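/- Let $\mathbb H$ be the quaternions, $S^3\subset\mathbb H$ the group of unit quaternions, $S^7\subset\mathbb H^2$ and $S^4\subset\mathbb R\times\mathbb H$ the unit spheres, and $h,\tilde h:S^7\to S^4$ the maps $h(a,b)=(|a|^2-|b|^2,\,2a\bar b)$ and $\tilde h(a,b)=(|a|^2-|b|^2,\,2\bar a b)$. Let $Sp(2)$ be the group of quaternionic unitary $2\times 2$ matrices, and for $m\ge 2$ put $$Sp(2,m)=\{(u_1,\dots,u_m)\in (S^7)^m \mid h(u_1)=-h(u_2),\ \tilde h(u_i)=-h(u_{i+1})\text{ for } 2\le i\le m-1\}.$$ Let $m>2$. Then: 1. $Sp(2,m)$ is a smooth embedded submanifold of $(\mathbb H^2)^m$ of dimension $3m+4$. 2. The map $Sp(2,m)\to Sp(2,m-1)$, $(u_1,\dots,u_m)\mapsto(u_1,\dots,u_{m-1})$, with the $S^3$-action $q\cdot(u_1,\dots,u_m)=(u_1,\dots,u_{m-1},u_m\bar q)$, is a trivial smooth principal $S^3$-bundle: there is an $S^3$-equivariant diffeomorphism $Sp(2,m-1)\times S^3\to Sp(2,m)$ over $Sp(2,m-1)$. 3. $Sp(2,m)$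 is diffeomorphic to $(S^3)^{m-2}\times Sp(2)$. 4. $Sp(2,m)$ admits a Riemannian metric of positive Ricci curvature that is invariant under the action of $S^3\times(S^3)^m$ given by $$(p;q_1,\dots,q_m)\cdot(u_1,\dots,u_m)=(p\,u_1\bar q_1,\ p\,u_2\bar q_2,\ q_2u_3\bar q_3,\ \dots,\ q_{m-1}u_m\bar q_m);$$ in particular it is invariant under the $(S^3)^m$-action obtained by setting $p=1$. -/

import Mathlib

open scoped Quaternion ContDiff

noncomputable section

namespace Wilhelm

/-! ### Embedded submanifolds, diffeomorphisms, Riemannian metrics, Ricci curvature -/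

section Submanifolds

variable {E F : Type*} [NormedAddCommGroup E] [NormedSpace ℝ E]
  [NormedAddCommGroup F] [NormedSpace ℝ F]

/-- `φ : U → S`, with `U` open in `ℝ^d`, is a local parametrization of `S ⊆ E`: a smooth immersion
that is a homeomorphism of `U` onto a relatively open subset of `S`. -/
def IsLocalParam {d : ℕ} (S : Set E) (U : Set (Fin d → ℝ)) (φ : (Fin d → ℝ) → E) : Prop :=
  IsOpen U ∧ ContDiffOn ℝ ∞ φ U ∧ (∀ x ∈ U, Function.Injective (fderiv ℝ φ x)) ∧
    (∃ W : Set E, IsOpen W ∧ φ '' U = S ∩ W) ∧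
    ∃ ψ : E → (Fin d → ℝ), ContinuousOn ψ (φ '' U) ∧ Set.LeftInvOn ψ φ U

/-- `S` is a smooth embedded `d`-dimensional submanifold of `E`. -/
def IsSubmanifold (d : ℕ) (S : Set E) : Prop :=
  ∀ p ∈ S, ∃ (U : Set (Fin d → ℝ)) (φ : (Fin d → ℝ) → E), IsLocalParam S U φ ∧ p ∈ φ '' U

/-- `f` restricts to a diffeomorphism from the submanifold `S` onto the submanifold `T`. The values
of `f` and of its inverse `k` off `S` and `T` are irrelevant. -/
def IsDiffeo (f : E → F) (S : Set E) (T : Set F) : Prop :=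
  ContDiffOn ℝ ∞ f S ∧ Set.MapsTo f S T ∧
    ∃ k : F → E, ContDiffOn ℝ ∞ k T ∧ Set.MapsTo k T S ∧
      Set.LeftInvOn k f S ∧ Set.RightInvOn k f T

/-- The submanifolds `S` and `T` are diffeomorphic. -/
def AreDiffeomorphic (S : Set E) (T : Set F) : Prop := ∃ f : E → F, IsDiffeo f S T

/-- The tangent space of `S` at `p`: the velocities at `p` of smooth curves in `S`. -/
def tangentVectors (S : Set E) (p : E) : Set E :=
  {v | ∃ (ε : ℝ) (c : ℝ → E), 0 < ε ∧ ContDiffOn ℝ ∞ c (Set.Ioo (-ε) ε) ∧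
    (∀ t ∈ Set.Ioo (-ε) ε, c t ∈ S) ∧ c 0 = p ∧ HasDerivAt c v 0}

/-- `g` is a smooth Riemannian metric on the submanifold `S`. Only the restriction of `g p`
to the tangent space at `p ∈ S` carries information. -/
def IsRiemannianMetric (S : Set E) (g : E → E →L[ℝ] E →L[ℝ] ℝ) : Prop :=
  ContDiffOn ℝ ∞ g S ∧ ∀ p ∈ S,
    (∀ v ∈ tangentVectors S p, ∀ w ∈ tangentVectors S p, g p v w = g p w v) ∧
    (∀ v ∈ tangentVectors S p, v ≠ 0 → 0 < g p v v)

/-- The transformation `A` maps `S` into itself and preserves the Riemannian metric `g`. -/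
def PreservesMetric (S : Set E) (g : E → E →L[ℝ] E →L[ℝ] ℝ) (A : E → E) : Prop :=
  Set.MapsTo A S S ∧ ∀ p ∈ S, ∀ v ∈ tangentVectors S p, ∀ w ∈ tangentVectors S p,
    g (A p) (fderiv ℝ A p v) (fderiv ℝ A p w) = g p v w

/-- The partial derivative `∂_i f`. -/
def pderiv {d : ℕ} (i : Fin d) (f : (Fin d → ℝ) → ℝ) (x : Fin d → ℝ) : ℝ :=
  fderiv ℝ f x (Pi.single i 1)

/-- The matrix `g_{ij}` of the metric `g` in the local parametrization `φ`. -/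
def metricCoeff {d : ℕ} (g : E → E →L[ℝ] E →L[ℝ] ℝ) (φ : (Fin d → ℝ) → E) (x : Fin d → ℝ) :
    Matrix (Fin d) (Fin d) ℝ :=
  Matrix.of fun i j => g (φ x) (fderiv ℝ φ x (Pi.single i 1)) (fderiv ℝ φ x (Pi.single j 1))

/-- The Christoffel symbols `Γ^k_{ij}` of a metric `G` on an open subset of `ℝ^d`. -/
def christoffel {d : ℕ} (G : (Fin d → ℝ) → Matrix (Fin d) (Fin d) ℝ) (k i j : Fin d)
    (x : Fin d → ℝ) : ℝ :=
  (1 / 2) * ∑ l, (G x)⁻¹ k l *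
    (pderiv i (fun y => G y j l) x + pderiv j (fun y => G y i l) x - pderiv l (fun y => G y i j) x)

/-- The coefficients `R_{ij}` of the Ricci tensor of a metric `G` on an open subset of `ℝ^d`. -/
def ricci {d : ℕ} (G : (Fin d → ℝ) → Matrix (Fin d) (Fin d) ℝ) (i j : Fin d)
    (x : Fin d → ℝ) : ℝ :=
  ∑ k, (pderiv k (christoffel G k i j) x - pderiv j (christoffel G k i k) x +
    ∑ l, (christoffel G k k l x * christoffel G l i j x -
      christoffel G k j l x * christoffel G l i k x))

/-- The metric `g` on the `d`-dimensional submanifold `S` has positive Ricci curvature: at each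
point, the Ricci tensor is positive definite when computed in a local parametrization around
the point (being a tensor, it is then so in every such parametrization). -/
def HasPosRicci (d : ℕ) (S : Set E) (g : E → E →L[ℝ] E →L[ℝ] ℝ) : Prop :=
  ∀ p ∈ S, ∃ (U : Set (Fin d → ℝ)) (φ : (Fin d → ℝ) → E) (x : Fin d → ℝ),
    IsLocalParam S U φ ∧ x ∈ U ∧ φ x = p ∧
      ∀ v : Fin d → ℝ, v ≠ 0 → 0 < ∑ i, ∑ j, ricci (metricCoeff g φ) i j x * v i * v j

end Submanifolds

/-! ### Spheres, Hopf maps, `Sp(2)` and `Sp(2,m)` -/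

/-- The group of unit quaternions. -/
def S3 : Set ℍ[ℝ] := Metric.sphere 0 1

/-- The unit sphere of `ℍ²`. -/
def S7 : Set (ℍ[ℝ] × ℍ[ℝ]) := {u | ‖u.1‖ ^ 2 + ‖u.2‖ ^ 2 = 1}

/-- `h (a, b) = (|a|² - |b|², 2 a b̄)`. -/
def hopf (u : ℍ[ℝ] × ℍ[ℝ]) : ℝ × ℍ[ℝ] := (‖u.1‖ ^ 2 - ‖u.2‖ ^ 2, 2 * (u.1 * star u.2))

/-- `h̃ (a, b) = (|a|² - |b|², 2 ā b)`. -/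
def hopfTilde (u : ℍ[ℝ] × ℍ[ℝ]) : ℝ × ℍ[ℝ] := (‖u.1‖ ^ 2 - ‖u.2‖ ^ 2, 2 * (star u.1 * u.2))

/-- `Sp(2)`: pairs of columns `((a, b), (c, d))` of quaternionic unitary `2 × 2` matrices. -/
def Sp2 : Set ((ℍ[ℝ] × ℍ[ℝ]) × (ℍ[ℝ] × ℍ[ℝ])) :=
  {Q | !![Q.1.1, Q.2.1; Q.1.2, Q.2.2] ∈ unitary (Matrix (Fin 2) (Fin 2) ℍ[ℝ])}

/-- `Sp(2,m)`: the `(u_1, …, u_m) ∈ (S⁷)^m` with `h(u_1) = -h(u_2)` and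
`h̃(u_i) = -h(u_{i+1})` for `2 ≤ i < m`; here the indices start at `0`. -/
def Sp2m (m : ℕ) : Set (Fin m → ℍ[ℝ] × ℍ[ℝ]) :=
  {u | (∀ i, u i ∈ S7) ∧ ∀ i j : Fin m, (j : ℕ) = (i : ℕ) + 1 →
    (if (i : ℕ) = 0 then hopf (u i) else hopfTilde (u i)) = -hopf (u j)}

/-- The product `(S³)^n`. -/
def S3pow (n : ℕ) : Set (Fin n → ℍ[ℝ]) := {q | ∀ i, q i ∈ S3}

/-- The projection `(u_1, …, u_m) ↦ (u_1, …, u_{m-1})`. -/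
def forgetLast (m : ℕ) (u : Fin m → ℍ[ℝ] × ℍ[ℝ]) : Fin (m - 1) → ℍ[ℝ] × ℍ[ℝ] :=
  fun i => u ⟨i, lt_of_lt_of_le i.isLt (Nat.sub_le m 1)⟩

/-- `a u b̄` for `u ∈ ℍ²`, with quaternions `a`, `b`. -/
def twoSided (a b : ℍ[ℝ]) (u : ℍ[ℝ] × ℍ[ℝ]) : ℍ[ℝ] × ℍ[ℝ] := (a * u.1 * star b, a * u.2 * star b)

/-- The principal action `q · (u_1, …, u_m) = (u_1, …, u_{m-1}, u_m q̄)`. -/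
def lastAction (m : ℕ) (q : ℍ[ℝ]) (u : Fin m → ℍ[ℝ] × ℍ[ℝ]) : Fin m → ℍ[ℝ] × ℍ[ℝ] :=
  fun i => if (i : ℕ) + 1 = m then twoSided 1 q (u i) else u i

/-- The action of `(p; q_1, …, q_m) ∈ S³ × (S³)^m`,
`(u_1, …, u_m) ↦ (p u_1 q̄_1, p u_2 q̄_2, q_2 u_3 q̄_3, …, q_{m-1} u_m q̄_m)`. The case `p = 1` is the
principal `(S³)^m`-action over `S⁴`. -/
def wilhelmAction (m : ℕ) (p : ℍ[ℝ]) (q : Fin m → ℍ[ℝ]) (u : Fin m → ℍ[ℝ] × ℍ[ℝ]) :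
    Fin m → ℍ[ℝ] × ℍ[ℝ] :=
  fun i => twoSided
    (if (i : ℕ) < 2 then p else q ⟨(i : ℕ) - 1, lt_of_le_of_lt (Nat.sub_le _ _) i.isLt⟩) (q i) (u i)

/-- `π : P → B`, with the action `act` of `S³` on `P`, is a trivial smooth principal `S³`-bundle:
there is an equivariant diffeomorphism `B × S³ → P` over `B`, where `S³` acts on `B × S³` by
multiplication on the second factor. -/
def IsTrivialPrincipalS3Bundle {E F : Type*} [NormedAddCommGroup E] [NormedSpace ℝ E]
    [NormedAddCommGroup F] [NormedSpace ℝ F] (P : Set E) (B : Set F) (π : E → F)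
    (act : ℍ[ℝ] → E → E) : Prop :=
  ∃ Ψ : F × ℍ[ℝ] → E, IsDiffeo Ψ (B ×ˢ S3) P ∧
    ∀ b ∈ B, ∀ s ∈ S3, π (Ψ (b, s)) = b ∧ ∀ q ∈ S3, Ψ (b, q * s) = act q (Ψ (b, s))

end Wilhelm

end

noncomputable section

namespace Wilhelm

/-! ### Smoothness of quaternionic conjugation -/

/-! For unit columns of `ℍ²`, antipodal Hopf images mean orthogonality (`hopf_eq_neg_iff`). A point
of `Sp2m m` is therefore a chain of unit columns with `u 1 ⟂ u 0` and `u (i+1) ⟂ cj (u i)` for `i ≥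
1`, where `cj` is entrywise conjugation (`mem_Sp2m_iff`).

Bundle. Let `x` be the last column but one. The last column ranges over the unit columns orthogonal
to `cj x`, which form a copy of S³, so triviality amounts to choosing one of them smoothly. The
condition on `x` already provides a unit column orthogonal to `x` itself, and it has to be moved to
the complement of `cj x`. Conjugation is `-1` on the even-dimensional space Im ℍ ⊕ Im ℍ, hence the
cube of a 60° rotation (`rot_rot_rot`). Each 60° step keeps old and new columns non-orthogonal
(`ip_rot_ne_zero`), so projecting and normalizing never degenerates. This gives `lastSection` and
`isDiffeo_trivialize`; induction from `Sp(2,2) = Sp(2)` gives the product.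

Metric. `Sp2m m` is a principal `(S³)^m`-bundle over S⁴ with connection form `conn`. The metric
`connMetric` is the round metric of curvature 4 on the base plus `t²` times the squared length of
the connection form, so its fibres are products of round 3-spheres of radius `t`. The connection
form transforms by conjugation under the action (`conn_gauge`), hence invariance
(`preservesMetric_wilhelmAction`). In an orthonormal frame the Ricci tensor has horizontal block `12
- O(t²)`, mixed block `O(t)` and vertical block at least `2/t²`, so it is positive for small `t`;
compactness makes one `t` work everywhere.

Curvature. The Ricci tensor at a point where the metric matrix is the identity is an algebraic
expression in the two-jet of the metric (`ricci_eq_jetRicci`). Around each `p` the chart `param`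
combines a section `sec` through `p` with central projections of the S³ factors. For this section
the radial component of the connection form vanishes at the centre along with its first derivative
(`hasDerivAt_form_radial`). So the form vanishes at the centre and its first derivative is
antisymmetric (`formD_antisymm`), which brings the two-jet to the shape `blockD`, `blockH`
(`jet_metricCoeff`). The estimate is `jetRicci_pos`, with constants from `exists_bound_form`. The
same chart shows that `Sp2m m` is a submanifold (`exists_isLocalParam`). -/

/-- Quaternionic conjugation as a continuous real-linear map. -/
def starQ : ℍ[ℝ] →L[ℝ] ℍ[ℝ] :=
  LinearMap.toContinuousLinearMap
    { toFun := star
      map_add' := star_add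
      map_smul' := fun r a => by simp }

/-- The real part as a continuous real-linear map. -/
def reQ : ℍ[ℝ] →L[ℝ] ℝ :=
  LinearMap.toContinuousLinearMap
    { toFun := fun a => a.re
      map_add' := fun _ _ => by simp
      map_smul' := fun _ _ => by simp }

section Smooth

variable {E : Type*} [NormedAddCommGroup E] [NormedSpace ℝ E] {n : WithTop ℕ∞}

@[fun_prop]
lemma contDiffAt_starQ {f : E → ℍ[ℝ]} {x : E} (hf : ContDiffAt ℝ n f x) :
    ContDiffAt ℝ n (fun x => star (f x)) x :=
  starQ.contDiff.contDiffAt.comp x hf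

@[fun_prop]
lemma contDiffAt_reQ {f : E → ℍ[ℝ]} {x : E} (hf : ContDiffAt ℝ n f x) :
    ContDiffAt ℝ n (fun x => (f x).re) x :=
  reQ.contDiff.contDiffAt.comp x hf

end Smooth

lemma two_ne_zero_quaternion : (2 : ℍ[ℝ]) ≠ 0 := by
  intro h
  have h2 : ((2 : ℝ) : ℍ[ℝ]) = ((0 : ℝ) : ℍ[ℝ]) := by exact_mod_cast h
  exact two_ne_zero (Quaternion.coe_injective h2)

/-! ### The quaternionic Hermitian product on `ℍ²` -/

/-- The Hermitian product `x* y` of two columns `x, y ∈ ℍ²`. -/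
def ip (x y : ℍ[ℝ] × ℍ[ℝ]) : ℍ[ℝ] := star x.1 * y.1 + star x.2 * y.2

/-- Entrywise conjugation on `ℍ²`. -/
def cj (x : ℍ[ℝ] × ℍ[ℝ]) : ℍ[ℝ] × ℍ[ℝ] := (star x.1, star x.2)

/-- Left multiplication of a column by a quaternion. -/
def lm (a : ℍ[ℝ]) (x : ℍ[ℝ] × ℍ[ℝ]) : ℍ[ℝ] × ℍ[ℝ] := (a * x.1, a * x.2)

/-- Right multiplication of a column by a quaternion. -/
def rm (x : ℍ[ℝ] × ℍ[ℝ]) (b : ℍ[ℝ]) : ℍ[ℝ] × ℍ[ℝ] := (x.1 * b, x.2 * b)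

section Algebra

variable (x y z : ℍ[ℝ] × ℍ[ℝ]) (a b : ℍ[ℝ])

lemma star_ip : star (ip x y) = ip y x := by simp [ip]

lemma ip_rm : ip x (rm y b) = ip x y * b := by simp [ip, rm, add_mul, mul_assoc]

lemma ip_rm_left : ip (rm x b) y = star b * ip x y := by simp [ip, rm, mul_add, mul_assoc]

lemma ip_lm_left : ip (lm a x) y = ip x (lm (star a) y) := by simp [ip, lm, mul_assoc]

lemma ip_add : ip x (y + z) = ip x y + ip x z := by simp [ip, mul_add]; abel

lemma ip_sub : ip x (y - z) = ip x y - ip x z := by simp [ip, mul_sub]; abel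

lemma ip_add_left : ip (x + y) z = ip x z + ip y z := by simp [ip, add_mul]; abel

lemma ip_sub_left : ip (x - y) z = ip x z - ip y z := by simp [ip, sub_mul]; abel

lemma ip_smul (r : ℝ) : ip x (r • y) = r • ip x y := by simp [ip]

lemma ip_smul_left (r : ℝ) : ip (r • x) y = r • ip x y := by simp [ip]

@[simp] lemma ip_zero : ip x 0 = 0 := by simp [ip]

lemma lm_lm : lm a (lm b x) = lm (a * b) x := by simp [lm, mul_assoc]

lemma rm_rm : rm (rm x a) b = rm x (a * b) := by simp [rm, mul_assoc]

lemma lm_rm : lm a (rm x b) = rm (lm a x) b := by simp [lm, rm, mul_assoc]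

@[simp] lemma lm_one : lm 1 x = x := by simp [lm]

@[simp] lemma rm_one : rm x 1 = x := by simp [rm]

@[simp] lemma lm_zero_left : lm 0 x = 0 := by simp [lm]

@[simp] lemma rm_zero : rm x 0 = 0 := by simp [rm]

lemma rm_add : rm x (a + b) = rm x a + rm x b := by simp [rm, mul_add]

lemma add_rm : rm (x + y) a = rm x a + rm y a := by simp [rm, add_mul]

lemma sub_rm : rm (x - y) a = rm x a - rm y a := by simp [rm, sub_mul]

lemma lm_add : lm a (x + y) = lm a x + lm a y := by simp [lm, mul_add]

lemma add_lm : lm (a + b) x = lm a x + lm b x := by simp [lm, add_mul]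

lemma smul_rm (r : ℝ) : rm (r • x) a = r • rm x a := by simp [rm]

lemma rm_smul (r : ℝ) : rm x (r • a) = r • rm x a := by simp [rm]

lemma rm_coe (r : ℝ) : rm x (r : ℍ[ℝ]) = r • x := by
  simp [rm, ← Quaternion.coe_commutes, Quaternion.coe_mul_eq_smul, Prod.smul_def]

lemma cj_lm : cj (lm a x) = rm (cj x) (star a) := by simp [cj, lm, rm]

lemma cj_rm : cj (rm x a) = lm (star a) (cj x) := by simp [cj, lm, rm]

lemma twoSided_eq : twoSided a b x = rm (lm a x) (star b) := rfl

lemma ip_self : ip x x = ((‖x.1‖ ^ 2 + ‖x.2‖ ^ 2 : ℝ) : ℍ[ℝ]) := by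
  simp [ip, Quaternion.star_mul_self, Quaternion.normSq_eq_norm_mul_self, sq]

lemma star_mul_self_eq (a : ℍ[ℝ]) : star a * a = ((‖a‖ ^ 2 : ℝ) : ℍ[ℝ]) := by
  rw [Quaternion.star_mul_self, Quaternion.normSq_eq_norm_mul_self, sq]

lemma mul_star_self_eq (a : ℍ[ℝ]) : a * star a = ((‖a‖ ^ 2 : ℝ) : ℍ[ℝ]) := by
  rw [Quaternion.self_mul_star, Quaternion.normSq_eq_norm_mul_self, sq]

variable {x y z a b}

lemma mem_S7_iff : x ∈ S7 ↔ ip x x = 1 := by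
  rw [ip_self, S7, Set.mem_ofPred_eq]
  constructor
  · intro h; rw [h]; simp
  · intro h
    exact Quaternion.coe_injective (h.trans Quaternion.coe_one.symm)

lemma mem_S3_iff : a ∈ S3 ↔ ‖a‖ = 1 := by simp [S3]

lemma star_mul_self_of_norm (h : ‖a‖ = 1) : star a * a = 1 := by
  rw [star_mul_self_eq, h]; simp

lemma mul_star_self_of_norm (h : ‖a‖ = 1) : a * star a = 1 := by
  rw [mul_star_self_eq, h]; simp

lemma norm_eq_one_of_star_mul (h : star a * a = 1) : ‖a‖ = 1 := by
  rw [star_mul_self_eq] at h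
  have := Quaternion.coe_injective (h.trans Quaternion.coe_one.symm)
  exact (pow_eq_one_iff_of_nonneg (norm_nonneg a) two_ne_zero).1 this

lemma lm_star_lm (h : ‖a‖ = 1) : lm (star a) (lm a x) = x := by
  rw [lm_lm, star_mul_self_of_norm h, lm_one]

lemma lm_lm_star (h : ‖a‖ = 1) : lm a (lm (star a) x) = x := by
  rw [lm_lm, mul_star_self_of_norm h, lm_one]

lemma ip_lm_lm (h : ‖a‖ = 1) : ip (lm a x) (lm a y) = ip x y := by
  rw [ip_lm_left, lm_star_lm h]

lemma hopfTilde_eq : hopfTilde x = hopf (cj x) := by simp [hopfTilde, hopf, cj]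

lemma cj_mem_S7 (h : x ∈ S7) : cj x ∈ S7 := by simpa [S7, cj] using h

lemma norm_sq_fst_add (h : ip x x = 1) : ‖x.1‖ ^ 2 + ‖x.2‖ ^ 2 = 1 := mem_S7_iff.2 h

/-- Two unit columns are orthogonal iff their images under the Hopf map are antipodal. -/
lemma hopf_eq_neg_iff (hx : ip x x = 1) (hy : ip y y = 1) : hopf x = -hopf y ↔ ip x y = 0 := by
  obtain ⟨a, b⟩ := x
  obtain ⟨c, d⟩ := y
  have h1 := norm_sq_fst_add hx
  have h2 := norm_sq_fst_add hy
  simp only [hopf, ip, Prod.neg_mk, Prod.mk.injEq] at *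
  constructor
  · rintro ⟨h3, h4⟩
    have had : ‖a‖ ^ 2 = ‖d‖ ^ 2 := by linarith
    have h5 : a * star b = -(c * star d) := by
      have h6 : (2 : ℍ[ℝ]) * (a * star b) = 2 * (-(c * star d)) := by rw [h4]; simp
      exact mul_left_cancel₀ two_ne_zero_quaternion h6
    -- If `a = 0`, equality of norms forces `d = 0` and all terms vanish. Otherwise multiplying the
    -- wanted sum by `a` from the left gives `(‖a‖² - ‖d‖²) c = 0`, and `a` cancels.
    by_cases ha : a = 0
    · subst ha
      have : d = 0 := by
        have : ‖d‖ ^ 2 = 0 := by rw [← had]; simp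
        simpa using this
      simp [this]
    · have : a * (star a * c + star b * d) = 0 := by
        rw [mul_add, ← mul_assoc, ← mul_assoc, h5, mul_star_self_eq, neg_mul, mul_assoc c,
          star_mul_self_eq, had, Quaternion.coe_commutes, add_neg_cancel]
      exact (mul_eq_zero.1 this).resolve_left ha
  · intro h3
    have h4 : star a * c = -(star b * d) := eq_neg_of_add_eq_zero_left h3
    have h5 : ‖a‖ ^ 2 * ‖c‖ ^ 2 = ‖b‖ ^ 2 * ‖d‖ ^ 2 := by
      have := congrArg (fun q => ‖q‖ ^ 2) h4
      simpa [mul_pow] using this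
    have had : ‖a‖ ^ 2 = ‖d‖ ^ 2 := by
      have e1 : ‖b‖ ^ 2 = 1 - ‖a‖ ^ 2 := by linarith
      have e2 : ‖c‖ ^ 2 = 1 - ‖d‖ ^ 2 := by linarith
      rw [e1, e2] at h5; linarith
    refine ⟨by linarith, ?_⟩
    have h6 : a * star b + c * star d = 0 := by
      by_cases hd : d = 0
      · subst hd
        have : a = 0 := by
          have : ‖a‖ ^ 2 = 0 := by rw [had]; simp
          simpa using this
        simp [this]
      · have : (a * star b + c * star d) * d = 0 := by
          have h7 : star b * d = -(star a * c) := by rw [h4, neg_neg]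
          rw [add_mul, mul_assoc, mul_assoc, h7, star_mul_self_eq, mul_neg, ← mul_assoc,
            mul_star_self_eq, had, Quaternion.coe_commutes, neg_add_cancel]
        exact (mul_eq_zero.1 this).resolve_right hd
    rw [eq_neg_of_add_eq_zero_left h6]; simp

lemma hopfTilde_eq_neg_iff (hx : ip x x = 1) (hy : ip y y = 1) :
    hopfTilde x = -hopf y ↔ ip (cj x) y = 0 := by
  rw [hopfTilde_eq, hopf_eq_neg_iff _ hy]
  exact mem_S7_iff.1 (cj_mem_S7 (mem_S7_iff.2 hx))

/-- The rows of a matrix with orthonormal columns are orthonormal. -/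
lemma rows_of_orthonormal (hx : ip x x = 1) (hy : ip y y = 1) (hxy : ip x y = 0) :
    ‖x.1‖ ^ 2 + ‖y.1‖ ^ 2 = 1 ∧ ‖x.2‖ ^ 2 + ‖y.2‖ ^ 2 = 1 ∧
      x.1 * star x.2 + y.1 * star y.2 = 0 := by
  have h := (hopf_eq_neg_iff hx hy).2 hxy
  have h1 := norm_sq_fst_add hx
  have h2 := norm_sq_fst_add hy
  simp only [hopf, Prod.neg_mk, Prod.mk.injEq] at h
  obtain ⟨h3, h4⟩ := h
  refine ⟨by linarith, by linarith, ?_⟩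
  have h6 : (2 : ℍ[ℝ]) * (x.1 * star x.2) = 2 * (-(y.1 * star y.2)) := by rw [h4]; simp
  rw [mul_left_cancel₀ two_ne_zero_quaternion h6, neg_add_cancel]

/-- Two orthonormal columns form a basis of `ℍ²`. -/
lemma expand_of_orthonormal (hx : ip x x = 1) (hy : ip y y = 1) (hxy : ip x y = 0)
    (v : ℍ[ℝ] × ℍ[ℝ]) : rm x (ip x v) + rm y (ip y v) = v := by
  obtain ⟨h1, h2, h3⟩ := rows_of_orthonormal hx hy hxy
  have h4 : x.2 * star x.1 + y.2 * star y.1 = 0 := by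
    have := congrArg star h3
    simpa using this
  have e1 : x.1 * star x.1 + y.1 * star y.1 = 1 := by
    rw [mul_star_self_eq, mul_star_self_eq, ← Quaternion.coe_add, h1, Quaternion.coe_one]
  have e2 : x.2 * star x.2 + y.2 * star y.2 = 1 := by
    rw [mul_star_self_eq, mul_star_self_eq, ← Quaternion.coe_add, h2, Quaternion.coe_one]
  refine Prod.ext ?_ ?_
  · calc x.1 * (star x.1 * v.1 + star x.2 * v.2) + y.1 * (star y.1 * v.1 + star y.2 * v.2)
        = (x.1 * star x.1 + y.1 * star y.1) * v.1 + (x.1 * star x.2 + y.1 * star y.2) * v.2 := by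
          noncomm_ring
      _ = v.1 := by rw [e1, h3]; simp
  · calc x.2 * (star x.1 * v.1 + star x.2 * v.2) + y.2 * (star y.1 * v.1 + star y.2 * v.2)
        = (x.2 * star x.1 + y.2 * star y.1) * v.1 + (x.2 * star x.2 + y.2 * star y.2) * v.2 := by
          noncomm_ring
      _ = v.2 := by rw [e2, h4]; simp

end Algebra

section Smooth

variable {E : Type*} [NormedAddCommGroup E] [NormedSpace ℝ E] {n : WithTop ℕ∞}
  {f g : E → ℍ[ℝ] × ℍ[ℝ]} {a : E → ℍ[ℝ]} {x : E}

@[fun_prop]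
lemma contDiffAt_ip (hf : ContDiffAt ℝ n f x) (hg : ContDiffAt ℝ n g x) :
    ContDiffAt ℝ n (fun x => ip (f x) (g x)) x := by
  unfold ip; fun_prop

@[fun_prop]
lemma contDiffAt_cj (hf : ContDiffAt ℝ n f x) : ContDiffAt ℝ n (fun x => cj (f x)) x := by
  unfold cj; fun_prop

@[fun_prop]
lemma contDiffAt_lm (ha : ContDiffAt ℝ n a x) (hf : ContDiffAt ℝ n f x) :
    ContDiffAt ℝ n (fun x => lm (a x) (f x)) x := by
  unfold lm; fun_prop

@[fun_prop]
lemma contDiffAt_rm (hf : ContDiffAt ℝ n f x) (ha : ContDiffAt ℝ n a x) :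
    ContDiffAt ℝ n (fun x => rm (f x) (a x)) x := by
  unfold rm; fun_prop

end Smooth

/-! ### `Sp(2,m)` in terms of the Hermitian product -/

/-- The column to which `u_{i+1}` is orthogonal: `u_0` for `i = 0` and `cj u_i` for `i > 0`. -/
def pole (i : ℕ) (x : ℍ[ℝ] × ℍ[ℝ]) : ℍ[ℝ] × ℍ[ℝ] := if i = 0 then x else cj x

/-- Since `hopfTilde` is `hopf` after entrywise conjugation, the links after the first become
orthogonality to a conjugated column. All later arguments use this description. -/
lemma mem_Sp2m_iff {m : ℕ} {u : Fin m → ℍ[ℝ] × ℍ[ℝ]} :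
    u ∈ Sp2m m ↔ (∀ i, ip (u i) (u i) = 1) ∧
      ∀ i j : Fin m, (j : ℕ) = (i : ℕ) + 1 → ip (pole i (u i)) (u j) = 0 := by
  simp only [Sp2m, Set.mem_ofPred_eq, mem_S7_iff, pole]
  refine and_congr_right fun h => forall_congr' fun i => forall_congr' fun j =>
    imp_congr_right fun _ => ?_
  split_ifs
  · exact hopf_eq_neg_iff (h i) (h j)
  · exact hopfTilde_eq_neg_iff (h i) (h j)

lemma ip_cj_self {x : ℍ[ℝ] × ℍ[ℝ]} (h : ip x x = 1) : ip (cj x) (cj x) = 1 :=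
  mem_S7_iff.1 (cj_mem_S7 (mem_S7_iff.2 h))

lemma ip_pole_self {i : ℕ} {x : ℍ[ℝ] × ℍ[ℝ]} (h : ip x x = 1) : ip (pole i x) (pole i x) = 1 := by
  unfold pole; split_ifs
  · exact h
  · exact ip_cj_self h

/-! ### Projection to an orthogonal complement -/

/-- The squared length of a column. -/
def nsq (w : ℍ[ℝ] × ℍ[ℝ]) : ℝ := (ip w w).re

lemma ip_self_eq_nsq (w : ℍ[ℝ] × ℍ[ℝ]) : ip w w = ((nsq w : ℝ) : ℍ[ℝ]) := by
  rw [nsq, ip_self, Quaternion.re_coe]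

lemma nsq_eq (w : ℍ[ℝ] × ℍ[ℝ]) : nsq w = ‖w.1‖ ^ 2 + ‖w.2‖ ^ 2 := by
  rw [nsq, ip_self, Quaternion.re_coe]

lemma nsq_nonneg (w : ℍ[ℝ] × ℍ[ℝ]) : 0 ≤ nsq w := by rw [nsq_eq]; positivity

lemma nsq_eq_zero {w : ℍ[ℝ] × ℍ[ℝ]} : nsq w = 0 ↔ w = 0 := by
  rw [nsq_eq, Prod.ext_iff]
  constructor
  · intro h
    constructor
    · have : ‖w.1‖ ^ 2 = 0 := by nlinarith [sq_nonneg ‖w.1‖, sq_nonneg ‖w.2‖]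
      simpa using this
    · have : ‖w.2‖ ^ 2 = 0 := by nlinarith [sq_nonneg ‖w.1‖, sq_nonneg ‖w.2‖]
      simpa using this
  · rintro ⟨h1, h2⟩; rw [h1, h2]; simp

@[fun_prop]
lemma contDiffAt_nsq {E : Type*} [NormedAddCommGroup E] [NormedSpace ℝ E] {n : WithTop ℕ∞}
    {f : E → ℍ[ℝ] × ℍ[ℝ]} {x : E} (hf : ContDiffAt ℝ n f x) :
    ContDiffAt ℝ n (fun x => nsq (f x)) x := by
  unfold nsq; fun_prop

/-- The component of `y` orthogonal to the unit column `x`. -/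
def orth (x y : ℍ[ℝ] × ℍ[ℝ]) : ℍ[ℝ] × ℍ[ℝ] := y - rm x (ip x y)

/-- The normalized component of `y` orthogonal to the unit column `x`. -/
def northo (x y : ℍ[ℝ] × ℍ[ℝ]) : ℍ[ℝ] × ℍ[ℝ] := (√(nsq (orth x y)))⁻¹ • orth x y

lemma ip_orth {x y : ℍ[ℝ] × ℍ[ℝ]} (hx : ip x x = 1) : ip x (orth x y) = 0 := by
  rw [orth, ip_sub, ip_rm, hx, one_mul, sub_self]

lemma ip_northo {x y : ℍ[ℝ] × ℍ[ℝ]} (hx : ip x x = 1) : ip x (northo x y) = 0 := by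
  rw [northo, ip_smul, ip_orth hx, smul_zero]

lemma ip_northo_self {x y : ℍ[ℝ] × ℍ[ℝ]} (h : orth x y ≠ 0) :
    ip (northo x y) (northo x y) = 1 := by
  have h0 : 0 < nsq (orth x y) := lt_of_le_of_ne (nsq_nonneg _) fun h' => h (nsq_eq_zero.1 h'.symm)
  rw [northo, ip_smul, ip_smul_left, ip_self_eq_nsq, smul_smul, ← Quaternion.coe_smul,
    ← Quaternion.coe_one]
  congr 1
  rw [smul_eq_mul, ← mul_inv, Real.mul_self_sqrt h0.le, inv_mul_cancel₀ h0.ne']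

/-- Otherwise `y = x' λ` with `λ = ip x' y`, and `0 = ip x y = ip x x' * λ` forces `λ = 0`, hence `y
= 0`. So a unit column orthogonal to `x` can be projected to the complement of any `x'` that is not
orthogonal to `x`. -/
lemma orth_ne_zero {x x' y : ℍ[ℝ] × ℍ[ℝ]} (hy : ip y y = 1) (hxy : ip x y = 0)
    (h : ip x x' ≠ 0) : orth x' y ≠ 0 := by
  intro h0
  have h1 : y = rm x' (ip x' y) := sub_eq_zero.1 h0
  have h2 : ip x x' * ip x' y = 0 := by rw [← ip_rm, ← h1, hxy]
  have h3 := (mul_eq_zero.1 h2).resolve_left h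
  rw [h3, rm_zero] at h1
  rw [h1] at hy
  simp at hy

@[fun_prop]
lemma contDiffAt_orth {E : Type*} [NormedAddCommGroup E] [NormedSpace ℝ E] {n : WithTop ℕ∞}
    {f g : E → ℍ[ℝ] × ℍ[ℝ]} {x : E} (hf : ContDiffAt ℝ n f x) (hg : ContDiffAt ℝ n g x) :
    ContDiffAt ℝ n (fun x => orth (f x) (g x)) x := by
  unfold orth; fun_prop

lemma contDiffAt_northo {E : Type*} [NormedAddCommGroup E] [NormedSpace ℝ E] {n : WithTop ℕ∞}
    {f g : E → ℍ[ℝ] × ℍ[ℝ]} {x : E} (hf : ContDiffAt ℝ n f x) (hg : ContDiffAt ℝ n g x)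
    (h : orth (f x) (g x) ≠ 0) : ContDiffAt ℝ n (fun x => northo (f x) (g x)) x := by
  have h0 : 0 < nsq (orth (f x) (g x)) :=
    lt_of_le_of_ne (nsq_nonneg _) fun h' => h (nsq_eq_zero.1 h'.symm)
  have h1 : ContDiffAt ℝ n (fun x => √(nsq (orth (f x) (g x)))) x :=
    ContDiffAt.sqrt (by fun_prop) h0.ne'
  have h2 : ContDiffAt ℝ n (fun x => (√(nsq (orth (f x) (g x))))⁻¹) x :=
    h1.inv (Real.sqrt_pos.2 h0).ne'
  have h3 : ContDiffAt ℝ n (fun x => orth (f x) (g x)) x := by fun_prop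
  exact h2.smul h3

/-! ### Entrywise conjugation as the cube of a rotation -/

/-- The rotation of `ℍ²` by 60° in the three planes of `Im ℍ ⊕ Im ℍ`. -/
def rot (x : ℍ[ℝ] × ℍ[ℝ]) : ℍ[ℝ] × ℍ[ℝ] :=
  ((3 / 4 : ℝ) • x.1 + (1 / 4 : ℝ) • star x.1 - (√3 / 4) • (x.2 - star x.2),
    (3 / 4 : ℝ) • x.2 + (1 / 4 : ℝ) • star x.2 + (√3 / 4) • (x.1 - star x.1))

/-- Real parts are fixed. On each plane of matching imaginary coordinates `rot` has cosine `3/4 -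
1/4 = 1/2` and sine `√3/2`, so its cube is `-1` there. -/
lemma rot_rot_rot (x : ℍ[ℝ] × ℍ[ℝ]) : rot (rot (rot x)) = cj x := by
  have h3 : √3 * √3 = 3 := Real.mul_self_sqrt (by norm_num)
  obtain ⟨a, b⟩ := x
  simp only [rot, cj]
  refine Prod.ext ?_ ?_ <;> ext <;> simp
  · ring
  · linear_combination (-3 / 8 * a.imI + √3 * b.imI / 8) * h3
  · linear_combination (-3 / 8 * a.imJ + √3 * b.imJ / 8) * h3
  · linear_combination (-3 / 8 * a.imK + √3 * b.imK / 8) * h3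
  · ring
  · linear_combination (-3 / 8 * b.imI - √3 * a.imI / 8) * h3
  · linear_combination (-3 / 8 * b.imJ - √3 * a.imJ / 8) * h3
  · linear_combination (-3 / 8 * b.imK - √3 * a.imK / 8) * h3

lemma re_ip (x y : ℍ[ℝ] × ℍ[ℝ]) : (ip x y).re =
    x.1.re * y.1.re + x.1.imI * y.1.imI + x.1.imJ * y.1.imJ + x.1.imK * y.1.imK +
    (x.2.re * y.2.re + x.2.imI * y.2.imI + x.2.imJ * y.2.imJ + x.2.imK * y.2.imK) := by
  simp [ip]

lemma nsq_rot (x : ℍ[ℝ] × ℍ[ℝ]) : nsq (rot x) = nsq x := by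
  have h3 : √3 * √3 = 3 := Real.mul_self_sqrt (by norm_num)
  obtain ⟨a, b⟩ := x
  simp only [rot, nsq, re_ip]
  simp
  linear_combination (1 / 4 * (a.imI ^ 2 + a.imJ ^ 2 + a.imK ^ 2 + b.imI ^ 2 + b.imJ ^ 2 +
    b.imK ^ 2)) * h3

/-- The real part is the squared length of the real coordinates plus half that of the imaginary ones
(cos 60° = 1/2), hence at least `1/2`. A single step of 180° would lack this. -/
lemma ip_rot_ne_zero {x : ℍ[ℝ] × ℍ[ℝ]} (hx : ip x x = 1) : ip x (rot x) ≠ 0 := by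
  intro h
  have h1 := congrArg (fun q : ℍ[ℝ] => q.re) h
  have h2 := congrArg (fun q : ℍ[ℝ] => q.re) hx
  obtain ⟨a, b⟩ := x
  simp only [rot, re_ip] at h1 h2
  simp at h1 h2
  nlinarith [sq_nonneg a.re, sq_nonneg b.re]

lemma ip_rot_self {x : ℍ[ℝ] × ℍ[ℝ]} (hx : ip x x = 1) : ip (rot x) (rot x) = 1 := by
  rw [ip_self_eq_nsq, nsq_rot, ← ip_self_eq_nsq, hx]

@[fun_prop]
lemma contDiffAt_rot {E : Type*} [NormedAddCommGroup E] [NormedSpace ℝ E] {n : WithTop ℕ∞}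
    {f : E → ℍ[ℝ] × ℍ[ℝ]} {x : E} (hf : ContDiffAt ℝ n f x) :
    ContDiffAt ℝ n (fun x => rot (f x)) x := by
  unfold rot; fun_prop

/-- For orthonormal `x, y`, a unit column orthogonal to `cj x` that depends smoothly on `x`
and `y`: transport `y` along the path from `x` to `cj x` in three steps of 60°. -/
def transport (x y : ℍ[ℝ] × ℍ[ℝ]) : ℍ[ℝ] × ℍ[ℝ] :=
  northo (rot (rot (rot x))) (northo (rot (rot x)) (northo (rot x) y))

section Transport

variable {x y : ℍ[ℝ] × ℍ[ℝ]}

lemma northo_rot (hx : ip x x = 1) (hy : ip y y = 1) (hxy : ip x y = 0) :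
    orth (rot x) y ≠ 0 ∧ ip (northo (rot x) y) (northo (rot x) y) = 1 ∧
      ip (rot x) (northo (rot x) y) = 0 :=
  have h := orth_ne_zero hy hxy (ip_rot_ne_zero hx)
  ⟨h, ip_northo_self h, ip_northo (ip_rot_self hx)⟩

/-- Every step returns an orthonormal pair and so can be repeated; after three steps the first
member is `cj x`. -/
lemma transport_spec (hx : ip x x = 1) (hy : ip y y = 1) (hxy : ip x y = 0) :
    ip (transport x y) (transport x y) = 1 ∧ ip (cj x) (transport x y) = 0 := by
  obtain ⟨-, h1, h2⟩ := northo_rot hx hy hxy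
  obtain ⟨-, h3, h4⟩ := northo_rot (ip_rot_self hx) h1 h2
  obtain ⟨-, h5, h6⟩ := northo_rot (ip_rot_self (ip_rot_self hx)) h3 h4
  rw [← rot_rot_rot]
  exact ⟨h5, h6⟩

lemma contDiffAt_transport {E : Type*} [NormedAddCommGroup E] [NormedSpace ℝ E] {n : WithTop ℕ∞}
    {f g : E → ℍ[ℝ] × ℍ[ℝ]} {e : E} (hf : ContDiffAt ℝ n f e) (hg : ContDiffAt ℝ n g e)
    (hx : ip (f e) (f e) = 1) (hy : ip (g e) (g e) = 1) (hxy : ip (f e) (g e) = 0) :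
    ContDiffAt ℝ n (fun e => transport (f e) (g e)) e := by
  obtain ⟨k1, h1, h2⟩ := northo_rot hx hy hxy
  obtain ⟨k2, h3, h4⟩ := northo_rot (ip_rot_self hx) h1 h2
  obtain ⟨k3, -, -⟩ := northo_rot (ip_rot_self (ip_rot_self hx)) h3 h4
  unfold transport
  refine contDiffAt_northo (by fun_prop) (contDiffAt_northo (by fun_prop)
    (contDiffAt_northo (by fun_prop) hg k1) k2) k3

end Transport

/-! ### The bundle `Sp(2,m) → Sp(2,m-1)` is trivial -/

section Bundle

variable {k : ℕ}

/-- A smooth choice of a last entry `u_{k+3}` for `(u_1, …, u_{k+2}) ∈ Sp(2,k+2)`. -/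
def lastSection (b : Fin (k + 2) → ℍ[ℝ] × ℍ[ℝ]) : ℍ[ℝ] × ℍ[ℝ] :=
  transport (b (Fin.last (k + 1))) (pole k (b (Fin.last k).castSucc))

/-- The input for `transport`: the last link of the chain, read backwards, exhibits a unit column
orthogonal to the last one. -/
lemma lastSection_aux {b : Fin (k + 2) → ℍ[ℝ] × ℍ[ℝ]} (hb : b ∈ Sp2m (k + 2)) :
    ip (b (Fin.last (k + 1))) (b (Fin.last (k + 1))) = 1 ∧
    ip (pole k (b (Fin.last k).castSucc)) (pole k (b (Fin.last k).castSucc)) = 1 ∧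
    ip (b (Fin.last (k + 1))) (pole k (b (Fin.last k).castSucc)) = 0 := by
  rw [mem_Sp2m_iff] at hb
  refine ⟨hb.1 _, ip_pole_self (hb.1 _), ?_⟩
  have := hb.2 (Fin.last k).castSucc (Fin.last (k + 1)) (by simp)
  rw [← star_ip]
  simpa using this

lemma lastSection_spec {b : Fin (k + 2) → ℍ[ℝ] × ℍ[ℝ]} (hb : b ∈ Sp2m (k + 2)) :
    ip (lastSection b) (lastSection b) = 1 ∧
      ip (cj (b (Fin.last (k + 1)))) (lastSection b) = 0 := by
  obtain ⟨h1, h2, h3⟩ := lastSection_aux hb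
  exact transport_spec h1 h2 h3

@[fun_prop]
lemma contDiffAt_pole {E : Type*} [NormedAddCommGroup E] [NormedSpace ℝ E] {n : WithTop ℕ∞}
    {f : E → ℍ[ℝ] × ℍ[ℝ]} {x : E} {i : ℕ} (hf : ContDiffAt ℝ n f x) :
    ContDiffAt ℝ n (fun x => pole i (f x)) x := by
  unfold pole; split_ifs <;> fun_prop

lemma contDiffAt_lastSection {E : Type*} [NormedAddCommGroup E] [NormedSpace ℝ E]
    {n : WithTop ℕ∞} {f : E → Fin (k + 2) → ℍ[ℝ] × ℍ[ℝ]} {e : E} (hf : ContDiffAt ℝ n f e)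
    (hb : f e ∈ Sp2m (k + 2)) : ContDiffAt ℝ n (fun e => lastSection (f e)) e := by
  obtain ⟨h1, h2, h3⟩ := lastSection_aux hb
  have hf' := contDiffAt_pi.1 hf
  exact contDiffAt_transport (hf' _) (contDiffAt_pole (hf' _)) h1 h2 h3

/-- The new link starts at index `k + 1`, which is never `0`, so its pole is always a conjugated
column. -/
lemma snoc_mem_Sp2m_iff {b : Fin (k + 2) → ℍ[ℝ] × ℍ[ℝ]} {x : ℍ[ℝ] × ℍ[ℝ]} :
    (Fin.snoc (α := fun _ => ℍ[ℝ] × ℍ[ℝ]) b x : Fin (k + 3) → ℍ[ℝ] × ℍ[ℝ]) ∈ Sp2m (k + 3) ↔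
      b ∈ Sp2m (k + 2) ∧ ip x x = 1 ∧ ip (cj (b (Fin.last (k + 1)))) x = 0 := by
  simp only [mem_Sp2m_iff]
  constructor
  · rintro ⟨h1, h2⟩
    refine ⟨⟨fun i => by simpa using h1 i.castSucc, fun i j hij => ?_⟩, ?_, ?_⟩
    · simpa using h2 i.castSucc j.castSucc (by simpa using hij)
    · simpa using h1 (Fin.last _)
    · simpa [pole] using h2 (Fin.last (k + 1)).castSucc (Fin.last _) (by simp)
  · rintro ⟨⟨h1, h2⟩, h3, h4⟩
    refine ⟨fun i => ?_, fun i j => ?_⟩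
    · induction i using Fin.lastCases with
      | last => simpa using h3
      | cast i => simpa using h1 i
    · induction j using Fin.lastCases with
      | last =>
        intro hi
        obtain rfl : i = (Fin.last (k + 1)).castSucc := Fin.ext (by simpa using hi.symm)
        simpa [pole] using h4
      | cast j =>
        induction i using Fin.lastCases with
        | last => intro hi; simp at hi; omega
        | cast i => intro hi; simpa using h2 i j (by simpa using hi)

/-- The trivialization `Sp(2,k+2) × S³ → Sp(2,k+3)`. -/
def trivialize (x : (Fin (k + 2) → ℍ[ℝ] × ℍ[ℝ]) × ℍ[ℝ]) : Fin (k + 3) → ℍ[ℝ] × ℍ[ℝ] :=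
  Fin.snoc (α := fun _ => ℍ[ℝ] × ℍ[ℝ]) x.1 (rm (lastSection x.1) (star x.2))

/-- The inverse of `trivialize`. -/
def untrivialize (u : Fin (k + 3) → ℍ[ℝ] × ℍ[ℝ]) : (Fin (k + 2) → ℍ[ℝ] × ℍ[ℝ]) × ℍ[ℝ] :=
  (Fin.init (α := fun _ => ℍ[ℝ] × ℍ[ℝ]) u,
    star (ip (lastSection (Fin.init (α := fun _ => ℍ[ℝ] × ℍ[ℝ]) u)) (u (Fin.last _))))

lemma contDiffOn_trivialize :
    ContDiffOn ℝ ∞ (trivialize (k := k)) (Sp2m (k + 2) ×ˢ S3) := by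
  rintro ⟨b, s⟩ ⟨hb, hs⟩
  refine ContDiffAt.contDiffWithinAt (contDiffAt_pi.2 fun i => ?_)
  have h1 : ContDiffAt ℝ ∞ (fun x : (Fin (k + 2) → ℍ[ℝ] × ℍ[ℝ]) × ℍ[ℝ] => lastSection x.1) (b, s) :=
    contDiffAt_lastSection (f := fun x : (Fin (k + 2) → ℍ[ℝ] × ℍ[ℝ]) × ℍ[ℝ] => x.1)
      contDiffAt_fst hb
  induction i using Fin.lastCases with
  | last => simp only [trivialize, Fin.snoc_last]; fun_prop
  | cast i => simp only [trivialize, Fin.snoc_castSucc]; fun_prop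

lemma contDiffOn_untrivialize :
    ContDiffOn ℝ ∞ (untrivialize (k := k)) (Sp2m (k + 3)) := by
  intro u hu
  have h0 : ContDiffAt ℝ ∞ (fun u : Fin (k + 3) → ℍ[ℝ] × ℍ[ℝ] =>
      Fin.init (α := fun _ => ℍ[ℝ] × ℍ[ℝ]) u) u := by
    unfold Fin.init; fun_prop
  rw [← Fin.snoc_init_self (α := fun _ => ℍ[ℝ] × ℍ[ℝ]) u, snoc_mem_Sp2m_iff] at hu
  have h1 := contDiffAt_lastSection h0 hu.1
  refine ContDiffAt.contDiffWithinAt (h0.prodMk ?_)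
  fun_prop

/-- `cj` of the previous column and `lastSection` form an orthonormal basis. A column orthogonal to
the former is a right multiple of the latter, with coefficient recovered by `ip`, and it is a unit
column exactly when the coefficient is a unit. -/
lemma isDiffeo_trivialize :
    IsDiffeo (trivialize (k := k)) (Sp2m (k + 2) ×ˢ S3) (Sp2m (k + 3)) := by
  refine ⟨contDiffOn_trivialize, ?_, untrivialize, contDiffOn_untrivialize, ?_, ?_, ?_⟩
  · rintro ⟨b, s⟩ ⟨hb, hs⟩
    obtain ⟨h1, h2⟩ := lastSection_spec hb
    have hs : ‖star s‖ = 1 := by simpa using mem_S3_iff.1 hs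
    refine snoc_mem_Sp2m_iff.2 ⟨hb, ?_, ?_⟩
    · rw [ip_rm, ip_rm_left, h1, mul_one, star_mul_self_of_norm hs]
    · rw [ip_rm, h2, zero_mul]
  · intro u hu
    rw [← Fin.snoc_init_self (α := fun _ => ℍ[ℝ] × ℍ[ℝ]) u, snoc_mem_Sp2m_iff] at hu
    obtain ⟨hb, h3, h4⟩ := hu
    obtain ⟨h1, h2⟩ := lastSection_spec hb
    have h5 := expand_of_orthonormal (ip_cj_self (lastSection_aux hb).1) h1 h2 (u (Fin.last _))
    rw [h4, rm_zero, zero_add] at h5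
    refine ⟨hb, mem_S3_iff.2 ?_⟩
    simp only [untrivialize, norm_star]
    refine norm_eq_one_of_star_mul ?_
    rw [← ip_rm_left, h5, h3]
  · rintro ⟨b, s⟩ ⟨hb, hs⟩
    obtain ⟨h1, h2⟩ := lastSection_spec hb
    simp [trivialize, untrivialize, ip_rm, h1]
  · intro u hu
    rw [← Fin.snoc_init_self (α := fun _ => ℍ[ℝ] × ℍ[ℝ]) u, snoc_mem_Sp2m_iff] at hu
    obtain ⟨hb, h3, h4⟩ := hu
    obtain ⟨h1, h2⟩ := lastSection_spec hb
    have h5 := expand_of_orthonormal (ip_cj_self (lastSection_aux hb).1) h1 h2 (u (Fin.last _))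
    rw [h4, rm_zero, zero_add] at h5
    simp only [trivialize, untrivialize, star_star, h5]
    exact Fin.snoc_init_self (α := fun _ => ℍ[ℝ] × ℍ[ℝ]) u

/-- The fibre coordinate enters `trivialize` conjugated, so multiplying it by `q` on the left
multiplies the last column by `star q` on the right, as the action does. -/
theorem isTrivialPrincipalS3Bundle_Sp2m (k : ℕ) :
    IsTrivialPrincipalS3Bundle (Sp2m (k + 3)) (Sp2m (k + 2)) (forgetLast (k + 3))
      (lastAction (k + 3)) := by
  refine ⟨trivialize, isDiffeo_trivialize, fun b hb s hs => ⟨?_, fun q hq => ?_⟩⟩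
  · funext i
    exact Fin.snoc_castSucc (α := fun _ => ℍ[ℝ] × ℍ[ℝ]) _ _ i
  · funext i
    induction i using Fin.lastCases with
    | last => simp [lastAction, trivialize, twoSided_eq, rm_rm]
    | cast i =>
      have : (i : ℕ) ≠ k + 2 := by omega
      simp [lastAction, trivialize, this]

end Bundle

/-! ### `Sp(2,m)` is diffeomorphic to `(S³)^{m-2} × Sp(2)` -/

section Diffeo

variable {E F G : Type*} [NormedAddCommGroup E] [NormedSpace ℝ E]
  [NormedAddCommGroup F] [NormedSpace ℝ F] [NormedAddCommGroup G] [NormedSpace ℝ G]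
  {S : Set E} {T : Set F} {R : Set G}

lemma AreDiffeomorphic.symm (h : AreDiffeomorphic S T) : AreDiffeomorphic T S := by
  obtain ⟨f, h1, h2, k, h3, h4, h5, h6⟩ := h
  exact ⟨k, h3, h4, f, h1, h2, h6, h5⟩

lemma AreDiffeomorphic.trans (h : AreDiffeomorphic S T) (h' : AreDiffeomorphic T R) :
    AreDiffeomorphic S R := by
  obtain ⟨f, h1, h2, k, h3, h4, h5, h6⟩ := h
  obtain ⟨f', h1', h2', k', h3', h4', h5', h6'⟩ := h'
  refine ⟨f' ∘ f, h1'.comp h1 h2, h2'.comp h2, k ∘ k', h3.comp h3' h4', h4.comp h4', ?_, ?_⟩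
  · intro x hx
    simp [h5' (h2 hx), h5 hx]
  · intro x hx
    simp [h6 (h4' hx), h6' hx]

lemma AreDiffeomorphic.prod_right (h : AreDiffeomorphic S T) (R : Set G) :
    AreDiffeomorphic (S ×ˢ R) (T ×ˢ R) := by
  obtain ⟨f, h1, h2, k, h3, h4, h5, h6⟩ := h
  refine ⟨Prod.map f id, h1.prodMap contDiffOn_id, fun x hx => ⟨h2 hx.1, hx.2⟩,
    Prod.map k id, h3.prodMap contDiffOn_id, fun x hx => ⟨h4 hx.1, hx.2⟩, ?_, ?_⟩
  · intro x hx
    exact Prod.ext (h5 hx.1) rfl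
  · intro x hx
    exact Prod.ext (h6 hx.1) rfl

end Diffeo

/-- The column relations are one half of unitarity; the other half concerns the rows and comes from
`rows_of_orthonormal`. -/
lemma mem_Sp2_iff {Q : (ℍ[ℝ] × ℍ[ℝ]) × (ℍ[ℝ] × ℍ[ℝ])} :
    Q ∈ Sp2 ↔ ip Q.1 Q.1 = 1 ∧ ip Q.2 Q.2 = 1 ∧ ip Q.1 Q.2 = 0 := by
  obtain ⟨⟨a, b⟩, ⟨c, d⟩⟩ := Q
  simp only [Sp2, Set.mem_ofPred_eq, Unitary.mem_iff]
  constructor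
  · rintro ⟨h, -⟩
    refine ⟨?_, ?_, ?_⟩
    · simpa [Matrix.mul_apply, Fin.sum_univ_two, ip] using congrFun (congrFun h 0) 0
    · simpa [Matrix.mul_apply, Fin.sum_univ_two, ip] using congrFun (congrFun h 1) 1
    · simpa [Matrix.mul_apply, Fin.sum_univ_two, ip] using congrFun (congrFun h 0) 1
  · rintro ⟨h1, h2, h3⟩
    have h4 : ip (c, d) (a, b) = 0 := by rw [← star_ip, h3, star_zero]
    obtain ⟨e1, e2, e3⟩ := rows_of_orthonormal h1 h2 h3
    have e4 : b * star a + d * star c = 0 := by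
      have := congrArg star e3
      simpa using this
    have e5 : a * star a + c * star c = 1 := by
      rw [mul_star_self_eq, mul_star_self_eq, ← Quaternion.coe_add, e1, Quaternion.coe_one]
    have e6 : b * star b + d * star d = 1 := by
      rw [mul_star_self_eq, mul_star_self_eq, ← Quaternion.coe_add, e2, Quaternion.coe_one]
    simp only [ip] at h1 h2 h3 h4
    constructor
    · ext1 i j
      fin_cases i <;> fin_cases j <;> simpa [Matrix.mul_apply, Fin.sum_univ_two]
    · ext1 i j
      fin_cases i <;> fin_cases j <;> simpa [Matrix.mul_apply, Fin.sum_univ_two]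

lemma areDiffeomorphic_Sp2m_two : AreDiffeomorphic (Sp2m 2) (S3pow 0 ×ˢ Sp2) := by
  have key : ∀ u : Fin 2 → ℍ[ℝ] × ℍ[ℝ], u ∈ Sp2m 2 ↔ (u 0, u 1) ∈ Sp2 := by
    intro u
    rw [mem_Sp2m_iff, mem_Sp2_iff]
    constructor
    · rintro ⟨h1, h2⟩
      exact ⟨h1 0, h1 1, by simpa [pole] using h2 0 1 (by simp)⟩
    · rintro ⟨h1, h2, h3⟩
      refine ⟨fun i => by fin_cases i <;> assumption, fun i j hij => ?_⟩
      obtain rfl : i = 0 := by omega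
      obtain rfl : j = 1 := by ext; simpa using hij
      simpa [pole] using h3
  refine ⟨fun u => (0, (u 0, u 1)), by fun_prop, fun u hu => ⟨fun i => i.elim0, (key u).1 hu⟩,
    fun x => ![x.2.1, x.2.2], ?_, ?_, ?_, ?_⟩
  · refine ContDiff.contDiffOn (contDiff_pi.2 fun i => ?_)
    fin_cases i <;> simp <;> fun_prop
  · rintro ⟨a, x⟩ ⟨-, hx⟩
    exact (key _).2 (by simpa using hx)
  · intro u _
    funext i
    fin_cases i <;> rfl
  · rintro ⟨a, x⟩ _
    refine Prod.ext (Subsingleton.elim _ _) rfl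

lemma areDiffeomorphic_S3pow_succ {E : Type*} [NormedAddCommGroup E] [NormedSpace ℝ E] (n : ℕ)
    (R : Set E) : AreDiffeomorphic ((S3pow n ×ˢ R) ×ˢ S3) (S3pow (n + 1) ×ˢ R) := by
  refine ⟨fun x => (Fin.snoc (α := fun _ => ℍ[ℝ]) x.1.1 x.2, x.1.2), ?_, ?_,
    fun y => ((Fin.init (α := fun _ => ℍ[ℝ]) y.1, y.2), y.1 (Fin.last n)), ?_, ?_, ?_, ?_⟩
  · refine ContDiff.contDiffOn (ContDiff.prodMk (contDiff_pi.2 fun i => ?_) (by fun_prop))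
    induction i using Fin.lastCases with
    | last => simp only [Fin.snoc_last]; fun_prop
    | cast i => simp only [Fin.snoc_castSucc]; fun_prop
  · rintro ⟨⟨q, r⟩, s⟩ ⟨⟨hq, hr⟩, hs⟩
    refine ⟨fun i => ?_, hr⟩
    induction i using Fin.lastCases with
    | last => simpa using hs
    | cast i => simpa using hq i
  · unfold Fin.init; fun_prop
  · rintro ⟨q, r⟩ ⟨hq, hr⟩
    exact ⟨⟨fun i => hq _, hr⟩, hq _⟩
  · rintro ⟨⟨q, r⟩, s⟩ _
    simp
  · rintro ⟨q, r⟩ _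
    simp

/-- Each trivial bundle in the tower contributes one factor S³; the base case is the pair of
orthonormal columns itself. -/
theorem areDiffeomorphic_Sp2m (n : ℕ) : AreDiffeomorphic (Sp2m (n + 2)) (S3pow n ×ˢ Sp2) := by
  induction n with
  | zero => exact areDiffeomorphic_Sp2m_two
  | succ n ih =>
    exact (AreDiffeomorphic.symm ⟨_, isDiffeo_trivialize⟩).trans
      ((ih.prod_right S3).trans (areDiffeomorphic_S3pow_succ n Sp2))

/-! ### The Ricci tensor in terms of the 2-jet of the metric -/

section Pderiv

variable {d : ℕ} {f g : (Fin d → ℝ) → ℝ} {x : Fin d → ℝ} {i : Fin d}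

lemma pderiv_congr (h : f =ᶠ[nhds x] g) : pderiv i f x = pderiv i g x := by
  rw [pderiv, pderiv, h.fderiv_eq]

lemma pderiv_add (hf : DifferentiableAt ℝ f x) (hg : DifferentiableAt ℝ g x) :
    pderiv i (fun y => f y + g y) x = pderiv i f x + pderiv i g x := by
  simp [pderiv, fderiv_fun_add hf hg]

lemma pderiv_sub (hf : DifferentiableAt ℝ f x) (hg : DifferentiableAt ℝ g x) :
    pderiv i (fun y => f y - g y) x = pderiv i f x - pderiv i g x := by
  simp [pderiv, fderiv_fun_sub hf hg]

lemma pderiv_mul (hf : DifferentiableAt ℝ f x) (hg : DifferentiableAt ℝ g x) :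
    pderiv i (fun y => f y * g y) x = f x * pderiv i g x + pderiv i f x * g x := by
  simp [pderiv, fderiv_fun_mul hf hg, mul_comm]

lemma pderiv_const_mul (c : ℝ) (hf : DifferentiableAt ℝ f x) :
    pderiv i (fun y => c * f y) x = c * pderiv i f x := by
  simp [pderiv, fderiv_const_mul hf]

@[simp] lemma pderiv_const (c : ℝ) : pderiv i (fun _ => c) x = 0 := by simp [pderiv]

lemma pderiv_sum {ι : Type*} {s : Finset ι} {F : ι → (Fin d → ℝ) → ℝ}
    (h : ∀ l ∈ s, DifferentiableAt ℝ (F l) x) :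
    pderiv i (fun y => ∑ l ∈ s, F l y) x = ∑ l ∈ s, pderiv i (F l) x := by
  simp [pderiv, fderiv_fun_sum h]

/-- Order `ω` is preserved by differentiation and, unlike order `∞` at a single point, holds on a
whole neighbourhood, as needed to differentiate a derivative formula again. -/
lemma contDiffAt_pderiv (hf : ContDiffAt ℝ ω f x) : ContDiffAt ℝ ω (pderiv i f) x := by
  unfold pderiv
  exact (hf.fderiv_right (m := ω) (by simp)).clm_apply contDiffAt_const

end Pderiv

section TwoJet

variable {ι : Type*} [Fintype ι]

/-- Christoffel symbols at a point where the metric is the identity matrix, in terms of the first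
derivatives `D k i j = ∂_k g_{ij}`. -/
def jetChristoffel (D : ι → ι → ι → ℝ) (k i j : ι) : ℝ := (1 / 2) * (D i j k + D j i k - D k i j)

/-- Derivatives of the Christoffel symbols at a point where the metric is the identity matrix, in
terms of `D k i j = ∂_k g_{ij}` and `H p k i j = ∂_p ∂_k g_{ij}`. -/
def jetDChristoffel (D : ι → ι → ι → ℝ) (H : ι → ι → ι → ι → ℝ) (p k i j : ι) : ℝ :=
  (1 / 2) * (H p i j k + H p j i k - H p k i j) - ∑ l, D p k l * jetChristoffel D l i j

/-- The Ricci tensor at a point where the metric is the identity matrix. -/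
def jetRicci (D : ι → ι → ι → ℝ) (H : ι → ι → ι → ι → ℝ) (i j : ι) : ℝ :=
  ∑ k, (jetDChristoffel D H k k i j - jetDChristoffel D H j k i k +
    ∑ l, (jetChristoffel D k k l * jetChristoffel D l i j -
      jetChristoffel D k j l * jetChristoffel D l i k))

lemma jetRicci_reindex {κ : Type*} [Fintype κ] (e : ι ≃ κ) (D : κ → κ → κ → ℝ)
    (H : κ → κ → κ → κ → ℝ) (i j : ι) :
    jetRicci (fun k i j => D (e k) (e i) (e j)) (fun p k i j => H (e p) (e k) (e i) (e j)) i j =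
      jetRicci D H (e i) (e j) := by
  have h1 : ∀ k i j, jetChristoffel (fun k i j => D (e k) (e i) (e j)) k i j =
      jetChristoffel D (e k) (e i) (e j) := fun _ _ _ => rfl
  have h2 : ∀ p k i j, jetDChristoffel (fun k i j => D (e k) (e i) (e j))
      (fun p k i j => H (e p) (e k) (e i) (e j)) p k i j =
      jetDChristoffel D H (e p) (e k) (e i) (e j) := fun p k i j => by
    simp only [jetDChristoffel, h1]
    rw [← e.sum_comp]
  simp only [jetRicci, h1, h2]
  rw [← e.sum_comp]
  refine Finset.sum_congr rfl fun k _ => ?_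
  rw [← e.sum_comp (fun l => jetChristoffel D (e k) (e k) l * jetChristoffel D l (e i) (e j) -
      jetChristoffel D (e k) (e j) l * jetChristoffel D l (e i) (e k))]

variable {d : ℕ} {G : (Fin d → ℝ) → Matrix (Fin d) (Fin d) ℝ} {x : Fin d → ℝ}

lemma contDiffAt_det {n : ℕ} {A : (Fin d → ℝ) → Matrix (Fin n) (Fin n) ℝ}
    (hA : ∀ i j, ContDiffAt ℝ ω (fun y => A y i j) x) : ContDiffAt ℝ ω (fun y => (A y).det) x := by
  simp only [Matrix.det_apply']
  refine ContDiffAt.sum fun s _ => contDiffAt_const.mul ?_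
  exact contDiffAt_prod fun i _ => hA _ _

lemma contDiffAt_matrix_inv (hG : ∀ i j, ContDiffAt ℝ ω (fun y => G y i j) x) (h1 : G x = 1)
    (k l : Fin d) : ContDiffAt ℝ ω (fun y => (G y)⁻¹ k l) x := by
  simp only [Matrix.inv_def, Matrix.smul_apply, Ring.inverse_eq_inv', smul_eq_mul,
    Matrix.adjugate_apply]
  refine ContDiffAt.mul ((contDiffAt_det hG).inv (by simp [h1])) (contDiffAt_det fun i j => ?_)
  by_cases h : i = l
  · subst h
    simp only [Matrix.updateRow_self]
    exact contDiffAt_const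
  · simp only [Matrix.updateRow_ne h]
    exact hG i j

/-- Differentiate `G * G⁻¹ = 1`, valid near `x` because the determinant stays nonzero; at `x` both
undifferentiated factors are the identity. -/
lemma pderiv_matrix_inv (hG : ∀ i j, ContDiffAt ℝ ω (fun y => G y i j) x) (h1 : G x = 1)
    (p k l : Fin d) :
    pderiv p (fun y => (G y)⁻¹ k l) x = -pderiv p (fun y => G y k l) x := by
  have hI := contDiffAt_matrix_inv hG h1
  have hdG : ∀ i j, DifferentiableAt ℝ (fun y => G y i j) x := fun i j =>
    (hG i j).differentiableAt (by simp)
  have hdI : ∀ i j, DifferentiableAt ℝ (fun y => (G y)⁻¹ i j) x := fun i j =>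
    (hI i j).differentiableAt (by simp)
  have hdet : ∀ᶠ y in nhds x, (G y).det ≠ 0 :=
    (contDiffAt_det hG).continuousAt.eventually_ne (by simp [h1])
  have h2 : (fun y => ∑ j, G y k j * (G y)⁻¹ j l) =ᶠ[nhds x] fun _ => (1 : Matrix _ _ ℝ) k l := by
    filter_upwards [hdet] with y hy
    rw [← Matrix.mul_apply, Matrix.mul_nonsing_inv _ (isUnit_iff_ne_zero.2 hy)]
  have h3 := pderiv_congr (i := p) h2
  rw [pderiv_sum fun j _ => (hdG k j).fun_mul (hdI j l), pderiv_const] at h3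
  simp only [fun j => pderiv_mul (i := p) (hdG k j) (hdI j l), Finset.sum_add_distrib, h1, inv_one,
    Matrix.one_apply, ite_mul, mul_ite, one_mul, zero_mul, mul_one, mul_zero, Finset.sum_ite_eq,
    Finset.sum_ite_eq', Finset.mem_univ, if_true] at h3
  linarith

lemma christoffel_eq_jet (h1 : G x = 1) (k i j : Fin d) :
    christoffel G k i j x = jetChristoffel (fun k i j => pderiv k (fun y => G y i j) x) k i j := by
  simp [christoffel, jetChristoffel, h1, Matrix.one_apply]

/-- In the product rule the derivative of the inverse matrix is minus the derivative of the metric,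
which produces the quadratic correction in `jetDChristoffel`. -/
lemma pderiv_christoffel (hG : ∀ i j, ContDiffAt ℝ ω (fun y => G y i j) x) (h1 : G x = 1)
    (p k i j : Fin d) :
    pderiv p (christoffel G k i j) x =
      jetDChristoffel (fun k i j => pderiv k (fun y => G y i j) x)
        (fun p k i j => pderiv p (pderiv k (fun y => G y i j)) x) p k i j := by
  have hI := contDiffAt_matrix_inv hG h1
  have hdI : ∀ i j, DifferentiableAt ℝ (fun y => (G y)⁻¹ i j) x := fun i j =>
    (hI i j).differentiableAt (by simp)
  have hP : ∀ l i j, DifferentiableAt ℝ (pderiv l (fun y => G y i j)) x := fun l i j =>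
    (contDiffAt_pderiv (hG i j)).differentiableAt (by simp)
  have hB : ∀ l, DifferentiableAt ℝ (fun y => pderiv i (fun y => G y j l) y +
      pderiv j (fun y => G y i l) y - pderiv l (fun y => G y i j) y) x := fun l =>
    ((hP i j l).fun_add (hP j i l)).fun_sub (hP l i j)
  have e : christoffel G k i j = fun y => (1 / 2) * ∑ l, (G y)⁻¹ k l *
    (pderiv i (fun y => G y j l) y + pderiv j (fun y => G y i l) y -
      pderiv l (fun y => G y i j) y) := rfl
  rw [e, pderiv_const_mul _ (DifferentiableAt.fun_sum fun l _ => (hdI k l).fun_mul (hB l)),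
    pderiv_sum fun l _ => (hdI k l).fun_mul (hB l)]
  simp only [fun l => pderiv_mul (i := p) (hdI k l) (hB l), pderiv_matrix_inv hG h1, h1, inv_one,
    Finset.sum_add_distrib]
  simp only [fun l => pderiv_sub (i := p) ((hP i j l).fun_add (hP j i l)) (hP l i j),
    fun l => pderiv_add (i := p) (hP i j l) (hP j i l), Matrix.one_apply, ite_mul, one_mul,
    zero_mul, Finset.sum_ite_eq, Finset.mem_univ, if_true]
  have h4 : ∀ a b : ℝ, ∀ u v : Fin d → ℝ, (∀ l, (1 / 2) * u l = -v l) → a = b →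
      (1 / 2) * (a + ∑ l, u l) = (1 / 2) * b - ∑ l, v l := by
    intro a b u v huv hab
    rw [mul_add, Finset.mul_sum, Finset.sum_congr rfl fun l _ => huv l, Finset.sum_neg_distrib, hab,
      sub_eq_add_neg]
  refine h4 _ _ _ _ (fun l => ?_) rfl
  rw [jetChristoffel]
  ring

theorem ricci_eq_jetRicci (hG : ∀ i j, ContDiffAt ℝ ω (fun y => G y i j) x) (h1 : G x = 1)
    (i j : Fin d) :
    ricci G i j x = jetRicci (fun k i j => pderiv k (fun y => G y i j) x)
        (fun p k i j => pderiv p (pderiv k (fun y => G y i j)) x) i j := by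
  simp only [ricci, jetRicci, pderiv_christoffel hG h1, christoffel_eq_jet h1]

end TwoJet

/-! ### The Ricci tensor of a connection metric -/

section Block

variable {α β : Type*} [Fintype α] [Fintype β]

/-- Termwise `|X U| ≤ (X² + U²)/2`; each square is then counted once for every index of the other
kind. -/
lemma abs_sum_mul_le (c : α → β → ℝ) (K : ℝ) (hc : ∀ i a, |c i a| ≤ K) (X : α → ℝ) (U : β → ℝ) :
    |∑ i, ∑ a, c i a * (X i * U a)| ≤
      K / 2 * (Fintype.card β * ∑ i, X i ^ 2 + Fintype.card α * ∑ a, U a ^ 2) := by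
  calc |∑ i, ∑ a, c i a * (X i * U a)| ≤ ∑ i, ∑ a, K / 2 * (X i ^ 2 + U a ^ 2) := by
        refine (Finset.abs_sum_le_sum_abs _ _).trans (Finset.sum_le_sum fun i _ => ?_)
        refine (Finset.abs_sum_le_sum_abs _ _).trans (Finset.sum_le_sum fun a _ => ?_)
        have h1 : |X i * U a| ≤ (X i ^ 2 + U a ^ 2) / 2 := by
          rw [abs_le]; constructor <;> nlinarith [sq_nonneg (X i - U a), sq_nonneg (X i + U a)]
        rw [abs_mul]
        have := mul_le_mul (hc i a) h1 (abs_nonneg _) ((abs_nonneg _).trans (hc i a))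
        linarith
    _ = _ := by
        simp only [← Finset.mul_sum, Finset.sum_add_distrib, Finset.sum_const, Finset.card_univ,
          nsmul_eq_mul]

variable [DecidableEq α]

/-- First derivatives of a connection metric with connection form vanishing at the point. -/
def blockD (t : ℝ) (f : α → α → β → ℝ) : α ⊕ β → α ⊕ β → α ⊕ β → ℝ
  | .inl k, .inl i, .inr a => t * f k i a
  | .inl k, .inr a, .inl i => t * f k i a
  | _, _, _ => 0

/-- Second derivatives of a connection metric with connection form vanishing at the point. -/
def blockH (t : ℝ) (f : α → α → β → ℝ) (s : α → α → α → β → ℝ) (e : α → α → β → β → ℝ)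
    (w : β → β → β → β → ℝ) : α ⊕ β → α ⊕ β → α ⊕ β → α ⊕ β → ℝ
  | .inl k, .inl l, .inl i, .inl j => (if k = l ∧ i = j then -4 else 0) +
      t ^ 2 * ∑ a, (f k i a * f l j a + f l i a * f k j a)
  | .inl k, .inl l, .inl i, .inr a => t * s k l i a
  | .inl k, .inl l, .inr a, .inl i => t * s k l i a
  | .inl k, .inr d, .inl i, .inr a => e k i d a
  | .inl k, .inr d, .inr a, .inl i => e k i d a
  | .inr d, .inl k, .inl i, .inr a => e k i d a
  | .inr d, .inl k, .inr a, .inl i => e k i d a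
  | .inr d, .inr d', .inr a, .inr b => w d d' a b
  | _, _, _, _ => 0

variable {t : ℝ} {f : α → α → β → ℝ} {s : α → α → α → β → ℝ} {e : α → α → β → β → ℝ}
    {w : β → β → β → β → ℝ}

/-- The constant 12 is the Ricci curvature of the 4-sphere of sectional curvature 4. As `f` is
antisymmetric, the curvature of the connection is `2 f`, and the correction is the usual `-(t²/2)`
times its square. -/
lemma jetRicci_inl_inl (hα : Fintype.card α = 4) (hf : ∀ k i a, f k i a = -f i k a)
    (he : ∀ k i d a, e k i d a = -e i k d a) (i j : α) :
    jetRicci (blockD t f) (blockH t f s e w) (.inl i) (.inl j) =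
      (if i = j then 12 else 0) - 2 * t ^ 2 * ∑ k, ∑ a, f i k a * f j k a := by
  have hf0 : ∀ k a, f k k a = 0 := fun k a => by linarith [hf k k a]
  simp only [jetRicci, jetDChristoffel, jetChristoffel, Fintype.sum_sum_type, blockD, blockH]
  simp [hf0]
  have hfi : ∀ x a, f x i a = -f i x a := fun x a => hf x i a
  have hfj : ∀ x a, f x j a = -f j x a := fun x a => hf x j a
  have e1 : ∀ x, ∑ a, f x j a * f i x a = -∑ a, f i x a * f j x a := fun x => by
    rw [← Finset.sum_neg_distrib]; exact Finset.sum_congr rfl fun a _ => by rw [hfj]; ring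
  have e2 : ∀ x, ∑ a, f x i a * f j x a = -∑ a, f i x a * f j x a := fun x => by
    rw [← Finset.sum_neg_distrib]; exact Finset.sum_congr rfl fun a _ => by rw [hfi]; ring
  have e3 : ∀ x, ∑ a, (f x i a * f x j a + f x i a * f x j a) = 2 * ∑ a, f i x a * f j x a :=
    fun x => by
      rw [Finset.mul_sum]; exact Finset.sum_congr rfl fun a _ => by rw [hfi, hfj]; ring
  have e4 : ∀ x, ∑ a, (f j x a * f i x a + f i x a * f j x a) = 2 * ∑ a, f i x a * f j x a :=
    fun x => by rw [Finset.mul_sum]; exact Finset.sum_congr rfl fun a _ => by ring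
  have e5 : ∀ x a, t * f i x a + t * f x i a = 0 := fun x a => by rw [hfi]; ring
  have e6 : ∀ x a, t * f j x a + t * f x j a = 0 := fun x a => by rw [hfj]; ring
  have e7 : ∀ x, e i j x x + e j i x x = 0 := fun x => by rw [he]; ring
  have e8 : ∑ x, ∑ k, t * f j k x * (2⁻¹ * (t * f i k x - t * f k i x)) =
      t ^ 2 * ∑ k, ∑ a, f i k a * f j k a := by
    rw [Finset.sum_comm, Finset.mul_sum]
    refine Finset.sum_congr rfl fun k _ => ?_
    rw [Finset.mul_sum]
    exact Finset.sum_congr rfl fun a _ => by rw [hfi]; ring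
  simp only [e1, e2, e3, e4, e5, e6, e7, e8, mul_zero, zero_mul, Finset.sum_const_zero, neg_zero,
    add_zero, sub_zero, zero_add]
  -- On the diagonal the first two terms contribute `-4` once each and the last two `+4` four times
  -- each: `-8 + 32 = 24`, twice the Ricci constant.
  have e9 : ∑ x, ((if x = i ∧ j = x then (-4 : ℝ) else 0) + (if x = j ∧ i = x then -4 else 0) -
      (if i = j then -4 else 0) - (if j = i then -4 else 0)) = if i = j then 24 else 0 := by
    by_cases h : i = j
    · subst h
      have : ∀ x, (if x = i ∧ i = x then (-4 : ℝ) else 0) = if x = i then -4 else 0 := fun x => by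
        by_cases hx : x = i
        · simp [hx]
        · simp [hx]
      simp [this, Finset.sum_add_distrib, hα]
      norm_num
    · have h1 : ∀ x, ¬(x = i ∧ j = x) := fun x hx => h (hx.2.trans hx.1).symm
      have h2 : ∀ x, ¬(x = j ∧ i = x) := fun x hx => h (hx.2.trans hx.1)
      simp [h, h1, h2, Ne.symm h]
  have e10 : (if i = j then (12 : ℝ) else 0) = 2⁻¹ * (if i = j then 24 else 0) := by
    split_ifs <;> norm_num
  rw [e10, ← e9, Finset.mul_sum, Finset.mul_sum, Finset.mul_sum, ← Finset.sum_add_distrib,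
    ← Finset.sum_sub_distrib]
  exact Finset.sum_congr rfl fun x _ => by ring

/-- The mixed block is a divergence of the curvature of the connection. It is of first order in `t`,
so only a bound on it will matter. -/
lemma jetRicci_inl_inr (hf : ∀ k i a, f k i a = -f i k a) (i : α) (a : β) :
    jetRicci (blockD t f) (blockH t f s e w) (.inl i) (.inr a) =
      (t / 2) * ∑ k, (s k i k a - s k k i a) := by
  have hf0 : ∀ k a, f k k a = 0 := fun k a => by linarith [hf k k a]
  simp only [jetRicci, jetDChristoffel, jetChristoffel, Fintype.sum_sum_type, blockD, blockH]
  simp [hf0]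
  rw [← Finset.sum_sub_distrib, Finset.mul_sum]
  exact Finset.sum_congr rfl fun x _ => by ring

lemma jetRicci_inr_inl (hf : ∀ k i a, f k i a = -f i k a) (i : α) (a : β) :
    jetRicci (blockD t f) (blockH t f s e w) (.inr a) (.inl i) =
      (t / 2) * ∑ k, (s k i k a - s k k i a) := by
  have hf0 : ∀ k a, f k k a = 0 := fun k a => by linarith [hf k k a]
  simp only [jetRicci, jetDChristoffel, jetChristoffel, Fintype.sum_sum_type, blockD, blockH]
  simp [hf0]
  rw [← Finset.sum_sub_distrib, Finset.mul_sum]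
  exact Finset.sum_congr rfl fun x _ => by ring

/-- The first sum is the Ricci tensor of the fibre metric, whose first derivatives vanish at the
point. The second is a Gram matrix in `a, b`, hence nonnegative. -/
lemma jetRicci_inr_inr (hf : ∀ k i a, f k i a = -f i k a)
    (he : ∀ k i d a, e k i d a = -e i k d a) (a b : β) :
    jetRicci (blockD t f) (blockH t f s e w) (.inr a) (.inr b) =
      (1 / 2) * ∑ d, (w d a b d + w d b a d - w d d a b - w b a d d) +
        t ^ 2 * ∑ k, ∑ l, f k l a * f k l b := by
  have hf0 : ∀ k a, f k k a = 0 := fun k a => by linarith [hf k k a]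
  have he0 : ∀ k d a, e k k d a = 0 := fun k d a => by linarith [he k k d a]
  simp only [jetRicci, jetDChristoffel, jetChristoffel, Fintype.sum_sum_type, blockD, blockH]
  simp [hf0, he0]
  have e1 : ∑ x, ∑ y, 2⁻¹ * (t * f y x b - t * f x y b) * (2⁻¹ * (t * f x y a - t * f y x a)) =
      -(t ^ 2 * ∑ k, ∑ l, f k l a * f k l b) := by
    rw [Finset.mul_sum, ← Finset.sum_neg_distrib]
    refine Finset.sum_congr rfl fun k _ => ?_
    rw [Finset.mul_sum, ← Finset.sum_neg_distrib]
    exact Finset.sum_congr rfl fun l _ => by rw [hf l k a, hf l k b]; ring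
  rw [e1, ← Finset.sum_sub_distrib, ← Finset.sum_sub_distrib, ← Finset.sum_sub_distrib,
    neg_neg, add_comm, Finset.mul_sum _ _ (2⁻¹ : ℝ)]
  congr 1
  exact Finset.sum_congr rfl fun x _ => by ring

/-- A connection metric with small fibres has positive Ricci curvature. -/
theorem jetRicci_pos [DecidableEq β] (hα : Fintype.card α = 4) (hf : ∀ k i a, f k i a = -f i k a)
    (he : ∀ k i d a, e k i d a = -e i k d a)
    (hw : ∀ a b, (1 / 2) * ∑ d, (w d a b d + w d b a d - w d d a b - w b a d d) =
      if a = b then 2 / t ^ 2 else 0)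
    {K : ℝ} (hK : 0 ≤ K) (ht0 : 0 < t) (ht1 : t ≤ 1)
    (htK : t * (32 * Fintype.card β * K ^ 2 + K * Fintype.card β + 2 * K) ≤ 1)
    (hfK : ∀ k i a, |f k i a| ≤ K) (hsK : ∀ i a, |∑ k, (s k i k a - s k k i a)| ≤ K)
    (v : α ⊕ β → ℝ) (hv : v ≠ 0) :
    0 < ∑ i, ∑ j, jetRicci (blockD t f) (blockH t f s e w) i j * v i * v j := by
  set X : α → ℝ := fun i => v (.inl i) with hX
  set U : β → ℝ := fun a => v (.inr a) with hU
  set n : ℝ := (Fintype.card β : ℝ) with hn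
  have hn0 : 0 ≤ n := by positivity
  simp only [Fintype.sum_sum_type, jetRicci_inl_inl hα hf he, jetRicci_inl_inr hf,
    jetRicci_inr_inl hf, jetRicci_inr_inr hf he, hw]
  obtain ⟨i₀⟩ : Nonempty α := Fintype.card_pos_iff.1 (by omega)
  have hXX : |∑ i, ∑ j, (∑ k, ∑ a, f i k a * f j k a) * (X i * X j)| ≤
      (4 * n * K ^ 2) / 2 * (Fintype.card α * ∑ i, X i ^ 2 + Fintype.card α * ∑ i, X i ^ 2) := by
    refine abs_sum_mul_le _ _ (fun i j => ?_) X X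
    calc |∑ k, ∑ a, f i k a * f j k a| ≤ ∑ k : α, ∑ a : β, K ^ 2 := by
          refine (Finset.abs_sum_le_sum_abs _ _).trans (Finset.sum_le_sum fun k _ => ?_)
          refine (Finset.abs_sum_le_sum_abs _ _).trans (Finset.sum_le_sum fun a _ => ?_)
          rw [abs_mul, sq]
          exact mul_le_mul (hfK _ _ _) (hfK _ _ _) (abs_nonneg _) ((abs_nonneg _).trans (hfK i k a))
      _ = 4 * n * K ^ 2 := by simp [hα, hn, mul_assoc]
  have hXU := abs_sum_mul_le _ _ hsK X U
  -- The curvature term in the fibre directions is a sum of squares and needs no bound.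
  have hUU : ∑ a, ∑ b, (∑ k, ∑ l, f k l a * f k l b) * (U a * U b) =
      ∑ k, ∑ l, (∑ a, f k l a * U a) ^ 2 := by
    simp only [Finset.sum_mul, sq, Finset.mul_sum]
    rw [Finset.sum_congr rfl fun a _ => Finset.sum_comm, Finset.sum_comm]
    refine Finset.sum_congr rfl fun k _ => ?_
    rw [Finset.sum_congr rfl fun a _ => Finset.sum_comm, Finset.sum_comm]
    refine Finset.sum_congr rfl fun l _ => ?_
    rw [Finset.sum_comm]
    exact Finset.sum_congr rfl fun a _ => Finset.sum_congr rfl fun b _ => by ring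
  have hUU' : 0 ≤ ∑ k, ∑ l, (∑ a, f k l a * U a) ^ 2 := by positivity
  have e1 : ∀ δ : α → β → ℝ, ∑ i, (∑ j, ((if i = j then 12 else 0) - 2 * t ^ 2 * ∑ k, ∑ a, f i k a * f j k a) * X i * X j +
      ∑ a, t / 2 * δ i a * X i * U a) +
      ∑ a, (∑ i, t / 2 * δ i a * U a * X i +
        ∑ b, ((if a = b then 2 / t ^ 2 else 0) + t ^ 2 * ∑ k, ∑ l, f k l a * f k l b) * U a * U b) =
      12 * ∑ i, X i ^ 2 - 2 * t ^ 2 * ∑ i, ∑ j, (∑ k, ∑ a, f i k a * f j k a) * (X i * X j) +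
      t * ∑ i, ∑ a, δ i a * (X i * U a) + 2 / t ^ 2 * ∑ a, U a ^ 2 +
      t ^ 2 * ∑ a, ∑ b, (∑ k, ∑ l, f k l a * f k l b) * (U a * U b) := by
    intro δ
    have h1 : ∀ i, ∑ j, ((if i = j then 12 else 0) -
        2 * t ^ 2 * ∑ k, ∑ a, f i k a * f j k a) * X i * X j =
        12 * X i ^ 2 - 2 * t ^ 2 * ∑ j, (∑ k, ∑ a, f i k a * f j k a) * (X i * X j) := fun i => by
      simp only [sub_mul, ite_mul, zero_mul, Finset.sum_sub_distrib, Finset.sum_ite_eq,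
        Finset.mem_univ, if_true]
      rw [Finset.mul_sum]
      exact congrArg₂ _ (by ring) (Finset.sum_congr rfl fun j _ => by ring)
    have h2 : ∀ a, ∑ b, ((if a = b then 2 / t ^ 2 else 0) +
        t ^ 2 * ∑ k, ∑ l, f k l a * f k l b) * U a * U b =
        2 / t ^ 2 * U a ^ 2 + t ^ 2 * ∑ b, (∑ k, ∑ l, f k l a * f k l b) * (U a * U b) :=
      fun a => by
      simp only [add_mul, ite_mul, zero_mul, Finset.sum_add_distrib, Finset.sum_ite_eq,
        Finset.mem_univ, if_true]
      rw [Finset.mul_sum]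
      exact congrArg₂ _ (by ring) (Finset.sum_congr rfl fun j _ => by ring)
    have h3 : ∑ i, ∑ a, t / 2 * δ i a * X i * U a =
        t / 2 * ∑ i, ∑ a, δ i a * (X i * U a) := by
      simp only [Finset.mul_sum]
      exact Finset.sum_congr rfl fun i _ => Finset.sum_congr rfl fun a _ => by ring
    have h4 : ∑ a, ∑ i, t / 2 * δ i a * U a * X i =
        t / 2 * ∑ i, ∑ a, δ i a * (X i * U a) := by
      rw [Finset.sum_comm, ← h3]
      exact Finset.sum_congr rfl fun i _ => Finset.sum_congr rfl fun a _ => by ring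
    simp only [h1, h2, Finset.sum_add_distrib, Finset.sum_sub_distrib, h3, h4]
    simp only [← Finset.mul_sum]
    ring
  refine lt_of_lt_of_eq ?_ (e1 fun i a => ∑ k, (s k i k a - s k k i a)).symm
  rw [hUU]
  rw [hα] at hXX hXU
  set Q := ∑ i, ∑ j, (∑ k, ∑ a, f i k a * f j k a) * (X i * X j)
  set M := ∑ i, ∑ a, (∑ k, (s k i k a - s k k i a)) * (X i * U a)
  set P := ∑ k, ∑ l, (∑ a, f k l a * U a) ^ 2
  set x2 := ∑ i, X i ^ 2 with hx2
  set u2 := ∑ a, U a ^ 2 with hu2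
  have hx0 : 0 ≤ x2 := Finset.sum_nonneg fun _ _ => sq_nonneg _
  have hu0 : 0 ≤ u2 := Finset.sum_nonneg fun _ _ => sq_nonneg _
  have hpos : 0 < x2 + u2 := by
    refine lt_of_le_of_ne (by positivity) fun h0 => hv ?_
    have hx' : x2 = 0 := by linarith
    have hu' : u2 = 0 := by linarith
    rw [hx2, Finset.sum_eq_zero_iff_of_nonneg fun _ _ => sq_nonneg _] at hx'
    rw [hu2, Finset.sum_eq_zero_iff_of_nonneg fun _ _ => sq_nonneg _] at hu'
    funext c
    rcases c with i | a
    · exact pow_eq_zero_iff two_ne_zero |>.1 (hx' i (Finset.mem_univ _))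
    · exact pow_eq_zero_iff two_ne_zero |>.1 (hu' a (Finset.mem_univ _))
  -- The single smallness condition on `t` is split: `a1` controls the horizontal correction, `a2`
  -- and `a3` the two halves of the mixed term.
  have a1 : t * (32 * n * K ^ 2) ≤ 1 := by
    have : 0 ≤ t * (K * n + 2 * K) := by positivity
    nlinarith
  have a2 : t * (K * n) ≤ 1 := by
    have : 0 ≤ t * (32 * n * K ^ 2 + 2 * K) := by positivity
    nlinarith
  have a3 : t * (2 * K) ≤ 1 := by
    have : 0 ≤ t * (32 * n * K ^ 2 + K * n) := by positivity
    nlinarith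
  have b1 : 2 * t ^ 2 * Q ≤ x2 := by
    have h1 : Q ≤ 16 * n * K ^ 2 * x2 := (le_abs_self Q).trans (hXX.trans (by push_cast; linarith))
    have h2 : t ^ 2 * (32 * n * K ^ 2) ≤ 1 := by
      have : t * (t * (32 * n * K ^ 2)) ≤ 1 * 1 :=
        mul_le_mul ht1 a1 (by positivity) zero_le_one
      linarith
    calc 2 * t ^ 2 * Q ≤ 2 * t ^ 2 * (16 * n * K ^ 2 * x2) :=
          mul_le_mul_of_nonneg_left h1 (by positivity)
      _ = t ^ 2 * (32 * n * K ^ 2) * x2 := by ring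
      _ ≤ 1 * x2 := mul_le_mul_of_nonneg_right h2 hx0
      _ = x2 := one_mul _
  have b2 : -(x2 + u2) ≤ t * M := by
    have h1 : -(K / 2 * (n * x2 + 4 * u2)) ≤ M := (abs_le.1 (by exact_mod_cast hXU)).1
    have h2 := mul_le_mul_of_nonneg_left h1 ht0.le
    have h3 := mul_le_mul_of_nonneg_right a2 hx0
    have h4 := mul_le_mul_of_nonneg_right a3 hu0
    linarith
  have b3 : 2 * u2 ≤ 2 / t ^ 2 * u2 := by
    refine mul_le_mul_of_nonneg_right ?_ hu0
    rw [le_div_iff₀ (by positivity)]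
    have : t ^ 2 ≤ 1 := pow_le_one₀ ht0.le ht1
    linarith
  have b4 : 0 ≤ t ^ 2 * P := by positivity
  -- The quadratic form is at least `12 x2 - x2 - (x2 + u2) + 2 u2 = 10 x2 + u2`.
  linarith

end Block

/-! ### The connection form and the connection metrics on `Sp(2,m)` -/

/-- A finite sequence, extended by zero to all of `ℕ`. -/
def ent {m : ℕ} {V : Type*} [Zero V] (u : Fin m → V) (n : ℕ) : V := if h : n < m then u ⟨n, h⟩ else 0

section Ent

variable {m : ℕ} {V : Type*}

@[simp] lemma ent_val [Zero V] (u : Fin m → V) (i : Fin m) : ent u (i : ℕ) = u i := by simp [ent]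

lemma ent_of_lt [Zero V] (u : Fin m → V) {n : ℕ} (h : n < m) : ent u n = u ⟨n, h⟩ := by
  simp [ent, h]

lemma ent_add [AddZeroClass V] (u v : Fin m → V) (n : ℕ) : ent (u + v) n = ent u n + ent v n := by
  unfold ent; split_ifs <;> simp

lemma ent_smul [AddCommGroup V] [Module ℝ V] (c : ℝ) (u : Fin m → V) (n : ℕ) :
    ent (c • u) n = c • ent u n := by
  unfold ent; split_ifs <;> simp

@[fun_prop]
lemma contDiffAt_ent [NormedAddCommGroup V] [NormedSpace ℝ V] {E : Type*} [NormedAddCommGroup E]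
    [NormedSpace ℝ E] {k : WithTop ℕ∞} {f : E → Fin m → V} {x : E} {n : ℕ}
    (hf : ContDiffAt ℝ k f x) : ContDiffAt ℝ k (fun x => ent (f x) n) x := by
  unfold ent; split_ifs
  · exact contDiffAt_pi.1 hf _
  · exact contDiffAt_const

end Ent

/-- The values at the tangent vector `v` at `u` of the components of the principal connection
of `Sp(2,m) → S⁴`. -/
def conn (u v : ℕ → ℍ[ℝ] × ℍ[ℝ]) : ℕ → ℍ[ℝ]
  | 0 => ip (u 0) (v 0)
  | n + 1 => ip (u (n + 1)) (v (n + 1)) +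
      ip (u (n + 1)) (lm (if n = 0 then 0 else conn u v n) (u (n + 1)))

lemma conn_zero (u v : ℕ → ℍ[ℝ] × ℍ[ℝ]) : conn u v 0 = ip (u 0) (v 0) := rfl

lemma conn_one (u v : ℕ → ℍ[ℝ] × ℍ[ℝ]) : conn u v 1 = ip (u 1) (v 1) := by simp [conn]

/-- The group factor with index `n` acts on column `n` from the right and on column `n + 1` from the
left. A vertical vector with parameters `ξ` thus has `v (n+1) = u (n+1) ξ (n+1) - ξ n u (n+1)`, and
the second summand here undoes the left part. The factor with index 0 does not touch column 1, hence
the exception. -/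
lemma conn_succ (u v : ℕ → ℍ[ℝ] × ℍ[ℝ]) {n : ℕ} (hn : n ≠ 0) :
    conn u v (n + 1) = ip (u (n + 1)) (v (n + 1)) + ip (u (n + 1)) (lm (conn u v n) (u (n + 1))) := by
  simp [conn, hn]

lemma conn_add (u v w : ℕ → ℍ[ℝ] × ℍ[ℝ]) (n : ℕ) :
    conn u (fun k => v k + w k) n = conn u v n + conn u w n := by
  induction n with
  | zero => simp [conn, ip_add]
  | succ n ih =>
    simp only [conn, ip_add]
    split_ifs with h
    · simp
    · rw [ih, add_lm, ip_add]; abel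

lemma lm_smul (c : ℝ) (a : ℍ[ℝ]) (x : ℍ[ℝ] × ℍ[ℝ]) : lm (c • a) x = c • lm a x := by simp [lm]

lemma conn_smul (u v : ℕ → ℍ[ℝ] × ℍ[ℝ]) (c : ℝ) (n : ℕ) :
    conn u (fun k => c • v k) n = c • conn u v n := by
  induction n with
  | zero => simp [conn, ip_smul]
  | succ n ih =>
    simp only [conn, ip_smul]
    split_ifs with h
    · simp
    · rw [ih, lm_smul, ip_smul, smul_add]

lemma conn_congr {u u' v v' : ℕ → ℍ[ℝ] × ℍ[ℝ]} {n : ℕ} (hu : ∀ k ≤ n, u k = u' k)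
    (hv : ∀ k ≤ n, v k = v' k) : conn u v n = conn u' v' n := by
  induction n with
  | zero => simp [conn, hu 0 le_rfl, hv 0 le_rfl]
  | succ n ih =>
    simp only [conn, hu (n + 1) le_rfl, hv (n + 1) le_rfl,
      ih (fun k hk => hu k (by omega)) (fun k hk => hv k (by omega))]

lemma contDiffAt_conn {E : Type*} [NormedAddCommGroup E] [NormedSpace ℝ E] {k : WithTop ℕ∞} {x : E}
    {f g : E → ℕ → ℍ[ℝ] × ℍ[ℝ]} {n : ℕ} (hf : ∀ j ≤ n, ContDiffAt ℝ k (fun x => f x j) x)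
    (hg : ∀ j ≤ n, ContDiffAt ℝ k (fun x => g x j) x) :
    ContDiffAt ℝ k (fun x => conn (f x) (g x) n) x := by
  induction n with
  | zero => exact contDiffAt_ip (hf 0 le_rfl) (hg 0 le_rfl)
  | succ n ih =>
    have h1 := hf (n + 1) le_rfl
    have h2 := hg (n + 1) le_rfl
    have h3 := ih (fun j hj => hf j (by omega)) (fun j hj => hg j (by omega))
    simp only [conn]
    split_ifs <;> fun_prop

/-- The factor by which the left action multiplies the `n`-th column, where `r n` is the factor
on the right. -/
def lft (p : ℍ[ℝ]) (r : ℕ → ℍ[ℝ]) : ℕ → ℍ[ℝ]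
  | 0 => p
  | n + 1 => if n = 0 then p else star (r n)

@[simp] lemma zero_rm (a : ℍ[ℝ]) : rm 0 a = 0 := by simp [rm]

/-- The behaviour of the connection form under a moving gauge transformation. -/
lemma conn_gauge {u v : ℕ → ℍ[ℝ] × ℍ[ℝ]} {r r' : ℕ → ℍ[ℝ]} {p : ℍ[ℝ]} {n : ℕ} (hp : ‖p‖ = 1)
    (hu : ∀ k ≤ n, ip (u k) (u k) = 1) (hr : ∀ k ≤ n, ‖r k‖ = 1)
    (hr' : ∀ k ≤ n, r k * star (r' k) + r' k * star (r k) = 0) :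
    conn (fun k => rm (lm (lft p r k) (u k)) (r k))
      (fun k => rm (lm (lft 0 r' k) (u k)) (r k) + rm (lm (lft p r k) (v k)) (r k) +
        rm (lm (lft p r k) (u k)) (r' k)) n =
      star (r n) * (conn u v n + r' n * star (r n)) * r n := by
  have key : ∀ (a x y : ℍ[ℝ]) (w z : ℍ[ℝ] × ℍ[ℝ]), ‖a‖ = 1 → 
      ip (rm (lm a w) x) (rm (lm a z) y) = star x * ip w z * y := fun a x y w z ha => by
    rw [ip_rm, ip_rm_left, ip_lm_lm ha]
  have hlft : ∀ k ≤ n, ‖lft p r k‖ = 1 := by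
    intro k hk
    cases k with
    | zero => exact hp
    | succ k =>
      simp only [lft]; split_ifs
      · exact hp
      · simpa using hr k (by omega)
  have hrr : star (r n) * (r' n * star (r n)) * r n = star (r n) * r' n := by
    rw [mul_assoc, mul_assoc, star_mul_self_of_norm (hr n le_rfl), mul_one]
  induction n with
  | zero =>
    rw [mul_add, add_mul, hrr]
    simp only [conn, ip_add, lft, lm_zero_left, key _ _ _ _ _ hp, hu 0 le_rfl, zero_rm,
      zero_add, mul_one]
  | succ n ih =>
    rw [mul_add, add_mul, hrr]
    by_cases hn : n = 0
    · subst hn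
      simp only [conn, ip_add, lft, if_true, lm_zero_left, key _ _ _ _ _ hp, hu 1 le_rfl, zero_rm,
        ip_zero, zero_add, add_zero, mul_one]
    · have ih' := ih (fun k hk => hu k (by omega)) (fun k hk => hr k (by omega))
        (fun k hk => hr' k (by omega)) (fun k hk => hlft k (by omega))
        (by rw [mul_assoc, mul_assoc, star_mul_self_of_norm (hr n (by omega)), mul_one])
      have h1 := hr n (by omega)
      have h2 := hr' n (by omega)
      rw [conn_succ _ _ hn, conn_succ _ _ hn, ih']
      simp only [ip_add, key _ _ _ _ _ (hlft (n + 1) le_rfl), hu (n + 1) le_rfl, mul_one]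
      simp only [lft, hn, if_false]
      -- Moving `c` past the unit left factor conjugates it by `r n`; the left factor then stands in
      -- front, where `key` removes it.
      have e1 : ∀ c : ℍ[ℝ], lm c (rm (lm (star (r n)) (u (n + 1))) (r (n + 1))) =
          rm (lm (star (r n)) (lm (r n * c * star (r n)) (u (n + 1)))) (r (n + 1)) := fun c => by
        rw [lm_lm, lm_rm, lm_lm]
        congr 2
        rw [← mul_assoc, ← mul_assoc, star_mul_self_of_norm h1, one_mul]
      have e2 : rm (lm (star (r' n)) (u (n + 1))) (r (n + 1)) =
          rm (lm (star (r n)) (lm (r n * star (r' n)) (u (n + 1)))) (r (n + 1)) := by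
        rw [lm_lm, ← mul_assoc, star_mul_self_of_norm h1, one_mul]
      have h1' : ‖star (r n)‖ = 1 := by simpa using h1
      rw [e1, e2, key _ _ _ _ _ h1', key _ _ _ _ _ h1']
      have e3 : r n * (star (r n) * (conn u v n + r' n * star (r n)) * r n) * star (r n) =
          conn u v n + r' n * star (r n) := by
        calc _ = (r n * star (r n)) * (conn u v n + r' n * star (r n)) * (r n * star (r n)) := by
              noncomm_ring
          _ = _ := by rw [mul_star_self_of_norm h1]; simp
      -- As `r' n * star (r n)` is imaginary, the velocity of the left factor cancels the shift of
      -- the previous component of the connection form.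
      have e4 : r n * star (r' n) = -(r' n * star (r n)) := eq_neg_of_add_eq_zero_left h2
      rw [e3, e4, add_lm, ip_add]
      have e5 : ip (u (n + 1)) (lm (-(r' n * star (r n))) (u (n + 1))) =
          -ip (u (n + 1)) (lm (r' n * star (r n)) (u (n + 1))) := by
        simp [ip, lm]; abel
      rw [e5]
      noncomm_ring

/-- The value of the connection metric with fibre size `t`. -/
def metricFun (m : ℕ) (t : ℝ) (u v w : Fin m → ℍ[ℝ] × ℍ[ℝ]) : ℝ :=
  (ip (orth (ent u 0) (ent v 0)) (orth (ent u 0) (ent w 0))).re +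
    t ^ 2 * ∑ n ∈ Finset.range m,
      (star (conn (ent u) (ent v) n) * conn (ent u) (ent w) n).re

lemma orth_add (x y z : ℍ[ℝ] × ℍ[ℝ]) : orth x (y + z) = orth x y + orth x z := by
  simp only [orth, ip_add, rm_add]; abel

lemma orth_smul (c : ℝ) (x y : ℍ[ℝ] × ℍ[ℝ]) : orth x (c • y) = c • orth x y := by
  simp only [orth, ip_smul, rm_smul, smul_sub]

lemma metricFun_comm (m : ℕ) (t : ℝ) (u v w : Fin m → ℍ[ℝ] × ℍ[ℝ]) :
    metricFun m t u v w = metricFun m t u w v := by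
  have h : ∀ a b : ℍ[ℝ], (star a * b).re = (star b * a).re := fun a b => by
    simp; ring
  unfold metricFun
  congr 1
  · rw [← star_ip, Quaternion.re_star]
  · simp only [h]

lemma conn_ent_add {m : ℕ} (u v w : Fin m → ℍ[ℝ] × ℍ[ℝ]) (n : ℕ) :
    conn (ent u) (ent (v + w)) n = conn (ent u) (ent v) n + conn (ent u) (ent w) n := by
  rw [← conn_add]; exact conn_congr (fun _ _ => rfl) fun k _ => ent_add _ _ _

lemma conn_ent_smul {m : ℕ} (u v : Fin m → ℍ[ℝ] × ℍ[ℝ]) (c : ℝ) (n : ℕ) :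
    conn (ent u) (ent (c • v)) n = c • conn (ent u) (ent v) n := by
  rw [← conn_smul]; exact conn_congr (fun _ _ => rfl) fun k _ => ent_smul _ _ _

lemma metricFun_add_right (m : ℕ) (t : ℝ) (u v w w' : Fin m → ℍ[ℝ] × ℍ[ℝ]) :
    metricFun m t u v (w + w') = metricFun m t u v w + metricFun m t u v w' := by
  simp only [metricFun, ent_add, orth_add, ip_add, conn_ent_add, mul_add, Quaternion.re_add,
    Finset.sum_add_distrib]
  ring

lemma metricFun_smul_right (m : ℕ) (t : ℝ) (u v w : Fin m → ℍ[ℝ] × ℍ[ℝ]) (c : ℝ) :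
    metricFun m t u v (c • w) = c * metricFun m t u v w := by
  simp only [metricFun, ent_smul, orth_smul, ip_smul, conn_ent_smul, mul_smul_comm,
    Quaternion.re_smul, smul_eq_mul, ← Finset.mul_sum]
  ring

/-- The connection metric with fibre size `t`. -/
def connMetric (m : ℕ) (t : ℝ) (u : Fin m → ℍ[ℝ] × ℍ[ℝ]) :
    (Fin m → ℍ[ℝ] × ℍ[ℝ]) →L[ℝ] (Fin m → ℍ[ℝ] × ℍ[ℝ]) →L[ℝ] ℝ :=
  LinearMap.toContinuousLinearMap
    ((LinearMap.toContinuousLinearMap : ((Fin m → ℍ[ℝ] × ℍ[ℝ]) →ₗ[ℝ] ℝ) ≃ₗ[ℝ] _).toLinearMap ∘ₗ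
      LinearMap.mk₂ ℝ (metricFun m t u)
        (fun v v' w => by
          rw [metricFun_comm, metricFun_add_right, metricFun_comm, metricFun_comm m t u w v'])
        (fun c v w => by
          rw [metricFun_comm, metricFun_smul_right, metricFun_comm, smul_eq_mul])
        (fun v w w' => metricFun_add_right m t u v w w')
        (fun c v w => metricFun_smul_right m t u v w c))

lemma connMetric_apply (m : ℕ) (t : ℝ) (u v w : Fin m → ℍ[ℝ] × ℍ[ℝ]) :
    connMetric m t u v w = metricFun m t u v w := rfl

lemma contDiff_connMetric_apply (m : ℕ) (t : ℝ) {k : WithTop ℕ∞}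
    (v w : Fin m → ℍ[ℝ] × ℍ[ℝ]) : ContDiff ℝ k (fun u => connMetric m t u v w) := by
  simp only [connMetric_apply, metricFun]
  refine contDiff_iff_contDiffAt.2 fun u => ?_
  have h : ∀ (v : Fin m → ℍ[ℝ] × ℍ[ℝ]) n,
      ContDiffAt ℝ k (fun u : Fin m → ℍ[ℝ] × ℍ[ℝ] => conn (ent u) (ent v) n) u := fun v n =>
    contDiffAt_conn (fun j _ => by fun_prop) (fun j _ => by fun_prop)
  refine ContDiffAt.add (by fun_prop) (contDiffAt_const.mul (ContDiffAt.sum fun n _ => ?_))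
  have h1 := h v n
  have h2 := h w n
  fun_prop

lemma isRiemannianMetric_of_apply {E : Type*} [NormedAddCommGroup E] [NormedSpace ℝ E]
    [FiniteDimensional ℝ E] {S : Set E} {g : E → E →L[ℝ] E →L[ℝ] ℝ}
    (h1 : ∀ v w, ContDiff ℝ ∞ (fun u => g u v w)) (h2 : ∀ u v w, g u v w = g u w v)
    (h3 : ∀ p ∈ S, ∀ v ∈ tangentVectors S p, v ≠ 0 → 0 < g p v v) : IsRiemannianMetric S g :=
  ⟨(contDiff_clm_apply_iff.2 fun v => contDiff_clm_apply_iff.2 fun w => h1 v w).contDiffOn,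
    fun p hp => ⟨fun v _ w _ => h2 p v w, h3 p hp⟩⟩

/-! ### Invariance of the metric -/

lemma ent_wilhelmAction {m : ℕ} (p : ℍ[ℝ]) (q : Fin m → ℍ[ℝ]) (u : Fin m → ℍ[ℝ] × ℍ[ℝ]) {n : ℕ}
    (hn : n < m) : ent (wilhelmAction m p q u) n =
      rm (lm (lft p (fun k => star (ent q k)) n) (ent u n)) (star (ent q n)) := by
  rw [ent_of_lt _ hn, ent_of_lt q hn, ent_of_lt u hn, wilhelmAction, twoSided_eq]
  rcases n with _ | _ | n
  · simp [lft]
  · simp [lft]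
  · simp [lft, ent_of_lt q (show n + 1 < m by omega)]

/-- Conjugation turns the right factor `star (q i)` of column `i` into a left factor `q i`, the one
carried by column `i + 1`, so it cancels in their Hermitian product. Columns 0 and 1 share the left
factor `p`. -/
lemma wilhelmAction_mem {m : ℕ} {p : ℍ[ℝ]} {q : Fin m → ℍ[ℝ]} {u : Fin m → ℍ[ℝ] × ℍ[ℝ]}
    (hp : p ∈ S3) (hq : q ∈ S3pow m) (hu : u ∈ Sp2m m) : wilhelmAction m p q u ∈ Sp2m m := by
  rw [mem_S3_iff] at hp
  replace hq : ∀ i, ‖q i‖ = 1 := fun i => mem_S3_iff.1 (hq i)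
  rw [mem_Sp2m_iff] at hu ⊢
  have key : ∀ (a x y : ℍ[ℝ]) (w z : ℍ[ℝ] × ℍ[ℝ]), ‖a‖ = 1 →
      ip (rm (lm a w) x) (rm (lm a z) y) = star x * ip w z * y := fun a x y w z ha => by
    rw [ip_rm, ip_rm_left, ip_lm_lm ha]
  refine ⟨fun i => ?_, fun i j hij => ?_⟩
  · simp only [wilhelmAction, twoSided_eq]
    rw [key _ _ _ _ _ (by split_ifs <;> simp [hp, hq]), hu.1 i, mul_one,
      star_mul_self_of_norm (by simp [hq])]
  · have h := hu.2 i j hij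
    simp only [wilhelmAction, twoSided_eq, pole] at h ⊢
    by_cases hi : (i : ℕ) = 0
    · have hj : (j : ℕ) < 2 := by omega
      have hi' : (i : ℕ) < 2 := by omega
      simp only [hi, hj, if_true] at h ⊢
      rw [if_pos (by norm_num), key _ _ _ _ _ hp, h]; simp
    · have hj : ¬(j : ℕ) < 2 := by omega
      have hj' : (⟨(j : ℕ) - 1, lt_of_le_of_lt (Nat.sub_le _ _) j.isLt⟩ : Fin m) = i :=
        Fin.ext (by simp; omega)
      simp only [hi, hj, if_false, hj'] at h ⊢
      rw [cj_rm, cj_lm, ← lm_rm, lm_rm, star_star, lm_rm, ip_rm_left, ip_rm, ip_lm_lm (hq i), h]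
      simp

lemma wilhelmAction_add {m : ℕ} (p : ℍ[ℝ]) (q : Fin m → ℍ[ℝ]) (u v : Fin m → ℍ[ℝ] × ℍ[ℝ]) :
    wilhelmAction m p q (u + v) = wilhelmAction m p q u + wilhelmAction m p q v := by
  funext i
  simp [wilhelmAction, twoSided_eq, lm_add, add_rm]

lemma wilhelmAction_smul {m : ℕ} (p : ℍ[ℝ]) (q : Fin m → ℍ[ℝ]) (c : ℝ)
    (u : Fin m → ℍ[ℝ] × ℍ[ℝ]) : wilhelmAction m p q (c • u) = c • wilhelmAction m p q u := by
  funext i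
  simp [wilhelmAction, twoSided]

lemma fderiv_wilhelmAction {m : ℕ} (p : ℍ[ℝ]) (q : Fin m → ℍ[ℝ]) (u v : Fin m → ℍ[ℝ] × ℍ[ℝ]) :
    fderiv ℝ (wilhelmAction m p q) u v = wilhelmAction m p q v := by
  let L : (Fin m → ℍ[ℝ] × ℍ[ℝ]) →L[ℝ] (Fin m → ℍ[ℝ] × ℍ[ℝ]) := LinearMap.toContinuousLinearMap
    { toFun := wilhelmAction m p q
      map_add' := wilhelmAction_add p q
      map_smul' := wilhelmAction_smul p q }
  have h : HasFDerivAt (wilhelmAction m p q) L u := L.hasFDerivAt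
  rw [h.fderiv]
  rfl

lemma re_conj_mul {r a b : ℍ[ℝ]} (hr : ‖r‖ = 1) :
    (star (star r * a * r) * (star r * b * r)).re = (star a * b).re := by
  have h : star (star r * a * r) * (star r * b * r) = star r * (star a * b) * r := by
    calc _ = star r * star a * (r * star r) * b * r := by simp [mul_assoc]
      _ = _ := by rw [mul_star_self_of_norm hr]; noncomm_ring
  have h2 : r.re ^ 2 + r.imI ^ 2 + r.imJ ^ 2 + r.imK ^ 2 = 1 := by
    have := congrArg (fun q : ℍ[ℝ] => q.re) (mul_star_self_of_norm hr)
    simp at this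
    linarith
  rw [h]
  generalize star a * b = c
  simp
  linear_combination c.re * h2

/-- The horizontal part of a tangent vector under a moving gauge transformation. -/
lemma orth_gauge {u v : ℍ[ℝ] × ℍ[ℝ]} {p r r' : ℍ[ℝ]} (hp : ‖p‖ = 1) (hr : ‖r‖ = 1)
    (hu : ip u u = 1) :
    orth (rm (lm p u) r) (rm (lm p v) r + rm (lm p u) r') = rm (lm p (orth u v)) r := by
  have e : ip (rm (lm p u) r) (rm (lm p v) r + rm (lm p u) r') = star r * (ip u v * r + r') := by
    rw [ip_add, ip_rm_left, ip_rm_left, ip_rm, ip_rm, ip_lm_lm hp, ip_lm_lm hp, hu]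
    noncomm_ring
  rw [orth, e, rm_rm, ← mul_assoc, mul_star_self_of_norm hr, one_mul, rm_add, orth]
  have e2 : lm p (v - rm u (ip u v)) = lm p v - rm (lm p u) (ip u v) := by
    simp [lm, rm, mul_sub, mul_assoc]
  rw [e2, sub_rm, rm_rm]
  abel

lemma re_ip_gauge {x y : ℍ[ℝ] × ℍ[ℝ]} {p r : ℍ[ℝ]} (hp : ‖p‖ = 1) (hr : ‖r‖ = 1) :
    (ip (rm (lm p x) r) (rm (lm p y) r)).re = (ip x y).re := by
  rw [ip_rm, ip_rm_left, ip_lm_lm hp]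
  have := re_conj_mul (a := 1) (b := ip x y) hr
  simpa [star_mul_self_of_norm hr] using this

/-- This is `conn_gauge` with constant factors, `r' = 0`: each component of the connection form is
conjugated by a unit quaternion and the horizontal part is multiplied by units, which leaves the
inner products unchanged. -/
lemma preservesMetric_wilhelmAction {m : ℕ} (hm : 0 < m) (t : ℝ) {p : ℍ[ℝ]} {q : Fin m → ℍ[ℝ]}
    (hp : p ∈ S3) (hq : q ∈ S3pow m) :
    PreservesMetric (Sp2m m) (connMetric m t) (wilhelmAction m p q) := by
  refine ⟨fun u hu => wilhelmAction_mem hp hq hu, fun u hu v _ w _ => ?_⟩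
  rw [mem_Sp2m_iff] at hu
  have hu' : ∀ k < m, ip (ent u k) (ent u k) = 1 := fun k hk => by
    rw [ent_of_lt u hk]; exact hu.1 _
  rw [mem_S3_iff] at hp
  have hr : ∀ k < m, ‖star (ent q k)‖ = 1 := fun k hk => by
    rw [ent_of_lt q hk, norm_star]; exact mem_S3_iff.1 (hq _)
  rw [fderiv_wilhelmAction, fderiv_wilhelmAction, connMetric_apply, connMetric_apply]
  have hc : ∀ n < m, ∀ v : Fin m → ℍ[ℝ] × ℍ[ℝ],
      conn (ent (wilhelmAction m p q u)) (ent (wilhelmAction m p q v)) n =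
        star (star (ent q n)) * conn (ent u) (ent v) n * star (ent q n) := by
    intro n hn v
    have h := conn_gauge (u := ent u) (v := ent v) (r := fun k => star (ent q k))
      (r' := fun _ => 0) (n := n) hp (fun k hk => hu' k (by omega)) (fun k hk => hr k (by omega))
      (by simp)
    have hl : ∀ k, lft 0 (fun _ => (0 : ℍ[ℝ])) k = 0 := fun k => by
      cases k <;> simp [lft]
    simp only [hl, zero_mul, add_zero] at h
    rw [← h]
    refine conn_congr (fun k hk => ent_wilhelmAction p q u (by omega)) (fun k hk => ?_)
    rw [ent_wilhelmAction p q v (by omega)]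
    simp [rm]
  unfold metricFun
  congr 1
  · simp only [ent_wilhelmAction p q _ hm]
    have h0 := hr 0 hm
    have ho : ∀ v : ℍ[ℝ] × ℍ[ℝ], orth (rm (lm p (ent u 0)) (star (ent q 0)))
        (rm (lm p v) (star (ent q 0))) = rm (lm p (orth (ent u 0) v)) (star (ent q 0)) :=
      fun v => by
        have := orth_gauge (v := v) (r' := 0) hp h0 (hu' 0 hm)
        rwa [rm_zero, add_zero] at this
    simp only [lft, ho, re_ip_gauge hp h0]
  · congr 1
    refine Finset.sum_congr rfl fun n hn => ?_
    rw [Finset.mem_range] at hn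
    rw [hc n hn v, hc n hn w, re_conj_mul (hr n hn)]

/-! ### Admissible sequences -/

/-- The equations of `Sp(2,m)` for the first `m` terms of a sequence of columns. -/
def Adm (m : ℕ) (u : ℕ → ℍ[ℝ] × ℍ[ℝ]) : Prop :=
  (∀ k < m, ip (u k) (u k) = 1) ∧ ∀ k, k + 1 < m → ip (pole k (u k)) (u (k + 1)) = 0

lemma mem_Sp2m_iff_adm {m : ℕ} {u : Fin m → ℍ[ℝ] × ℍ[ℝ]} : u ∈ Sp2m m ↔ Adm m (ent u) := by
  rw [mem_Sp2m_iff, Adm]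
  refine and_congr ⟨fun h k hk => ?_, fun h i => ?_⟩ ⟨fun h k hk => ?_, fun h i j hij => ?_⟩
  · rw [ent_of_lt u hk]; exact h _
  · simpa using h i i.2
  · rw [ent_of_lt u hk, ent_of_lt u (show k < m by omega)]
    exact h ⟨k, by omega⟩ ⟨k + 1, hk⟩ rfl
  · have := h i (by omega)
    rw [← hij] at this
    simpa using this

/-! ### Local sections of `Sp(2,m) → S⁴` -/

/-- The factor `1 / √(1 + |y|²)`. -/
def rho (y : ℍ[ℝ]) : ℝ := (√(1 + ‖y‖ ^ 2))⁻¹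

lemma rho_pos (y : ℍ[ℝ]) : 0 < rho y := by unfold rho; positivity

lemma rho_sq (y : ℍ[ℝ]) : rho y ^ 2 * (1 + ‖y‖ ^ 2) = 1 := by
  rw [rho, inv_pow, Real.sq_sqrt (by positivity), inv_mul_cancel₀ (by positivity)]

@[simp] lemma rho_zero : rho 0 = 1 := by simp [rho]

@[fun_prop]
lemma contDiffAt_rho {E : Type*} [NormedAddCommGroup E] [NormedSpace ℝ E] {n : WithTop ℕ∞}
    {f : E → ℍ[ℝ]} {x : E} (hf : ContDiffAt ℝ n f x) : ContDiffAt ℝ n (fun x => rho (f x)) x := by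
  have h1 : ContDiffAt ℝ n (fun x => 1 + ‖f x‖ ^ 2) x := contDiffAt_const.add (hf.norm_sq ℝ)
  exact (h1.sqrt (by positivity)).inv (by positivity)

/-- The section through `p` of `Sp(2,m) → S⁴` over the affine chart of `S⁴ = ℍP¹` given
by `p 0` and `p 1`, with value `p` at `y = 0`. -/
def sec (p : ℕ → ℍ[ℝ] × ℍ[ℝ]) (y : ℍ[ℝ]) : ℕ → ℍ[ℝ] × ℍ[ℝ]
  | 0 => rho y • (p 0 + rm (p 1) y)
  | n + 1 => if n = 0 then rho y • (p 1 - rm (p 0) (star y)) else northo (cj (sec p y n)) (p (n + 1))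

/-- The set of parameters where the section is defined. -/
def Good (m : ℕ) (p : ℕ → ℍ[ℝ] × ℍ[ℝ]) (y : ℍ[ℝ]) : Prop :=
  ∀ n, n ≠ 0 → n + 1 < m → orth (cj (sec p y n)) (p (n + 1)) ≠ 0

section Sec

variable {m : ℕ} {p : ℕ → ℍ[ℝ] × ℍ[ℝ]} {y : ℍ[ℝ]}

lemma sec_zero (p : ℕ → ℍ[ℝ] × ℍ[ℝ]) (y : ℍ[ℝ]) :
    sec p y 0 = rho y • (p 0 + rm (p 1) y) := rfl

lemma sec_one (p : ℕ → ℍ[ℝ] × ℍ[ℝ]) (y : ℍ[ℝ]) :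
    sec p y 1 = rho y • (p 1 - rm (p 0) (star y)) := by simp [sec]

lemma sec_succ (p : ℕ → ℍ[ℝ] × ℍ[ℝ]) (y : ℍ[ℝ]) {n : ℕ} (hn : n ≠ 0) :
    sec p y (n + 1) = northo (cj (sec p y n)) (p (n + 1)) := by simp [sec, hn]

/-- The first two columns have length 1 by `rho_sq`, and their cross terms `star y` and `-star y`
cancel. The later columns are normalized projections onto the required complements. -/
lemma sec_adm (hm : 1 < m) (hp : Adm m p) (hy : Good m p y) : Adm m (sec p y) := by
  have h00 := hp.1 0 (by omega)
  have h11 := hp.1 1 hm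
  have h01 : ip (p 0) (p 1) = 0 := by simpa [pole] using hp.2 0 hm
  have h10 : ip (p 1) (p 0) = 0 := by rw [← star_ip, h01, star_zero]
  have hr : (rho y * rho y) • ((1 : ℍ[ℝ]) + ((‖y‖ ^ 2 : ℝ) : ℍ[ℝ])) = 1 := by
    rw [← Quaternion.coe_one, ← Quaternion.coe_add, ← Quaternion.coe_smul, smul_eq_mul, ← sq,
      rho_sq]
  have e0 : ip (sec p y 0) (sec p y 0) = 1 := by
    rw [sec_zero, ip_smul, ip_smul_left, smul_smul, ip_add, ip_add_left, ip_add_left, ip_rm, ip_rm,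
      ip_rm_left, ip_rm_left, h00, h11, h01, h10, mul_one, star_mul_self_eq]
    refine Eq.trans ?_ hr
    simp
  have e1 : ip (sec p y 1) (sec p y 1) = 1 := by
    rw [sec_one, ip_smul, ip_smul_left, smul_smul, ip_sub, ip_sub_left, ip_sub_left, ip_rm, ip_rm,
      ip_rm_left, ip_rm_left, h00, h11, h01, h10, mul_one, star_star, mul_star_self_eq]
    refine Eq.trans ?_ hr
    simp
  have e2 : ∀ k < m, ip (sec p y k) (sec p y k) = 1 := by
    intro k hk
    rcases k with _ | _ | k
    · exact e0
    · exact e1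
    · rw [sec_succ _ _ (Nat.succ_ne_zero k)]
      exact ip_northo_self (hy (k + 1) (by omega) hk)
  refine ⟨e2, fun k hk => ?_⟩
  rcases k with _ | k
  · rw [pole, if_pos rfl, sec_zero, zero_add, sec_one, ip_smul, ip_smul_left, smul_smul, ip_sub,
      ip_add_left, ip_add_left, ip_rm, ip_rm, ip_rm_left, ip_rm_left, h00, h11, h01, h10]
    simp
  · rw [pole, if_neg (Nat.succ_ne_zero k), sec_succ _ _ (Nat.succ_ne_zero k)]
    exact ip_northo (ip_cj_self (e2 (k + 1) (by omega)))

lemma sec_at_zero (hp : Adm m p) {n : ℕ} (hn : n < m) : sec p 0 n = p n := by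
  induction n with
  | zero => simp [sec_zero]
  | succ n ih =>
    by_cases h : n = 0
    · subst h; simp [sec_one]
    · rw [sec_succ _ _ h, ih (by omega)]
      have h1 : ip (cj (p n)) (p (n + 1)) = 0 := by simpa [pole, h] using hp.2 n hn
      have h2 : orth (cj (p n)) (p (n + 1)) = p (n + 1) := by rw [orth, h1, rm_zero, sub_zero]
      rw [northo, h2, nsq, hp.1 _ hn]
      simp

lemma good_zero (hp : Adm m p) : Good m p 0 := by
  intro n hn hnm
  rw [sec_at_zero hp (by omega)]
  have h1 : ip (cj (p n)) (p (n + 1)) = 0 := by simpa [pole, hn] using hp.2 n hnm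
  rw [orth, h1, rm_zero, sub_zero]
  intro h0
  have := hp.1 _ hnm
  rw [h0] at this
  simp at this

lemma contDiffAt_sec {E : Type*} [NormedAddCommGroup E] [NormedSpace ℝ E] {k : WithTop ℕ∞} {x : E}
    {f : E → ℕ → ℍ[ℝ] × ℍ[ℝ]} {g : E → ℍ[ℝ]} (hf : ∀ j, ContDiffAt ℝ k (fun x => f x j) x)
    (hg : ContDiffAt ℝ k g x) (hgood : Good m (f x) (g x)) {n : ℕ} (hn : n < m) :
    ContDiffAt ℝ k (fun x => sec (f x) (g x) n) x := by
  induction n with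
  | zero =>
    have h0 := hf 0
    have h1 := hf 1
    simp only [sec_zero]; fun_prop
  | succ n ih =>
    by_cases h : n = 0
    · subst h
      have h0 := hf 0
      have h1 := hf 1
      simp only [sec, if_true]; fun_prop
    · simp only [sec_succ _ _ h]
      exact contDiffAt_northo (contDiffAt_cj (ih (by omega))) (hf _) (hgood n h hn)

lemma eventually_good {E : Type*} [NormedAddCommGroup E] [NormedSpace ℝ E] {x : E}
    {f : E → ℕ → ℍ[ℝ] × ℍ[ℝ]} {g : E → ℍ[ℝ]} (hf : ∀ j, ContDiffAt ℝ ω (fun x => f x j) x)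
    (hg : ContDiffAt ℝ ω g x) (hgood : Good m (f x) (g x)) : ∀ᶠ x in nhds x, Good m (f x) (g x) := by
  have h : ∀ n ∈ Finset.range m, ∀ᶠ x in nhds x, n ≠ 0 → n + 1 < m →
      orth (cj (sec (f x) (g x) n)) (f x (n + 1)) ≠ 0 := by
    intro n hn
    by_cases h : n ≠ 0 ∧ n + 1 < m
    · have hc : ContDiffAt ℝ ω (fun x => orth (cj (sec (f x) (g x) n)) (f x (n + 1))) x :=
        contDiffAt_orth (contDiffAt_cj (contDiffAt_sec hf hg hgood (by simpa using hn))) (hf _)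
      filter_upwards [hc.continuousAt.eventually_ne (hgood n h.1 h.2)] with z hz _ _
      exact hz
    · filter_upwards with z h1 h2
      exact absurd ⟨h1, h2⟩ h
  filter_upwards [(Finset.eventually_all _).2 h] with z hz n h1 h2
  exact hz n (Finset.mem_range.2 (by omega)) h1 h2

end Sec

/-! ### Derivatives along curves -/

section Curves

variable {f g : ℝ → ℍ[ℝ] × ℍ[ℝ]} {f' g' : ℍ[ℝ] × ℍ[ℝ]} {a : ℝ → ℍ[ℝ]} {a' : ℍ[ℝ]} {s : ℝ}

lemma hasDerivAt_star (h : HasDerivAt a a' s) : HasDerivAt (fun s => star (a s)) (star a') s :=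
  starQ.hasFDerivAt.comp_hasDerivAt s h

lemma hasDerivAt_fst (h : HasDerivAt f f' s) : HasDerivAt (fun s => (f s).1) f'.1 s :=
  (ContinuousLinearMap.fst ℝ ℍ[ℝ] ℍ[ℝ]).hasFDerivAt.comp_hasDerivAt s h

lemma hasDerivAt_snd (h : HasDerivAt f f' s) : HasDerivAt (fun s => (f s).2) f'.2 s :=
  (ContinuousLinearMap.snd ℝ ℍ[ℝ] ℍ[ℝ]).hasFDerivAt.comp_hasDerivAt s h

lemma hasDerivAt_ip (hf : HasDerivAt f f' s) (hg : HasDerivAt g g' s) :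
    HasDerivAt (fun s => ip (f s) (g s)) (ip f' (g s) + ip (f s) g') s := by
  have h := ((hasDerivAt_star (hasDerivAt_fst hf)).mul (hasDerivAt_fst hg)).add
    ((hasDerivAt_star (hasDerivAt_snd hf)).mul (hasDerivAt_snd hg))
  refine h.congr_deriv ?_
  simp only [Wilhelm.ip]; abel

lemma hasDerivAt_cj (hf : HasDerivAt f f' s) :
    HasDerivAt (fun s => cj (f s)) (cj f') s :=
  (hasDerivAt_star (hasDerivAt_fst hf)).prodMk (hasDerivAt_star (hasDerivAt_snd hf))

lemma hasDerivAt_rm (hf : HasDerivAt f f' s) (ha : HasDerivAt a a' s) :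
    HasDerivAt (fun s => rm (f s) (a s)) (rm f' (a s) + rm (f s) a') s :=
  ((hasDerivAt_fst hf).mul ha).prodMk ((hasDerivAt_snd hf).mul ha)

lemma hasDerivAt_lm (ha : HasDerivAt a a' s) (hf : HasDerivAt f f' s) :
    HasDerivAt (fun s => lm (a s) (f s)) (lm a' (f s) + lm (a s) f') s :=
  (ha.mul (hasDerivAt_fst hf)).prodMk (ha.mul (hasDerivAt_snd hf))

/-- A curve of unit columns is orthogonal to its velocity. -/
lemma re_ip_deriv_eq_zero (hf : HasDerivAt f f' s) (h1 : ∀ᶠ z in nhds s, ip (f z) (f z) = 1) :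
    (ip (f s) f').re = 0 := by
  have h := (hasDerivAt_ip hf hf).unique
    ((hasDerivAt_const s (1 : ℍ[ℝ])).congr_of_eventuallyEq h1)
  have h2 := congrArg (fun q : ℍ[ℝ] => q.re) h
  simp only [Quaternion.re_add, Quaternion.re_zero, ← star_ip (f s) f', Quaternion.re_star] at h2
  linarith

end Curves

/-! ### The pulled back connection form -/

lemma contDiffAt_fderiv_apply {E F : Type*} [NormedAddCommGroup E] [NormedSpace ℝ E]
    [NormedAddCommGroup F] [NormedSpace ℝ F] {f : E → F} {x : E} (hf : ContDiffAt ℝ ω f x) (v : E) :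
    ContDiffAt ℝ ω (fun x => fderiv ℝ f x v) x :=
  (hf.fderiv_right (m := ω) (by simp)).clm_apply contDiffAt_const

/-- The local section as a function of the centre and the parameter. -/
def sect (m : ℕ) (z : (Fin m → ℍ[ℝ] × ℍ[ℝ]) × ℍ[ℝ]) : Fin m → ℍ[ℝ] × ℍ[ℝ] :=
  fun i => sec (ent z.1) z.2 i

/-- The derivative of the local section in the direction `X`. -/
def dsect (m : ℕ) (z : (Fin m → ℍ[ℝ] × ℍ[ℝ]) × ℍ[ℝ]) (X : ℍ[ℝ]) : Fin m → ℍ[ℝ] × ℍ[ℝ] :=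
  fderiv ℝ (sect m) z (0, X)

/-- The pull-back of the connection form by the local section, evaluated on `X`. -/
def form (m : ℕ) (z : (Fin m → ℍ[ℝ] × ℍ[ℝ]) × ℍ[ℝ]) (X : ℍ[ℝ]) (n : ℕ) : ℍ[ℝ] :=
  conn (ent (sect m z)) (ent (dsect m z X)) n

section Form

variable {m : ℕ} {p : Fin m → ℍ[ℝ] × ℍ[ℝ]} {y : ℍ[ℝ]} {X : ℍ[ℝ]} {n : ℕ}

lemma ent_sect (hn : n < m) : ent (sect m (p, y)) n = sec (ent p) y n := by
  rw [ent_of_lt _ hn]; rfl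

lemma contDiffAt_sect (hy : Good m (ent p) y) : ContDiffAt ℝ ω (sect m) (p, y) := by
  refine contDiffAt_pi.2 fun i => ?_
  exact contDiffAt_sec (m := m)
    (f := fun z : (Fin m → ℍ[ℝ] × ℍ[ℝ]) × ℍ[ℝ] => ent z.1)
    (g := fun z : (Fin m → ℍ[ℝ] × ℍ[ℝ]) × ℍ[ℝ] => z.2) (fun j => by fun_prop) (by fun_prop) hy i.2

lemma contDiffAt_dsect (hy : Good m (ent p) y) (X : ℍ[ℝ]) :
    ContDiffAt ℝ ω (fun z => dsect m z X) (p, y) :=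
  contDiffAt_fderiv_apply (contDiffAt_sect hy) (0, X)

lemma contDiffAt_form (hy : Good m (ent p) y) (X : ℍ[ℝ]) (n : ℕ) :
    ContDiffAt ℝ ω (fun z => form m z X n) (p, y) := by
  have h1 := contDiffAt_sect hy
  have h2 := contDiffAt_dsect hy X
  exact contDiffAt_conn (fun j _ => contDiffAt_ent h1) (fun j _ => contDiffAt_ent h2)

lemma hasDerivAt_sect (hy : Good m (ent p) y) (X : ℍ[ℝ]) :
    HasDerivAt (fun s : ℝ => sect m (p, y + s • X)) (dsect m (p, y) X) 0 := by
  have h1 : HasDerivAt (fun s : ℝ => (p, y + s • X)) ((0, X) : (Fin m → ℍ[ℝ] × ℍ[ℝ]) × ℍ[ℝ]) 0 := by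
    refine (hasDerivAt_const _ _).prodMk ?_
    simpa using ((hasDerivAt_id (0 : ℝ)).smul_const X).const_add y
  have h2 : HasFDerivAt (sect m) (fderiv ℝ (sect m) (p, y)) (p, y + (0 : ℝ) • X) := by
    rw [zero_smul, add_zero]
    exact ((contDiffAt_sect hy).differentiableAt (by simp)).hasFDerivAt
  exact h2.comp_hasDerivAt 0 h1

lemma hasDerivAt_sec (hy : Good m (ent p) y) (X : ℍ[ℝ]) (hn : n < m) :
    HasDerivAt (fun s : ℝ => sec (ent p) (y + s • X) n) (ent (dsect m (p, y) X) n) 0 := by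
  rw [ent_of_lt _ hn]
  exact hasDerivAt_pi.1 (hasDerivAt_sect hy X) ⟨n, hn⟩

lemma eventually_good_line (hy : Good m (ent p) y) (X : ℍ[ℝ]) :
    ∀ᶠ s : ℝ in nhds 0, Good m (ent p) (y + s • X) :=
  eventually_good (m := m) (f := fun _ : ℝ => ent p) (g := fun s : ℝ => y + s • X) (x := 0)
    (fun j => contDiffAt_const) (by fun_prop) (by simpa using hy)

lemma re_ip_dsect (hm : 1 < m) (hp : Adm m (ent p)) (hy : Good m (ent p) y) (X : ℍ[ℝ])
    (hn : n < m) : (ip (sec (ent p) y n) (ent (dsect m (p, y) X) n)).re = 0 := by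
  have h := re_ip_deriv_eq_zero (hasDerivAt_sec hy X hn)
    (by filter_upwards [eventually_good_line hy X] with s hs using (sec_adm hm hp hs).1 n hn)
  simpa using h

lemma re_ip_lm_self (a : ℍ[ℝ]) (x : ℍ[ℝ] × ℍ[ℝ]) (ha : a.re = 0) : (ip x (lm a x)).re = 0 := by
  simp [ip, lm, ha]; ring

lemma re_conn {u v : ℕ → ℍ[ℝ] × ℍ[ℝ]} (h : ∀ k ≤ n, (ip (u k) (v k)).re = 0) :
    (conn u v n).re = 0 := by
  induction n with
  | zero => exact h 0 le_rfl
  | succ n ih =>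
    have := ih fun k hk => h k (by omega)
    rw [conn, Quaternion.re_add, h _ le_rfl, zero_add]
    refine re_ip_lm_self _ _ ?_
    split_ifs <;> simp [this]

/-- The pulled back connection form is imaginary. -/
lemma re_form (hm : 1 < m) (hp : Adm m (ent p)) (hy : Good m (ent p) y) (X : ℍ[ℝ])
    (hn : n < m) : (form m (p, y) X n).re = 0 := by
  refine re_conn fun k hk => ?_
  rw [ent_sect (by omega)]
  exact re_ip_dsect hm hp hy X (by omega)

/-- Differentiating `rho` contributes only a real multiple of the section, which disappears from
orthogonal parts and from the imaginary part of the connection form, so its value is left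
unspecified. -/
lemma dsect_zero (hm : 1 < m) (hy : Good m (ent p) y) (X : ℍ[ℝ]) :
    ∃ c : ℝ, ent (dsect m (p, y) X) 0 = c • sec (ent p) y 0 + rho y • rm (ent p 1) X := by
  have h := hasDerivAt_sec hy X (show 0 < m by omega)
  have hr : DifferentiableAt ℝ (fun s : ℝ => rho (y + s • X)) 0 :=
    ContDiffAt.differentiableAt (n := ω) (by fun_prop) (by simp)
  have h1 : HasDerivAt (fun s : ℝ => y + s • X) X 0 := by
    simpa using ((hasDerivAt_id (0 : ℝ)).smul_const X).const_add y
  have h2 := hr.hasDerivAt.fun_smul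
    ((hasDerivAt_rm (hasDerivAt_const (0 : ℝ) (ent p 1)) h1).const_add (ent p 0))
  refine ⟨deriv (fun s : ℝ => rho (y + s • X)) 0 * (rho y)⁻¹, h.unique (h2.congr_deriv ?_)⟩
  rw [sec_zero, smul_smul, mul_assoc, inv_mul_cancel₀ (rho_pos y).ne']
  simp [add_comm]

lemma dsect_one (hm : 1 < m) (hy : Good m (ent p) y) (X : ℍ[ℝ]) :
    ∃ c : ℝ, ent (dsect m (p, y) X) 1 =
      c • sec (ent p) y 1 - rho y • rm (ent p 0) (star X) := by
  have h := hasDerivAt_sec hy X hm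
  have hr : DifferentiableAt ℝ (fun s : ℝ => rho (y + s • X)) 0 :=
    ContDiffAt.differentiableAt (n := ω) (by fun_prop) (by simp)
  have h1 : HasDerivAt (fun s : ℝ => y + s • X) X 0 := by
    simpa using ((hasDerivAt_id (0 : ℝ)).smul_const X).const_add y
  have h2 := hr.hasDerivAt.fun_smul
    ((hasDerivAt_rm (hasDerivAt_const (0 : ℝ) (ent p 0)) (hasDerivAt_star h1)).const_sub (ent p 1))
  have h3 := h2.congr_of_eventuallyEq (f₁ := fun s : ℝ => sec (ent p) (y + s • X) 1)
    (.of_forall fun s => sec_one _ _)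
  refine ⟨deriv (fun s : ℝ => rho (y + s • X)) 0 * (rho y)⁻¹, h.unique (h3.congr_deriv ?_)⟩
  rw [sec_one, smul_smul, mul_assoc, inv_mul_cancel₀ (rho_pos y).ne']
  simp [sub_eq_add_neg, add_comm]

/-- The horizontal part of the velocity of the first column of the section. -/
lemma orth_dsect (hm : 1 < m) (hp : Adm m (ent p)) (hy : Good m (ent p) y) (X : ℍ[ℝ]) :
    orth (sec (ent p) y 0) (ent (dsect m (p, y) X) 0) = rho y ^ 2 • rm (sec (ent p) y 1) X := by
  obtain ⟨c, hc⟩ := dsect_zero hm hy X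
  have h0 := (sec_adm hm hp hy).1 0 (by omega)
  have h1 : orth (sec (ent p) y 0) (sec (ent p) y 0) = 0 := by
    rw [orth, h0, rm_one, sub_self]
  rw [hc, orth_add, orth_smul, h1, smul_zero, zero_add, orth_smul]
  have h11 := hp.1 1 hm
  have h01 : ip (ent p 0) (ent p 1) = 0 := by simpa [pole] using hp.2 0 hm
  have h2 : orth (sec (ent p) y 0) (rm (ent p 1) X) = rho y • rm (sec (ent p) y 1) X := by
    rw [orth, ip_rm, sec_zero, sec_one, ip_smul_left, ip_add_left, h01, zero_add, ip_rm_left, h11,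
      mul_one]
    have hr := rho_sq y
    have h3 : rm (ent p 1) (y * star y) = (‖y‖ ^ 2) • ent p 1 := by
      rw [mul_star_self_eq, rm_coe]
    rw [← rm_rm, ← sub_rm, ← smul_rm]
    congr 1
    rw [smul_rm, rm_smul, add_rm, rm_rm, h3, smul_smul, smul_smul, ← sq, smul_add, smul_sub,
      smul_smul]
    have h4 : ent p 1 = (rho y ^ 2 * (1 + ‖y‖ ^ 2)) • ent p 1 := by rw [hr, one_smul]
    nth_rewrite 1 [h4]
    module
  rw [h2, smul_smul, sq]

/-- The imaginary part is the standard instanton form `Im(ȳ dy) / (1 + |y|²)`. -/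
lemma form_zero (hm : 1 < m) (hp : Adm m (ent p)) (hy : Good m (ent p) y) (X : ℍ[ℝ]) :
    ∃ c : ℝ, form m (p, y) X 0 = (c : ℍ[ℝ]) + rho y ^ 2 • (star y * X) := by
  obtain ⟨c, hc⟩ := dsect_zero hm hy X
  have h0 := (sec_adm hm hp hy).1 0 (by omega)
  have h11 := hp.1 1 hm
  have h01 : ip (ent p 0) (ent p 1) = 0 := by simpa [pole] using hp.2 0 hm
  refine ⟨c, ?_⟩
  rw [form, conn_zero, ent_sect (by omega), hc, ip_add, ip_smul, h0, ip_smul, ip_rm, sec_zero,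
    ip_smul_left, ip_add_left, h01, ip_rm_left, h11, smul_mul_assoc, smul_smul, sq, zero_add,
    mul_one]
  congr 1
  rw [← Quaternion.coe_one, ← Quaternion.coe_smul, smul_eq_mul, mul_one]

lemma form_one (hm : 1 < m) (hp : Adm m (ent p)) (hy : Good m (ent p) y) (X : ℍ[ℝ]) :
    ∃ c : ℝ, form m (p, y) X 1 = (c : ℍ[ℝ]) + rho y ^ 2 • (y * star X) := by
  obtain ⟨c, hc⟩ := dsect_one hm hy X
  have h0 := (sec_adm hm hp hy).1 1 hm
  have h00 := hp.1 0 (by omega)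
  have h01 : ip (ent p 0) (ent p 1) = 0 := by simpa [pole] using hp.2 0 hm
  have h10 : ip (ent p 1) (ent p 0) = 0 := by rw [← star_ip, h01, star_zero]
  refine ⟨c, ?_⟩
  rw [form, conn_one, ent_sect hm, hc, ip_sub, ip_smul, h0, ip_smul, ip_rm, sec_one,
    ip_smul_left, ip_sub_left, h10, ip_rm_left, h00, smul_mul_assoc, smul_smul, sq, zero_sub,
    mul_one, star_star, neg_mul, smul_neg, sub_neg_eq_add]
  congr 1
  rw [← Quaternion.coe_one, ← Quaternion.coe_smul, smul_eq_mul, mul_one]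

/-- The velocity of the later columns of the section along the section. -/
lemma ip_dsect_succ (hm : 1 < m) (hp : Adm m (ent p)) (hy : Good m (ent p) y) (X : ℍ[ℝ])
    (hn : n ≠ 0) (hnm : n + 1 < m) :
    let x := cj (sec (ent p) y n)
    let x' := cj (ent (dsect m (p, y) X) n)
    let q := ent p (n + 1)
    ∃ c : ℝ, ip (sec (ent p) y (n + 1)) (ent (dsect m (p, y) X) (n + 1)) =
      (c : ℍ[ℝ]) + (nsq (orth x q))⁻¹ • (-(star (ip x' q) * ip x q) +
        star (ip x q) * ip x x' * ip x q) := by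
  intro x x' q
  have hx1 : ip x x = 1 := ip_cj_self ((sec_adm hm hp hy).1 n (by omega))
  have h := hasDerivAt_sec hy X hnm
  have hx : HasDerivAt (fun s : ℝ => cj (sec (ent p) (y + s • X) n)) x' 0 :=
    hasDerivAt_cj (hasDerivAt_sec hy X (by omega))
  have hx0 : cj (sec (ent p) (y + (0 : ℝ) • X) n) = x := by simp [x]
  have hw : HasDerivAt (fun s : ℝ => orth (cj (sec (ent p) (y + s • X) n)) q)
      (-(rm x' (ip x q) + rm x (ip x' q))) 0 := by
    have h1 := hasDerivAt_ip hx (hasDerivAt_const (0 : ℝ) q)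
    have h2 := (hasDerivAt_rm hx h1).const_sub q
    exact h2.congr_deriv (by rw [hx0, ip_zero, add_zero])
  have hnz : 0 < nsq (orth x q) :=
    lt_of_le_of_ne (nsq_nonneg _) fun h' => hy n hn hnm (nsq_eq_zero.1 h'.symm)
  have hν : DifferentiableAt ℝ
      (fun s : ℝ => (√(nsq (orth (cj (sec (ent p) (y + s • X) n)) q)))⁻¹) 0 := by
    have hs : ContDiffAt ℝ ω (fun s : ℝ => sec (ent p) (y + s • X) n) 0 :=
      contDiffAt_sec (m := m) (f := fun _ : ℝ => ent p) (g := fun s : ℝ => y + s • X)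
        (fun j => contDiffAt_const) (by fun_prop) (by simpa using hy) (by omega)
    have h2 : ContDiffAt ℝ ω (fun s : ℝ => nsq (orth (cj (sec (ent p) (y + s • X) n)) q)) 0 := by
      fun_prop
    have h3 : nsq (orth (cj (sec (ent p) (y + (0 : ℝ) • X) n)) q) ≠ 0 := by
      rw [hx0]; exact hnz.ne'
    refine ((h2.sqrt h3).inv ?_).differentiableAt (by simp)
    rw [hx0]; exact (Real.sqrt_pos.2 hnz).ne'
  have h' := hν.hasDerivAt.fun_smul hw
  have hu := h.unique (h'.congr_of_eventuallyEq (.of_forall fun s => by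
    simp only [sec_succ _ _ hn, northo]; rfl))
  rw [hx0] at hu
  set ν := (√(nsq (orth x q)))⁻¹ with hνdef
  set ν' := deriv (fun s : ℝ => (√(nsq (orth (cj (sec (ent p) (y + s • X) n)) q)))⁻¹) 0
  have hν2 : ν * ν = (nsq (orth x q))⁻¹ := by
    rw [hνdef, ← mul_inv, Real.mul_self_sqrt hnz.le]
  -- The derivative of the normalizing factor contributes only along `orth x q` itself, hence a real
  -- number.
  refine ⟨ν * ν' * nsq (orth x q), ?_⟩
  rw [hu, sec_succ _ _ hn]
  change ip (ν • orth x q) _ = _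
  have hox : ip (orth x q) x = 0 := by rw [← star_ip, ip_orth hx1, star_zero]
  have hox' : ip (orth x q) x' = star (ip x' q) - star (ip x q) * ip x x' := by
    rw [orth, ip_sub_left, ip_rm_left, ← star_ip x' q]
  have hneg : ∀ a b : ℍ[ℝ] × ℍ[ℝ], ip a (-b) = -ip a b := fun a b => by simp [ip]; abel
  rw [ip_smul_left, ip_add, ip_smul, ip_smul, ip_self_eq_nsq, hneg, ip_add, ip_rm, ip_rm, hox,
    hox', zero_mul, add_zero, smul_add, smul_smul, smul_smul, ← hν2, add_comm]
  congr 1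
  · rw [← Quaternion.coe_smul, smul_eq_mul]
  · rw [sub_mul, neg_sub, sub_eq_add_neg, add_comm]

/-- The imaginary part of a quaternion. -/
def imQ : ℍ[ℝ] →L[ℝ] ℍ[ℝ] := (1 / 2 : ℝ) • (ContinuousLinearMap.id ℝ ℍ[ℝ] - starQ)

lemma imQ_apply (a : ℍ[ℝ]) : imQ a = (1 / 2 : ℝ) • (a - star a) := rfl

lemma imQ_coe (c : ℝ) : imQ (c : ℍ[ℝ]) = 0 := by simp [imQ_apply]

lemma imQ_of_re {a : ℍ[ℝ]} (h : a.re = 0) : imQ a = a := by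
  rw [imQ_apply]
  ext <;> simp [h] <;> ring

/-- On the ray `y = s X` the products `star y * X` and `y * star X` are real, and the form is
imaginary. -/
lemma form_radial (hm : 1 < m) (hp : Adm m (ent p)) {s : ℝ} (hy : Good m (ent p) (s • X)) :
    form m (p, s • X) X 0 = 0 ∧ form m (p, s • X) X 1 = 0 := by
  constructor
  · obtain ⟨c, hc⟩ := form_zero hm hp hy X
    rw [← imQ_of_re (re_form hm hp hy X (by omega)), hc]
    have : rho (s • X) ^ 2 • (star (s • X) * X) =
        ((rho (s • X) ^ 2 * (s * ‖X‖ ^ 2) : ℝ) : ℍ[ℝ]) := by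
      rw [Quaternion.star_smul, smul_mul_assoc, star_mul_self_eq, ← Quaternion.coe_smul,
        ← Quaternion.coe_smul, smul_eq_mul, smul_eq_mul]
    rw [this, map_add, imQ_coe, imQ_coe, add_zero]
  · obtain ⟨c, hc⟩ := form_one hm hp hy X
    rw [← imQ_of_re (re_form hm hp hy X (by omega)), hc]
    have : rho (s • X) ^ 2 • (s • X * star X) =
        ((rho (s • X) ^ 2 * (s * ‖X‖ ^ 2) : ℝ) : ℍ[ℝ]) := by
      rw [smul_mul_assoc, mul_star_self_eq, ← Quaternion.coe_smul,
        ← Quaternion.coe_smul, smul_eq_mul, smul_eq_mul]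
    rw [this, map_add, imQ_coe, imQ_coe, add_zero]

/-- The pulled back connection form vanishes to second order in radial directions. -/
lemma hasDerivAt_form_radial (hm : 1 < m) (hp : Adm m (ent p)) (X : ℍ[ℝ]) (hn : n < m) :
    form m (p, 0) X n = 0 ∧ HasDerivAt (fun s : ℝ => form m (p, s • X) X n) 0 0 := by
  have hg := good_zero hp
  have hev : ∀ᶠ s : ℝ in nhds 0, Good m (ent p) (s • X) := by
    simpa using eventually_good_line hg X
  have base : ∀ k, (∀ s : ℝ, Good m (ent p) (s • X) → form m (p, s • X) X k = 0) →
      form m (p, 0) X k = 0 ∧ HasDerivAt (fun s : ℝ => form m (p, s • X) X k) 0 0 := by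
    intro k hk
    refine ⟨by simpa using hk 0 (by simpa using hg), ?_⟩
    refine (hasDerivAt_const (0 : ℝ) (0 : ℍ[ℝ])).congr_of_eventuallyEq ?_
    filter_upwards [hev] with s hs using hk s hs
  induction n with
  | zero => exact base 0 fun s hs => (form_radial hm hp hs).1
  | succ n ih =>
    by_cases h0 : n = 0
    · subst h0; exact base 1 fun s hs => (form_radial hm hp hs).2
    obtain ⟨ih1, ih2⟩ := ih (by omega)
    set q := ent p (n + 1) with hq
    set C : ℝ → ℍ[ℝ] := fun s => ip (cj (sec (ent p) (s • X) n)) q with hC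
    set D : ℝ → ℍ[ℝ] := fun s => ip (cj (ent (dsect m (p, s • X) X) n)) q with hD
    set R : ℝ → ℍ[ℝ] := fun s => ip (cj (sec (ent p) (s • X) n)) (cj (ent (dsect m (p, s • X) X) n))
      with hR
    set N : ℝ → ℝ := fun s => (nsq (orth (cj (sec (ent p) (s • X) n)) q))⁻¹ with hN
    have hline : ContDiffAt ℝ ω (fun s : ℝ => (p, s • X)) 0 := by fun_prop
    have hd : ContDiffAt ℝ ω (fun s : ℝ => dsect m (p, s • X) X) 0 :=
      ContDiffAt.comp (f := fun s : ℝ => (p, s • X)) (g := fun z => dsect m z X) 0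
        (by simpa using contDiffAt_dsect hg X) hline
    have hs : ContDiffAt ℝ ω (fun s : ℝ => sec (ent p) (s • X) n) 0 :=
      contDiffAt_sec (m := m) (f := fun _ : ℝ => ent p) (g := fun s : ℝ => s • X)
        (fun j => contDiffAt_const) (by fun_prop) (by simpa using hg) (by omega)
    have hs' : ContDiffAt ℝ ω (fun s : ℝ => sec (ent p) (s • X) (n + 1)) 0 :=
      contDiffAt_sec (m := m) (f := fun _ : ℝ => ent p) (g := fun s : ℝ => s • X)
        (fun j => contDiffAt_const) (by fun_prop) (by simpa using hg) (by omega)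
    have hDd : DifferentiableAt ℝ D 0 :=
      ContDiffAt.differentiableAt (n := ω) (by fun_prop) (by simp)
    have hRd : DifferentiableAt ℝ R 0 :=
      ContDiffAt.differentiableAt (n := ω) (by fun_prop) (by simp)
    have hNd : DifferentiableAt ℝ N 0 := by
      have h1 : ContDiffAt ℝ ω (fun s : ℝ => nsq (orth (cj (sec (ent p) (s • X) n)) q)) 0 := by
        fun_prop
      refine (h1.inv fun h => ?_).differentiableAt (by simp)
      exact hg n h0 hn (by simpa using nsq_eq_zero.1 h)
    have hC0 : C 0 = 0 := by
      have h1 := hp.2 n hn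
      simp only [pole, h0, if_false] at h1
      simp only [hC, zero_smul, sec_at_zero hp (show n < m by omega)]
      exact h1
    have hCd : HasDerivAt C (D 0) 0 := by
      have h1 := hasDerivAt_ip (hasDerivAt_cj (hasDerivAt_sec hg X (show n < m by omega)))
        (hasDerivAt_const (0 : ℝ) q)
      simpa [hC, hD] using h1
    -- `C` vanishes at 0 with derivative `D 0`, so the derivative of the whole expression is `-N 0
    -- |D 0|²`. This is real, and `imQ` kills it in the next step.
    have hT : HasDerivAt (fun s => N s • (-(star (D s) * C s) + star (C s) * R s * C s))
        (N 0 • -(star (D 0) * D 0)) 0 := by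
      have h1 := (hasDerivAt_star hDd.hasDerivAt).fun_mul hCd
      have h2 := ((hasDerivAt_star hCd).fun_mul hRd.hasDerivAt).fun_mul hCd
      refine (hNd.hasDerivAt.fun_smul (h1.fun_neg.fun_add h2)).congr_deriv ?_
      simp [hC0]
    have hT' : HasDerivAt (fun s => imQ (N s • (-(star (D s) * C s) + star (C s) * R s * C s)))
        0 0 := by
      refine (imQ.hasFDerivAt.comp_hasDerivAt (0 : ℝ) hT).congr_deriv ?_
      rw [star_mul_self_eq, map_smul, map_neg, imQ_coe, neg_zero, smul_zero]
    have hL : HasDerivAt (fun s : ℝ => ip (sec (ent p) (s • X) (n + 1))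
        (lm (form m (p, s • X) X n) (sec (ent p) (s • X) (n + 1)))) 0 0 := by
      have h1 := (hs'.differentiableAt (by simp)).hasDerivAt
      refine (hasDerivAt_ip h1 (hasDerivAt_lm ih2 h1)).congr_deriv ?_
      rw [zero_smul, ih1]
      simp
    have hF : ∀ s : ℝ, Good m (ent p) (s • X) → form m (p, s • X) X (n + 1) =
        imQ (N s • (-(star (D s) * C s) + star (C s) * R s * C s)) +
        ip (sec (ent p) (s • X) (n + 1))
          (lm (form m (p, s • X) X n) (sec (ent p) (s • X) (n + 1))) := by
      intro s hs
      obtain ⟨c, hc⟩ := ip_dsect_succ hm hp hs X h0 hn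
      rw [← imQ_of_re (re_form hm hp hs X hn), form, conn_succ _ _ h0, ent_sect hn, hc, map_add,
        map_add, imQ_coe, zero_add]
      congr 1
      exact imQ_of_re (re_ip_lm_self _ _ (re_form hm hp hs X (by omega)))
    have hF' : HasDerivAt (fun s : ℝ => form m (p, s • X) X (n + 1)) 0 0 := by
      have := (hT'.fun_add hL).congr_of_eventuallyEq
        (f₁ := fun s : ℝ => form m (p, s • X) X (n + 1))
        (by filter_upwards [hev] with s hs using hF s hs)
      simpa using this
    refine ⟨?_, hF'⟩
    have := hF 0 (by simpa using hg)
    simp only [hC0, zero_smul, ih1] at this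
    simpa using this

end Form

/-! ### Real coordinates on quaternions -/

/-- The standard basis of `ℍ`. -/
def basisQ : Fin 4 → ℍ[ℝ] := ![⟨1, 0, 0, 0⟩, ⟨0, 1, 0, 0⟩, ⟨0, 0, 1, 0⟩, ⟨0, 0, 0, 1⟩]

/-- The standard basis of `Im ℍ`. -/
def basisIm : Fin 3 → ℍ[ℝ] := ![⟨0, 1, 0, 0⟩, ⟨0, 0, 1, 0⟩, ⟨0, 0, 0, 1⟩]

/-- The real inner product on `ℍ` as a linear form in the second variable. -/
def coordQ (e : ℍ[ℝ]) : ℍ[ℝ] →L[ℝ] ℝ :=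
  LinearMap.toContinuousLinearMap
    { toFun := fun a => (star e * a).re
      map_add' := fun a b => by simp [mul_add]
      map_smul' := fun c a => by simp }

lemma coordQ_apply (e a : ℍ[ℝ]) : coordQ e a = (star e * a).re := rfl

lemma coordQ_eq (e a : ℍ[ℝ]) :
    coordQ e a = e.re * a.re + e.imI * a.imI + e.imJ * a.imJ + e.imK * a.imK := by
  simp [coordQ_apply]

@[simp] lemma basisQ_re (k : Fin 4) : (basisQ k).re = (![1, 0, 0, 0] : Fin 4 → ℝ) k := by
  fin_cases k <;> rfl

@[simp] lemma basisQ_imI (k : Fin 4) : (basisQ k).imI = (![0, 1, 0, 0] : Fin 4 → ℝ) k := by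
  fin_cases k <;> rfl

@[simp] lemma basisQ_imJ (k : Fin 4) : (basisQ k).imJ = (![0, 0, 1, 0] : Fin 4 → ℝ) k := by
  fin_cases k <;> rfl

@[simp] lemma basisQ_imK (k : Fin 4) : (basisQ k).imK = (![0, 0, 0, 1] : Fin 4 → ℝ) k := by
  fin_cases k <;> rfl

@[simp] lemma basisIm_re (k : Fin 3) : (basisIm k).re = (![0, 0, 0] : Fin 3 → ℝ) k := by
  fin_cases k <;> rfl

@[simp] lemma basisIm_imI (k : Fin 3) : (basisIm k).imI = (![1, 0, 0] : Fin 3 → ℝ) k := by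
  fin_cases k <;> rfl

@[simp] lemma basisIm_imJ (k : Fin 3) : (basisIm k).imJ = (![0, 1, 0] : Fin 3 → ℝ) k := by
  fin_cases k <;> rfl

@[simp] lemma basisIm_imK (k : Fin 3) : (basisIm k).imK = (![0, 0, 1] : Fin 3 → ℝ) k := by
  fin_cases k <;> rfl

lemma sum_coordQ_basisQ (a : ℍ[ℝ]) : ∑ k, coordQ (basisQ k) a • basisQ k = a := by
  rw [Fin.sum_univ_four]
  ext <;> simp [coordQ_eq]

lemma sum_coordQ_basisIm (a : ℍ[ℝ]) : ∑ k, coordQ (basisIm k) a • basisIm k = imQ a := by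
  rw [Fin.sum_univ_three]
  ext <;> simp [coordQ_eq, imQ_apply] <;> ring

lemma coordQ_basisQ (i j : Fin 4) : coordQ (basisQ i) (basisQ j) = if i = j then 1 else 0 := by
  fin_cases i <;> fin_cases j <;> simp [coordQ_eq]

lemma coordQ_basisIm (i j : Fin 3) : coordQ (basisIm i) (basisIm j) = if i = j then 1 else 0 := by
  fin_cases i <;> fin_cases j <;> simp [coordQ_eq]

lemma coordQ_basisIm_coe (i : Fin 3) (c : ℝ) : coordQ (basisIm i) (c : ℍ[ℝ]) = 0 := by
  fin_cases i <;> simp [coordQ_eq]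

/-- The splitting of `ℝ^{3m+4}` into `ℍ` and `m` copies of `Im ℍ`. -/
def idx (m : ℕ) : Fin (3 * m + 4) ≃ Fin 4 ⊕ (Fin m × Fin 3) :=
  Fintype.equivOfCardEq (by simp; ring)

/-- The base coordinate. -/
def baseL (m : ℕ) : (Fin (3 * m + 4) → ℝ) →L[ℝ] ℍ[ℝ] :=
  ∑ k : Fin 4, (ContinuousLinearMap.proj (R := ℝ) (φ := fun _ => ℝ) ((idx m).symm (.inl k))).smulRight (basisQ k)

/-- The fibre coordinates. -/
def fibL (m : ℕ) (t : ℝ) (s : Fin m) : (Fin (3 * m + 4) → ℝ) →L[ℝ] ℍ[ℝ] :=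
  ∑ b : Fin 3, (t⁻¹ • ContinuousLinearMap.proj (R := ℝ) (φ := fun _ => ℝ)
    ((idx m).symm (.inr (s, b)))).smulRight (basisIm b)

section Coord

variable {m : ℕ} {t : ℝ}

lemma baseL_apply (x : Fin (3 * m + 4) → ℝ) :
    baseL m x = ∑ k, x ((idx m).symm (.inl k)) • basisQ k := by
  simp [baseL]

lemma fibL_apply (x : Fin (3 * m + 4) → ℝ) (s : Fin m) :
    fibL m t s x = ∑ b, (t⁻¹ * x ((idx m).symm (.inr (s, b)))) • basisIm b := by
  simp [fibL]

lemma coordQ_baseL (x : Fin (3 * m + 4) → ℝ) (k : Fin 4) :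
    coordQ (basisQ k) (baseL m x) = x ((idx m).symm (.inl k)) := by
  simp [baseL_apply, coordQ_basisQ]

lemma coordQ_fibL (x : Fin (3 * m + 4) → ℝ) (s : Fin m) (b : Fin 3) :
    coordQ (basisIm b) (fibL m t s x) = t⁻¹ * x ((idx m).symm (.inr (s, b))) := by
  simp [fibL_apply, coordQ_basisIm]

lemma re_fibL (x : Fin (3 * m + 4) → ℝ) (s : Fin m) : (fibL m t s x).re = 0 := by
  rw [fibL_apply, Fin.sum_univ_three]
  simp

end Coord

/-! ### Local parametrizations of `Sp(2,m)` -/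

/-- The central projection from `Im ℍ` to `S³`. -/
def rz (z : ℍ[ℝ]) : ℍ[ℝ] := rho z • (1 + z)

lemma norm_rz {z : ℍ[ℝ]} (hz : z.re = 0) : ‖rz z‖ = 1 := by
  apply norm_eq_one_of_star_mul
  have h : star (1 + z) * (1 + z) = ((1 + ‖z‖ ^ 2 : ℝ) : ℍ[ℝ]) := by
    have h1 : star z + z = 0 := by
      ext <;> simp [hz]
    calc star (1 + z) * (1 + z) = 1 + (star z + z) + star z * z := by
          rw [star_add, star_one]; noncomm_ring
      _ = _ := by rw [h1, star_mul_self_eq]; simp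
  rw [rz, Quaternion.star_smul, smul_mul_smul_comm, h, ← Quaternion.coe_smul, smul_eq_mul, ← sq,
    rho_sq, Quaternion.coe_one]

/-- Central projection reaches only the open hemisphere of positive real part, which is the reason
for the positivity condition in `InvGood`. -/
lemma rz_of_unit {r : ℍ[ℝ]} (hr : ‖r‖ = 1) (h0 : 0 < r.re) : rz ((r.re)⁻¹ • imQ r) = r := by
  have h1 : 1 + (r.re)⁻¹ • imQ r = (r.re)⁻¹ • r := by
    ext <;> simp [imQ_apply, h0.ne']
    all_goals ring
  have h2 : 1 + ‖(r.re)⁻¹ • imQ r‖ ^ 2 = ((r.re)⁻¹) ^ 2 := by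
    have h3 : ‖imQ r‖ ^ 2 = 1 - r.re ^ 2 := by
      have e1 : ∀ a : ℍ[ℝ], ‖a‖ ^ 2 = a.re ^ 2 + a.imI ^ 2 + a.imJ ^ 2 + a.imK ^ 2 := fun a => by
        rw [sq, ← Quaternion.normSq_eq_norm_mul_self, Quaternion.normSq_def']
      have e2 := e1 r
      rw [hr] at e2
      rw [e1]
      simp [imQ_apply]
      linarith
    rw [norm_smul, mul_pow, h3, Real.norm_eq_abs, sq_abs]
    field_simp
    ring
  rw [rz, h1, rho, h2, Real.sqrt_sq (by positivity), inv_inv, smul_smul, mul_inv_cancel₀ h0.ne',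
    one_smul]

/-- The inverse of a quaternion, as a smooth function. -/
def qinv (a : ℍ[ℝ]) : ℍ[ℝ] := (‖a‖ ^ 2)⁻¹ • star a

lemma mul_qinv {a : ℍ[ℝ]} (h : a ≠ 0) : a * qinv a = 1 := by
  have h0 : ‖a‖ ^ 2 ≠ 0 := by simpa using h
  rw [qinv, mul_smul_comm, mul_star_self_eq, ← Quaternion.coe_smul, smul_eq_mul,
    inv_mul_cancel₀ h0, Quaternion.coe_one]

lemma qinv_mul {a : ℍ[ℝ]} (h : a ≠ 0) : qinv a * a = 1 := by
  have h0 : ‖a‖ ^ 2 ≠ 0 := by simpa using h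
  rw [qinv, smul_mul_assoc, star_mul_self_eq, ← Quaternion.coe_smul, smul_eq_mul,
    inv_mul_cancel₀ h0, Quaternion.coe_one]

lemma contDiffAt_qinv {E : Type*} [NormedAddCommGroup E] [NormedSpace ℝ E] {n : WithTop ℕ∞}
    {f : E → ℍ[ℝ]} {x : E} (hf : ContDiffAt ℝ n f x) (h : f x ≠ 0) :
    ContDiffAt ℝ n (fun x => qinv (f x)) x := by
  have h1 : ContDiffAt ℝ n (fun x => (‖f x‖ ^ 2)⁻¹) x := (hf.norm_sq ℝ).inv (by simpa using h)
  unfold qinv; fun_prop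

/-- The local parametrization of `Sp(2,m)` around `p`. -/
def param (m : ℕ) (t : ℝ) (p : Fin m → ℍ[ℝ] × ℍ[ℝ]) (x : Fin (3 * m + 4) → ℝ) :
    Fin m → ℍ[ℝ] × ℍ[ℝ] :=
  wilhelmAction m 1 (fun s => star (rz (fibL m t s x))) (sect m (p, baseL m x))

/-- The base coordinate of a point near `p`. -/
def baseInv (p u : ℕ → ℍ[ℝ] × ℍ[ℝ]) : ℍ[ℝ] := ip (p 1) (u 0) * qinv (ip (p 0) (u 0))

/-- The fibre coordinates, as unit quaternions, of a point near `p` over the point with base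
coordinate `y`. -/
def fibInv (p : ℕ → ℍ[ℝ] × ℍ[ℝ]) (y : ℍ[ℝ]) (u : ℕ → ℍ[ℝ] × ℍ[ℝ]) : ℕ → ℍ[ℝ]
  | 0 => ip (sec p y 0) (u 0)
  | n + 1 => ip (sec p y (n + 1)) (lm (if n = 0 then 1 else fibInv p y u n) (u (n + 1)))

/-- The inverse of the local parametrization. -/
def paramInv (m : ℕ) (t : ℝ) (p u : Fin m → ℍ[ℝ] × ℍ[ℝ]) (i : Fin (3 * m + 4)) : ℝ :=
  match idx m i with
  | .inl k => coordQ (basisQ k) (baseInv (ent p) (ent u))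
  | .inr (s, b) => t * ((fibInv (ent p) (baseInv (ent p) (ent u)) (ent u) s).re⁻¹ *
      coordQ (basisIm b) (fibInv (ent p) (baseInv (ent p) (ent u)) (ent u) s))

section Param

variable {m : ℕ} {t : ℝ} {p : Fin m → ℍ[ℝ] × ℍ[ℝ]}

/-- The right factors of the parametrization. -/
def rfac (m : ℕ) (t : ℝ) (x : Fin (3 * m + 4) → ℝ) (n : ℕ) : ℍ[ℝ] :=
  if h : n < m then rz (fibL m t ⟨n, h⟩ x) else 0

lemma ent_param (x : Fin (3 * m + 4) → ℝ) {n : ℕ} (hn : n < m) :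
    ent (param m t p x) n =
      rm (lm (lft 1 (rfac m t x) n) (sec (ent p) (baseL m x) n)) (rfac m t x n) := by
  rw [param, ent_wilhelmAction _ _ _ hn, ent_sect hn]
  have h : ∀ k, star (ent (fun s => star (rz (fibL m t s x))) k) = rfac m t x k := by
    intro k
    unfold ent rfac
    split_ifs <;> simp
  simp only [h]

lemma norm_rfac (x : Fin (3 * m + 4) → ℝ) {n : ℕ} (hn : n < m) : ‖rfac m t x n‖ = 1 := by
  rw [rfac, dif_pos hn]
  exact norm_rz (re_fibL _ _)

lemma contDiffAt_rfac (x : Fin (3 * m + 4) → ℝ) (n : ℕ) :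
    ContDiffAt ℝ ω (fun x => rfac m t x n) x := by
  unfold rfac rz
  split_ifs <;> fun_prop

lemma contDiffAt_param {x : Fin (3 * m + 4) → ℝ} (hx : Good m (ent p) (baseL m x)) :
    ContDiffAt ℝ ω (param m t p) x := by
  refine contDiffAt_pi.2 fun i => ?_
  have h1 : ∀ x, param m t p x i =
      rm (lm (lft 1 (rfac m t x) i) (sec (ent p) (baseL m x) i)) (rfac m t x i) := fun x => by
    rw [← ent_param x i.2, ent_val]
  simp only [h1]
  have h2 : ContDiffAt ℝ ω (fun x => sec (ent p) (baseL m x) i) x :=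
    contDiffAt_sec (m := m) (f := fun _ => ent p) (fun j => contDiffAt_const) (by fun_prop) hx i.2
  have h3 := contDiffAt_rfac (m := m) (t := t) x i
  have h4 : ContDiffAt ℝ ω (fun x => lft 1 (rfac m t x) i) x := by
    cases (i : ℕ) with
    | zero => exact contDiffAt_const
    | succ n =>
      simp only [lft]
      split_ifs
      · exact contDiffAt_const
      · exact contDiffAt_starQ (contDiffAt_rfac x n)
  fun_prop

lemma param_mem (hm : 1 < m) (hp : p ∈ Sp2m m) {x : Fin (3 * m + 4) → ℝ}
    (hx : Good m (ent p) (baseL m x)) : param m t p x ∈ Sp2m m := by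
  refine wilhelmAction_mem (mem_S3_iff.2 norm_one) (fun s => mem_S3_iff.2 ?_) ?_
  · rw [norm_star, norm_rz (re_fibL _ _)]
  · rw [mem_Sp2m_iff_adm]
    have h := sec_adm hm (mem_Sp2m_iff_adm.1 hp) hx
    exact ⟨fun k hk => by rw [ent_sect hk]; exact h.1 k hk,
      fun k hk => by rw [ent_sect hk, ent_sect (by omega)]; exact h.2 k hk⟩

/-- The fibre coordinate multiplies both components of column 0 from the right, so it drops out of
their quotient, the affine coordinate of `ℍP¹`. -/
lemma baseInv_param (hm : 1 < m) (hp : Adm m (ent p)) (x : Fin (3 * m + 4) → ℝ) :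
    baseInv (ent p) (ent (param m t p x)) = baseL m x := by
  have h00 := hp.1 0 (by omega)
  have h11 := hp.1 1 hm
  have h01 : ip (ent p 0) (ent p 1) = 0 := by simpa [pole] using hp.2 0 hm
  have h10 : ip (ent p 1) (ent p 0) = 0 := by rw [← star_ip, h01, star_zero]
  have hr := norm_rfac (t := t) x (show 0 < m by omega)
  have hne : rho (baseL m x) • rfac m t x 0 ≠ 0 := by
    refine smul_ne_zero (rho_pos _).ne' fun h => ?_
    rw [h, norm_zero] at hr
    exact zero_ne_one hr
  rw [baseInv, ent_param x (by omega), lft, lm_one, sec_zero, smul_rm, ip_smul, ip_smul, ip_rm,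
    ip_rm, ip_add, ip_add, ip_rm, ip_rm, h00, h11, h01, h10, zero_add, one_mul, zero_mul, add_zero,
    one_mul, ← mul_smul_comm, mul_assoc, mul_qinv hne, mul_one]

/-- The left factor on a later column is the conjugate of the preceding fibre coordinate, so the
fibre coordinates are recovered one after another. -/
lemma fibInv_param (hm : 1 < m) (hp : Adm m (ent p)) {x : Fin (3 * m + 4) → ℝ}
    (hx : Good m (ent p) (baseL m x)) {n : ℕ} (hn : n < m) :
    fibInv (ent p) (baseL m x) (ent (param m t p x)) n = rfac m t x n := by
  have h := (sec_adm hm hp hx).1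
  induction n with
  | zero => rw [fibInv, ent_param x hn, lft, lm_one, ip_rm, h 0 hn, one_mul]
  | succ n ih =>
    rw [fibInv, ent_param x hn, ih (by omega), lft]
    split_ifs with h0
    · rw [lm_one, lm_one, ip_rm, h _ hn, one_mul]
    · rw [lm_rm, lm_lm_star (norm_rfac x (by omega)), ip_rm, h _ hn, one_mul]

lemma paramInv_param (hm : 1 < m) (ht : t ≠ 0) (hp : Adm m (ent p)) {x : Fin (3 * m + 4) → ℝ}
    (hx : Good m (ent p) (baseL m x)) : paramInv m t p (param m t p x) = x := by
  funext i
  unfold paramInv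
  rw [baseInv_param hm hp]
  split
  · next k hk => rw [coordQ_baseL, ← hk, Equiv.symm_apply_apply]
  · next s b hk =>
    rw [fibInv_param hm hp hx s.2, rfac, dif_pos s.2, rz]
    have h1 : (rho (fibL m t s x) • (1 + fibL m t s x)).re = rho (fibL m t s x) := by
      simp [re_fibL]
    have h2 : coordQ (basisIm b) (1 + fibL m t s x) = t⁻¹ * x i := by
      rw [map_add, coordQ_fibL, ← Quaternion.coe_one, coordQ_basisIm_coe, zero_add, ← hk,
        Equiv.symm_apply_apply]
    rw [h1, map_smul, h2, smul_eq_mul, inv_mul_cancel_left₀ (rho_pos _).ne',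
      mul_inv_cancel_left₀ ht]

/-- The points to which the inverse parametrization applies. -/
def InvGood (m : ℕ) (p u : Fin m → ℍ[ℝ] × ℍ[ℝ]) : Prop :=
  ip (ent p 0) (ent u 0) ≠ 0 ∧ Good m (ent p) (baseInv (ent p) (ent u)) ∧
    ∀ n < m, 0 < (fibInv (ent p) (baseInv (ent p) (ent u)) (ent u) n).re

lemma fibInv_spec (hm : 1 < m) (hp : Adm m (ent p)) {u : Fin m → ℍ[ℝ] × ℍ[ℝ]}
    (hu : Adm m (ent u)) (h0 : ip (ent p 0) (ent u 0) ≠ 0)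
    (hg : Good m (ent p) (baseInv (ent p) (ent u))) {n : ℕ} (hn : n < m) :
    ‖fibInv (ent p) (baseInv (ent p) (ent u)) (ent u) n‖ = 1 ∧
    ent u n = rm (lm (lft 1 (fibInv (ent p) (baseInv (ent p) (ent u)) (ent u)) n)
      (sec (ent p) (baseInv (ent p) (ent u)) n))
      (fibInv (ent p) (baseInv (ent p) (ent u)) (ent u) n) := by
  set y := baseInv (ent p) (ent u) with hy
  set r := fibInv (ent p) y (ent u) with hr
  have hσ := sec_adm hm hp hg
  have key : ∀ (a b x : ℍ[ℝ] × ℍ[ℝ]), ip a a = 1 → ip b b = 1 → ip a b = 0 → ip x x = 1 →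
      ip a x = 0 → ‖ip b x‖ = 1 ∧ x = rm b (ip b x) := by
    intro a b x ha hb hab hx hax
    have h1 := expand_of_orthonormal ha hb hab x
    rw [hax, rm_zero, zero_add] at h1
    refine ⟨norm_eq_one_of_star_mul ?_, h1.symm⟩
    rw [← ip_rm_left, h1, hx]
  -- Column 0 has no predecessor: it is expanded in the basis `p 0`, `p 1`, and the choice of `y`
  -- makes the ratio of coefficients agree with that of the section. Each later column, freed from
  -- its left factor, is orthogonal to the same unit column as the section, so `key` gives the right
  -- factor.
  have hz : ‖r 0‖ = 1 ∧ ent u 0 = rm (sec (ent p) y 0) (r 0) := by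
    have h11 := hp.1 1 hm
    have h01 : ip (ent p 0) (ent p 1) = 0 := by simpa [pole] using hp.2 0 hm
    have e1 := expand_of_orthonormal (hp.1 0 (by omega)) h11 h01 (ent u 0)
    have e2 : ip (ent p 1) (ent u 0) = y * ip (ent p 0) (ent u 0) := by
      rw [hy, baseInv, mul_assoc, qinv_mul h0, mul_one]
    have e3 : rm (sec (ent p) y 0) ((rho y)⁻¹ • ip (ent p 0) (ent u 0)) = ent u 0 := by
      rw [sec_zero, smul_rm, rm_smul, smul_smul, mul_inv_cancel₀ (rho_pos y).ne', one_smul, add_rm,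
        rm_rm, ← e2, e1]
    have e4 : r 0 = (rho y)⁻¹ • ip (ent p 0) (ent u 0) := by
      change ip (sec (ent p) y 0) (ent u 0) = _
      nth_rewrite 1 [← e3]
      rw [ip_rm, hσ.1 0 (by omega), one_mul]
    rw [← e4] at e3
    refine ⟨norm_eq_one_of_star_mul ?_, e3.symm⟩
    have := hu.1 0 (by omega)
    rwa [← e3, ip_rm, ip_rm_left, hσ.1 0 (by omega), mul_one] at this
  induction n with
  | zero => rw [lft, lm_one]; exact hz
  | succ n ih =>
    obtain ⟨ih1, ih2⟩ := ih (by omega)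
    by_cases h : n = 0
    · subst h
      have h1 := hu.2 0 hn
      rw [pole, if_pos rfl, hz.2, ip_rm_left, zero_add] at h1
      have h2 : ip (sec (ent p) y 0) (ent u 1) = 0 := by
        refine (mul_eq_zero.1 h1).resolve_left fun h3 => ?_
        have := hz.1
        rw [← norm_star, h3, norm_zero] at this
        exact zero_ne_one this
      have h3 : ip (sec (ent p) y 0) (sec (ent p) y 1) = 0 := by simpa [pole] using hσ.2 0 hm
      have h4 : r 1 = ip (sec (ent p) y 1) (ent u 1) := by simp [hr, fibInv]
      have := key _ _ _ (hσ.1 0 (by omega)) (hσ.1 1 hm) h3 (hu.1 1 hm) h2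
      rw [← h4] at this
      simpa [lft] using this
    · have h1 := hu.2 n hn
      rw [pole, if_neg h, ih2, cj_rm, cj_lm, lm_rm, ip_rm_left, ip_lm_left, star_star,
        star_star] at h1
      have hlft : lft 1 r n ≠ 0 := by
        intro h3
        have h4 := hu.1 n (by omega)
        rw [ih2, h3, lm_zero_left, zero_rm, ip_zero] at h4
        exact zero_ne_one h4
      have h2 : ip (cj (sec (ent p) y n)) (lm (r n) (ent u (n + 1))) = 0 :=
        (mul_eq_zero.1 h1).resolve_left hlft
      have h3 : ip (cj (sec (ent p) y n)) (sec (ent p) y (n + 1)) = 0 := by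
        simpa [pole, h] using hσ.2 n hn
      have h4 : r (n + 1) = ip (sec (ent p) y (n + 1)) (lm (r n) (ent u (n + 1))) := by
        simp [hr, fibInv, h]
      have := key _ _ _ (ip_cj_self (hσ.1 n (by omega))) (hσ.1 (n + 1) hn) h3
        (by rw [ip_lm_lm ih1]; exact hu.1 _ hn) h2
      rw [← h4] at this
      refine ⟨this.1, ?_⟩
      rw [lft, if_neg h, ← lm_rm, ← this.2, lm_star_lm ih1]

lemma param_paramInv (hm : 1 < m) (ht : t ≠ 0) (hp : Adm m (ent p)) {u : Fin m → ℍ[ℝ] × ℍ[ℝ]}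
    (hu : Adm m (ent u)) (hg : InvGood m p u) : param m t p (paramInv m t p u) = u := by
  obtain ⟨h0, h1, h2⟩ := hg
  have hb : baseL m (paramInv m t p u) = baseInv (ent p) (ent u) := by
    rw [baseL_apply, ← sum_coordQ_basisQ (baseInv (ent p) (ent u))]
    refine Finset.sum_congr rfl fun k _ => ?_
    simp only [paramInv, Equiv.apply_symm_apply]
  have hf : ∀ n < m, rfac m t (paramInv m t p u) n =
      fibInv (ent p) (baseInv (ent p) (ent u)) (ent u) n := by
    intro n hn
    have hs := fibInv_spec hm hp hu h0 h1 hn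
    rw [rfac, dif_pos hn, ← rz_of_unit hs.1 (h2 n hn)]
    congr 1
    rw [fibL_apply, ← sum_coordQ_basisIm, Finset.smul_sum]
    refine Finset.sum_congr rfl fun b _ => ?_
    simp only [paramInv, Equiv.apply_symm_apply]
    rw [inv_mul_cancel_left₀ ht, smul_smul]
  funext i
  rw [← ent_val u i, ← ent_val (param m t p _) i, ent_param _ i.2, hb, hf i i.2,
    (fibInv_spec hm hp hu h0 h1 i.2).2]
  congr 2
  rcases hi : (i : ℕ) with _ | n
  · rfl
  · rw [lft, lft, hf n (by omega)]

lemma contDiffAt_baseInv {u : Fin m → ℍ[ℝ] × ℍ[ℝ]} (h0 : ip (ent p 0) (ent u 0) ≠ 0) :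
    ContDiffAt ℝ ω (fun u : Fin m → ℍ[ℝ] × ℍ[ℝ] => baseInv (ent p) (ent u)) u := by
  have h1 : ContDiffAt ℝ ω (fun u : Fin m → ℍ[ℝ] × ℍ[ℝ] => qinv (ip (ent p 0) (ent u 0))) u :=
    contDiffAt_qinv (by fun_prop) h0
  unfold baseInv; fun_prop

lemma contDiffAt_fibInv {u : Fin m → ℍ[ℝ] × ℍ[ℝ]} (h0 : ip (ent p 0) (ent u 0) ≠ 0)
    (hg : Good m (ent p) (baseInv (ent p) (ent u))) {n : ℕ} (hn : n < m) :
    ContDiffAt ℝ ω (fun u : Fin m → ℍ[ℝ] × ℍ[ℝ] =>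
      fibInv (ent p) (baseInv (ent p) (ent u)) (ent u) n) u := by
  have hs : ∀ n < m, ContDiffAt ℝ ω (fun u : Fin m → ℍ[ℝ] × ℍ[ℝ] =>
      sec (ent p) (baseInv (ent p) (ent u)) n) u := fun n hn =>
    contDiffAt_sec (m := m) (f := fun _ : Fin m → ℍ[ℝ] × ℍ[ℝ] => ent p)
      (fun j => contDiffAt_const) (contDiffAt_baseInv h0) hg hn
  induction n with
  | zero =>
    have h1 := hs 0 hn
    simp only [fibInv]; fun_prop
  | succ n ih =>
    have h1 := hs (n + 1) hn
    have h2 := ih (by omega)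
    simp only [fibInv]
    split_ifs <;> fun_prop

lemma contDiffAt_paramInv {u : Fin m → ℍ[ℝ] × ℍ[ℝ]} (hg : InvGood m p u) :
    ContDiffAt ℝ ω (paramInv m t p) u := by
  obtain ⟨h0, h1, h2⟩ := hg
  refine contDiffAt_pi.2 fun i => ?_
  unfold paramInv
  rcases idx m i with k | ⟨s, b⟩
  · exact (coordQ (basisQ k)).contDiff.contDiffAt.comp u (contDiffAt_baseInv h0)
  · have h3 := contDiffAt_fibInv h0 h1 s.2
    have h4 := (contDiffAt_reQ h3).inv (h2 s s.2).ne'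
    exact contDiffAt_const.mul (h4.mul ((coordQ (basisIm b)).contDiff.contDiffAt.comp u h3))

lemma param_zero (hp : Adm m (ent p)) : param m t p 0 = p := by
  funext i
  rw [← ent_val (param m t p 0) i, ent_param _ i.2, map_zero, sec_at_zero hp i.2, ent_val]
  have h1 : ∀ n < m, rfac m t 0 n = 1 := fun n hn => by
    rw [rfac, dif_pos hn, map_zero, rz]; simp
  have h2 : lft 1 (rfac m t 0) i = 1 := by
    rcases hi : (i : ℕ) with _ | n
    · rfl
    · rw [lft, h1 n (by omega)]; simp
  rw [h1 i i.2, h2, lm_one, rm_one]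

lemma eventually_invGood (hm : 1 < m) (hp : Adm m (ent p)) :
    ∀ᶠ u in nhds p, InvGood m p u := by
  have hb : baseInv (ent p) (ent p) = 0 := by
    have := baseInv_param (t := 1) hm hp 0
    rwa [param_zero hp, map_zero] at this
  have h0 : ip (ent p 0) (ent p 0) ≠ 0 := by rw [hp.1 0 (by omega)]; exact one_ne_zero
  have hg : Good m (ent p) (baseInv (ent p) (ent p)) := by rw [hb]; exact good_zero hp
  have hf : ∀ n < m, fibInv (ent p) (baseInv (ent p) (ent p)) (ent p) n = 1 := fun n hn => by
    have := fibInv_param (t := 1) (x := 0) hm hp (by rw [map_zero]; exact good_zero hp) hn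
    rw [param_zero hp, map_zero, rfac, dif_pos hn, map_zero, rz] at this
    rw [hb, this]; simp
  have e1 : ∀ᶠ u : Fin m → ℍ[ℝ] × ℍ[ℝ] in nhds p, ip (ent p 0) (ent u 0) ≠ 0 := by
    have : ContDiffAt ℝ ω (fun u : Fin m → ℍ[ℝ] × ℍ[ℝ] => ip (ent p 0) (ent u 0)) p := by fun_prop
    exact this.continuousAt.eventually_ne h0
  have e2 : ∀ᶠ u : Fin m → ℍ[ℝ] × ℍ[ℝ] in nhds p, Good m (ent p) (baseInv (ent p) (ent u)) :=
    eventually_good (f := fun _ : Fin m → ℍ[ℝ] × ℍ[ℝ] => ent p) (fun j => contDiffAt_const)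
      (contDiffAt_baseInv h0) hg
  have e3 : ∀ n ∈ Finset.range m, ∀ᶠ u : Fin m → ℍ[ℝ] × ℍ[ℝ] in nhds p,
      0 < (fibInv (ent p) (baseInv (ent p) (ent u)) (ent u) n).re := fun n hn => by
    have hn := Finset.mem_range.1 hn
    refine (contDiffAt_reQ (contDiffAt_fibInv h0 hg hn)).continuousAt.eventually_const_lt ?_
    change 0 < (fibInv (ent p) (baseInv (ent p) (ent p)) (ent p) n).re
    rw [hf n hn]; simp
  filter_upwards [e1, e2, (Finset.eventually_all _).2 e3] with u h1 h2 h3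
  exact ⟨h1, h2, fun n hn => h3 n (Finset.mem_range.2 hn)⟩

/-- Around each of its points `Sp(2,m)` is parametrized by `param`. -/
theorem exists_isLocalParam (hm : 1 < m) (ht : t ≠ 0) (hp : p ∈ Sp2m m) :
    ∃ U : Set (Fin (3 * m + 4) → ℝ), IsLocalParam (Sp2m m) U (param m t p) ∧ 0 ∈ U := by
  have hpa := mem_Sp2m_iff_adm.1 hp
  have hg0 : ∀ᶠ x in nhds (0 : Fin (3 * m + 4) → ℝ), Good m (ent p) (baseL m x) :=
    eventually_good (f := fun _ => ent p) (fun j => contDiffAt_const) (by fun_prop)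
      (by rw [map_zero]; exact good_zero hpa)
  obtain ⟨U', hU', hU'o, hU'0⟩ := mem_nhds_iff.1 hg0
  obtain ⟨W', hW', hW'o, hWp⟩ := mem_nhds_iff.1 (eventually_invGood hm hpa)
  have hφ : ∀ x ∈ U', ContDiffAt ℝ ω (param m t p) x := fun x hx => contDiffAt_param (hU' hx)
  have hψ : ∀ u ∈ W', ContDiffAt ℝ ω (paramInv m t p) u := fun u hu => contDiffAt_paramInv (hW' hu)
  have hφc : ContinuousOn (param m t p) U' := fun x hx => (hφ x hx).continuousAt.continuousWithinAt
  have hψc : ContinuousOn (paramInv m t p) W' := fun u hu =>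
    (hψ u hu).continuousAt.continuousWithinAt
  -- Each domain is cut down to the points that the map sends into the other one, so the two maps
  -- become mutually inverse between `U` and the part of `Sp2m m` in `W`.
  have hUo := hφc.isOpen_inter_preimage hU'o hW'o
  have hWo := hψc.isOpen_inter_preimage hW'o hU'o
  have hleft : ∀ x ∈ U', paramInv m t p (param m t p x) = x := fun x hx =>
    paramInv_param hm ht hpa (hU' hx)
  refine ⟨U' ∩ param m t p ⁻¹' W', ⟨hUo, fun x hx => ?_, fun x hx => ?_, ⟨W' ∩ paramInv m t p ⁻¹' U',
    hWo, ?_⟩, paramInv m t p, ?_, fun x hx => hleft x hx.1⟩, hU'0, ?_⟩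
  · exact ((hφ x hx.1).of_le le_top).contDiffWithinAt
  · have h1 := ((hφ x hx.1).differentiableAt (by simp)).hasFDerivAt
    have h2 := ((hψ _ hx.2).differentiableAt (by simp)).hasFDerivAt
    have h3 : HasFDerivAt (paramInv m t p ∘ param m t p) (ContinuousLinearMap.id ℝ _) x :=
      (hasFDerivAt_id x).congr_of_eventuallyEq
        (by filter_upwards [hU'o.mem_nhds hx.1] with z hz using hleft z hz)
    have h4 := (h2.comp x h1).unique h3
    intro v w hvw
    have h5 : ∀ v, fderiv ℝ (paramInv m t p) (param m t p x) (fderiv ℝ (param m t p) x v) = v :=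
      fun v => congrArg (fun L => L v) h4
    rw [← h5 v, ← h5 w, hvw]
  · ext u
    constructor
    · rintro ⟨x, ⟨hx1, hx2⟩, rfl⟩
      refine ⟨param_mem hm hp (hU' hx1), hx2, ?_⟩
      rw [Set.mem_preimage, hleft x hx1]; exact hx1
    · rintro ⟨hu, hu1, hu2⟩
      have := param_paramInv hm ht hpa (mem_Sp2m_iff_adm.1 hu) (hW' hu1)
      refine ⟨paramInv m t p u, ⟨hu2, ?_⟩, this⟩
      rw [Set.mem_preimage, this]; exact hu1
  · rintro u ⟨x, hx, rfl⟩
    exact (hψ _ hx.2).continuousAt.continuousWithinAt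
  · rw [Set.mem_preimage, param_zero hpa]; exact hWp

/-- Tangent vectors of `Sp(2,m)` come from the parametrization. -/
lemma exists_fderiv_param_eq (hm : 1 < m) (ht : t ≠ 0) (hp : p ∈ Sp2m m)
    {v : Fin m → ℍ[ℝ] × ℍ[ℝ]} (hv : v ∈ tangentVectors (Sp2m m) p) :
    ∃ ξ, fderiv ℝ (param m t p) 0 ξ = v := by
  have hpa := mem_Sp2m_iff_adm.1 hp
  obtain ⟨ε, c, hε, -, hcS, hc0, hcv⟩ := hv
  have hinv := eventually_invGood hm hpa
  have hψ : HasFDerivAt (paramInv m t p) (fderiv ℝ (paramInv m t p) (c 0)) (c 0) := by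
    rw [hc0]
    exact ((contDiffAt_paramInv hinv.self_of_nhds).differentiableAt (by simp)).hasFDerivAt
  have hφ : HasFDerivAt (param m t p) (fderiv ℝ (param m t p) 0) (paramInv m t p (c 0)) := by
    have : paramInv m t p (c 0) = 0 := by
      have := paramInv_param (x := 0) hm ht hpa (by rw [map_zero]; exact good_zero hpa)
      rw [hc0]; rwa [param_zero hpa] at this
    rw [this]
    refine ((contDiffAt_param ?_).differentiableAt (by simp)).hasFDerivAt
    rw [map_zero]; exact good_zero hpa
  -- Near time 0 the curve coincides with its image under `param ∘ paramInv`, so its velocity lies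
  -- in the range of the derivative of `param`.
  have h1 := hφ.comp_hasDerivAt 0 (hψ.comp_hasDerivAt 0 hcv)
  refine ⟨_, (h1.congr_of_eventuallyEq ?_).unique hcv⟩
  have h2 : ∀ᶠ s in nhds (0 : ℝ), InvGood m p (c s) :=
    hcv.continuousAt.eventually (by rw [hc0]; exact hinv)
  filter_upwards [h2, Ioo_mem_nhds (neg_lt_zero.2 hε) hε] with s hs1 hs2
  exact (param_paramInv hm ht hpa (mem_Sp2m_iff_adm.1 (hcS s hs2)) hs1).symm

end Param

/-! ### The metric in the local parametrization -/

section Coefficients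

variable {m : ℕ} {t : ℝ} {p : Fin m → ℍ[ℝ] × ℍ[ℝ]}

lemma imQ_eq_sub_re (a : ℍ[ℝ]) : imQ a = a - (a.re : ℍ[ℝ]) := by
  rw [imQ_apply]
  ext <;> simp <;> ring

lemma sum_coordQ_mul {a : ℍ[ℝ]} (ha : a.re = 0) (b : ℍ[ℝ]) :
    (star a * b).re = ∑ k, coordQ (basisIm k) a * coordQ (basisIm k) b := by
  rw [Fin.sum_univ_three]
  simp [coordQ_eq, ha]

/-- The logarithmic derivative of the central projection. -/
lemma rz_deriv_mul_star {z : ℝ → ℍ[ℝ]} {z' : ℍ[ℝ]} (hz : HasDerivAt z z' 0)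
    (hre : ∀ s, (z s).re = 0) :
    ∃ r', HasDerivAt (fun s => rz (z s)) r' 0 ∧
      rz (z 0) * star r' + r' * star (rz (z 0)) = 0 ∧
      r' * star (rz (z 0)) = rho (z 0) ^ 2 • (imQ z' - imQ (z' * z 0)) := by
  have hρ : DifferentiableAt ℝ (fun s => rho (z s)) 0 := by
    have h1 : ContDiffAt ℝ ω (fun w : ℍ[ℝ] => rho w) (z 0) := by fun_prop
    exact (h1.differentiableAt (by simp)).comp (0 : ℝ) hz.differentiableAt
  set ρ' := deriv (fun s => rho (z s)) 0
  have h := hρ.hasDerivAt.fun_smul (hz.const_add 1)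
  have h2 := h.fun_mul (hasDerivAt_star h)
  have h3 : HasDerivAt (fun s => rz (z s) * star (rz (z s))) 0 0 := by
    refine (hasDerivAt_const (0 : ℝ) (1 : ℍ[ℝ])).congr_of_eventuallyEq (.of_forall fun s => ?_)
    exact mul_star_self_of_norm (norm_rz (hre s))
  have h4 := h2.unique h3
  refine ⟨_, h, by rw [add_comm]; exact h4, ?_⟩
  have h5 : ∀ a : ℍ[ℝ], a + star a = 0 → imQ a = a := fun a ha => imQ_of_re (by
    have := congrArg (fun q : ℍ[ℝ] => q.re) ha
    simp at this
    linarith)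
  have hs : star (z 0) = -z 0 := by ext <;> simp [hre]
  -- By `h4` the logarithmic derivative is imaginary, so it may be replaced by its imaginary part;
  -- the term with `ρ'` is real and drops out.
  rw [← h5 ((rho (z 0) • z' + ρ' • (1 + z 0)) * star (rz (z 0))) (by
    rw [star_mul, star_star]; exact h4)]
  have h6 : (rho (z 0) • z' + ρ' • (1 + z 0)) * star (rz (z 0)) =
      rho (z 0) ^ 2 • (z' - z' * z 0) + (ρ' * rho (z 0)) • ((1 + z 0) * star (1 + z 0)) := by
    rw [rz, Quaternion.star_smul, add_mul, smul_mul_smul_comm, smul_mul_smul_comm, ← sq, star_add,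
      star_one, hs, mul_add, mul_one, mul_neg, ← sub_eq_add_neg]
  rw [h6, map_add, mul_star_self_eq, ← Quaternion.coe_smul, imQ_coe, add_zero, map_smul, map_sub]

/-- The connection form in the local parametrization, up to conjugation by the fibre coordinate,
evaluated on the coordinate vector `v`. -/
def locForm (m : ℕ) (t : ℝ) (p : Fin m → ℍ[ℝ] × ℍ[ℝ]) (x v : Fin (3 * m + 4) → ℝ) (n : Fin m) :
    ℍ[ℝ] :=
  form m (p, baseL m x) (baseL m v) n +
    rho (fibL m t n x) ^ 2 • (fibL m t n v - imQ (fibL m t n v * fibL m t n x))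

lemma re_imQ (a : ℍ[ℝ]) : (imQ a).re = 0 := by simp [imQ_eq_sub_re]

lemma re_locForm (hm : 1 < m) (hp : Adm m (ent p)) {x : Fin (3 * m + 4) → ℝ}
    (hx : Good m (ent p) (baseL m x)) (v : Fin (3 * m + 4) → ℝ) (n : Fin m) :
    (locForm m t p x v n).re = 0 := by
  rw [locForm, Quaternion.re_add, re_form hm hp hx _ n.2, Quaternion.re_smul, Quaternion.re_sub,
    re_fibL, re_imQ]
  simp

lemma hasDerivAt_lft {r : ℝ → ℕ → ℍ[ℝ]} {r' : ℕ → ℍ[ℝ]} {s : ℝ} {n : ℕ} (a : ℍ[ℝ])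
    (h : ∀ k < n, HasDerivAt (fun s => r s k) (r' k) s) :
    HasDerivAt (fun s => lft a (r s) n) (lft 0 r' n) s := by
  cases n with
  | zero => exact hasDerivAt_const _ _
  | succ n =>
    simp only [lft]
    split_ifs
    · exact hasDerivAt_const _ _
    · exact hasDerivAt_star (h n (by omega))

/-- The velocity of the local parametrization: its connection form and its horizontal part. -/
lemma fderiv_param (hm : 1 < m) (hp : Adm m (ent p)) {x : Fin (3 * m + 4) → ℝ}
    (hx : Good m (ent p) (baseL m x)) (v : Fin (3 * m + 4) → ℝ) :
    (∀ n : Fin m, conn (ent (param m t p x)) (ent (fderiv ℝ (param m t p) x v)) n =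
      star (rfac m t x n) * locForm m t p x v n * rfac m t x n) ∧
    orth (ent (param m t p x) 0) (ent (fderiv ℝ (param m t p) x v) 0) =
      rm (lm 1 (rho (baseL m x) ^ 2 • rm (sec (ent p) (baseL m x) 1) (baseL m v)))
        (rfac m t x 0) := by
  have hline : HasDerivAt (fun s : ℝ => x + s • v) v 0 := by
    simpa using ((hasDerivAt_id (0 : ℝ)).smul_const v).const_add x
  have hφ : HasDerivAt (fun s : ℝ => param m t p (x + s • v)) (fderiv ℝ (param m t p) x v) 0 := by
    have h1 : HasFDerivAt (param m t p) (fderiv ℝ (param m t p) x) (x + (0 : ℝ) • v) := by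
      rw [zero_smul, add_zero]
      exact ((contDiffAt_param hx).differentiableAt (by simp)).hasFDerivAt
    exact h1.comp_hasDerivAt 0 hline
  have hr : ∀ n : ℕ, ∃ r', n < m → HasDerivAt (fun s : ℝ => rfac m t (x + s • v) n) r' 0 ∧
      rfac m t x n * star r' + r' * star (rfac m t x n) = 0 ∧
      ∀ h : n < m, r' * star (rfac m t x n) = rho (fibL m t ⟨n, h⟩ x) ^ 2 •
        (fibL m t ⟨n, h⟩ v - imQ (fibL m t ⟨n, h⟩ v * fibL m t ⟨n, h⟩ x)) := by
    intro n
    by_cases hn : n < m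
    · have hz : HasDerivAt (fun s : ℝ => fibL m t ⟨n, hn⟩ (x + s • v)) (fibL m t ⟨n, hn⟩ v) 0 :=
        (fibL m t ⟨n, hn⟩).hasFDerivAt.comp_hasDerivAt 0 hline
      obtain ⟨r', h1, h2, h3⟩ := rz_deriv_mul_star hz fun s => re_fibL _ _
      rw [zero_smul, add_zero, imQ_of_re (re_fibL _ _)] at h3
      rw [zero_smul, add_zero] at h2
      simp only [rfac, dif_pos hn]
      exact ⟨r', fun _ => ⟨h1, h2, fun _ => h3⟩⟩
    · exact ⟨0, fun h => absurd h hn⟩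
  choose r' hr using hr
  have hd : ∀ n < m, ent (fderiv ℝ (param m t p) x v) n =
      rm (lm (lft 0 r' n) (sec (ent p) (baseL m x) n)) (rfac m t x n) +
      rm (lm (lft 1 (rfac m t x) n) (ent (dsect m (p, baseL m x) (baseL m v)) n)) (rfac m t x n) +
      rm (lm (lft 1 (rfac m t x) n) (sec (ent p) (baseL m x) n)) (r' n) := by
    intro n hn
    have h1 : HasDerivAt (fun s : ℝ => ent (param m t p (x + s • v)) n)
        (ent (fderiv ℝ (param m t p) x v) n) 0 := by
      simp only [ent_of_lt _ hn]
      exact hasDerivAt_pi.1 hφ ⟨n, hn⟩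
    have h2 : HasDerivAt (fun s : ℝ => sec (ent p) (baseL m (x + s • v)) n)
        (ent (dsect m (p, baseL m x) (baseL m v)) n) 0 := by
      simpa using hasDerivAt_sec hx (baseL m v) hn
    have h3 := hasDerivAt_lft (r := fun s : ℝ => rfac m t (x + s • v)) (n := n) 1
      fun k hk => (hr k (by omega)).1
    have h4 := hasDerivAt_rm (hasDerivAt_lm h3 h2) (hr n hn).1
    simp only [ent_param _ hn] at h1
    refine h1.unique (h4.congr_deriv ?_)
    simp only [zero_smul, add_zero, add_rm]
  have hu : ∀ k < m, ip (sec (ent p) (baseL m x) k) (sec (ent p) (baseL m x) k) = 1 :=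
    (sec_adm hm hp hx).1
  constructor
  · intro n
    have hg := conn_gauge (u := sec (ent p) (baseL m x))
      (v := ent (dsect m (p, baseL m x) (baseL m v))) (r := rfac m t x) (r' := r') (p := 1)
      (n := n) (by simp) (fun k hk => hu k (by omega)) (fun k hk => norm_rfac x (by omega))
      (fun k hk => (hr k (by omega)).2.1)
    rw [(hr n n.2).2.2 n.2] at hg
    rw [locForm, form, conn_congr (u := ent (sect m (p, baseL m x))) (u' := sec (ent p) (baseL m x))
      (fun k hk => ent_sect (by omega)) (fun _ _ => rfl), ← hg]
    exact conn_congr (fun k hk => ent_param x (by omega)) (fun k hk => hd k (by omega))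
  · rw [ent_param x (by omega), hd 0 (by omega), ← orth_dsect hm hp hx]
    simp only [lft, lm_zero_left, zero_rm, zero_add]
    exact orth_gauge (by simp) (norm_rfac x (by omega)) (hu 0 (by omega))

/-- The horizontal part is `|dy|² / (1 + |y|²)²`, the round metric of curvature 4. Conjugation by
the fibre coordinate does not affect lengths, so only `locForm` remains of the connection form. -/
lemma metricFun_param (hm : 1 < m) (hp : Adm m (ent p)) {x : Fin (3 * m + 4) → ℝ}
    (hx : Good m (ent p) (baseL m x)) (v w : Fin (3 * m + 4) → ℝ) :
    metricFun m t (param m t p x) (fderiv ℝ (param m t p) x v) (fderiv ℝ (param m t p) x w) =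
      (rho (baseL m x) ^ 2) ^ 2 * coordQ (baseL m v) (baseL m w) +
        t ^ 2 * ∑ a : Fin m × Fin 3, coordQ (basisIm a.2) (locForm m t p x v a.1) *
          coordQ (basisIm a.2) (locForm m t p x w a.1) := by
  obtain ⟨hv1, hv2⟩ := fderiv_param (t := t) hm hp hx v
  obtain ⟨hw1, hw2⟩ := fderiv_param (t := t) hm hp hx w
  have hu1 := (sec_adm hm hp hx).1 1 hm
  unfold metricFun
  congr 1
  · rw [hv2, hw2, re_ip_gauge (by simp) (norm_rfac x (by omega)), ip_smul, ip_smul_left, ip_rm,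
      ip_rm_left, hu1, mul_one, Quaternion.re_smul, Quaternion.re_smul, coordQ_apply, smul_eq_mul,
      smul_eq_mul]
    ring
  · congr 1
    rw [Finset.sum_range, Fintype.sum_prod_type]
    refine Finset.sum_congr rfl fun n _ => ?_
    rw [hv1, hw1, re_conj_mul (norm_rfac x n.2), sum_coordQ_mul (re_locForm hm hp hx v n)]

end Coefficients

/-! ### Two-jets at the origin -/

section Jets

variable {d : ℕ} {κ : Type*}

/-- `F` is analytic at `0` with value `c`, first derivatives `D` and second derivatives `H`; the
coordinates are labelled by `κ`. -/
structure HasJet (e : Fin d ≃ κ) (F : (Fin d → ℝ) → ℝ) (c : ℝ) (D : κ → ℝ) (H : κ → κ → ℝ) :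
    Prop where
  contDiffAt : ContDiffAt ℝ ω F 0
  val : F 0 = c
  fst : ∀ k, pderiv (e.symm k) F 0 = D k
  snd : ∀ p k, pderiv (e.symm p) (pderiv (e.symm k) F) 0 = H p k

variable {e : Fin d ≃ κ} {F F' : (Fin d → ℝ) → ℝ} {c c' : ℝ} {D D' : κ → ℝ} {H H' : κ → κ → ℝ}

lemma HasJet.of_contDiffAt (hF : ContDiffAt ℝ ω F 0) : HasJet e F (F 0)
    (fun k => pderiv (e.symm k) F 0) (fun p k => pderiv (e.symm p) (pderiv (e.symm k) F) 0) :=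
  ⟨hF, rfl, fun _ => rfl, fun _ _ => rfl⟩

lemma HasJet.cast (h : HasJet e F c D H) (h0 : c = c') (h1 : ∀ k, D k = D' k)
    (h2 : ∀ p k, H p k = H' p k) : HasJet e F c' D' H' :=
  ⟨h.contDiffAt, h.val.trans h0, fun k => (h.fst k).trans (h1 k),
    fun p k => (h.snd p k).trans (h2 p k)⟩

lemma HasJet.congr (h : HasJet e F c D H) (hF : F' =ᶠ[nhds 0] F) : HasJet e F' c D H := by
  refine ⟨h.contDiffAt.congr_of_eventuallyEq hF, hF.self_of_nhds.trans h.val, fun k => ?_,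
    fun p k => ?_⟩
  · rw [pderiv_congr hF, h.fst]
  · rw [← h.snd]
    refine pderiv_congr ?_
    filter_upwards [hF.eventually_nhds] with x hx using pderiv_congr hx

lemma HasJet.eq (h : HasJet e F c D H) (h' : HasJet e F c' D' H') :
    c = c' ∧ D = D' ∧ H = H' :=
  ⟨h.val.symm.trans h'.val, funext fun k => (h.fst k).symm.trans (h'.fst k),
    funext fun p => funext fun k => (h.snd p k).symm.trans (h'.snd p k)⟩

lemma HasJet.const (c : ℝ) : HasJet e (fun _ => c) c 0 0 := by
  refine ⟨contDiffAt_const, rfl, fun k => by simp, fun p k => ?_⟩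
  have : pderiv (e.symm k) (fun _ => c) = fun _ => 0 := funext fun x => by simp
  rw [this]; simp

lemma HasJet.coord [DecidableEq κ] (i : κ) :
    HasJet e (fun x => x (e.symm i)) 0 (fun k => if k = i then 1 else 0) 0 := by
  have h : ∀ k, pderiv (e.symm k) (fun x : Fin d → ℝ => x (e.symm i)) =
      fun _ => if k = i then 1 else 0 := fun k => funext fun x => by
    have h1 : HasFDerivAt (fun x : Fin d → ℝ => x (e.symm i))
      (ContinuousLinearMap.proj (R := ℝ) (φ := fun _ => ℝ) (e.symm i)) x :=
      (ContinuousLinearMap.proj (R := ℝ) (φ := fun _ : Fin d => ℝ) (e.symm i)).hasFDerivAt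
    rw [pderiv, h1.fderiv]
    simp [Pi.single_apply, eq_comm]
  refine ⟨by fun_prop, rfl, fun k => by rw [h], fun p k => ?_⟩
  rw [h]; simp

lemma HasJet.add (h : HasJet e F c D H) (h' : HasJet e F' c' D' H') :
    HasJet e (fun x => F x + F' x) (c + c') (fun k => D k + D' k) (fun p k => H p k + H' p k) := by
  have hd := h.contDiffAt.eventually (by simp)
  have hd' := h'.contDiffAt.eventually (by simp)
  have e1 : ∀ k, pderiv (e.symm k) (fun x => F x + F' x) =ᶠ[nhds 0]
      fun x => pderiv (e.symm k) F x + pderiv (e.symm k) F' x := fun k => by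
    filter_upwards [hd, hd'] with x hx hx'
    exact pderiv_add (hx.differentiableAt (by simp)) (hx'.differentiableAt (by simp))
  refine ⟨h.contDiffAt.add h'.contDiffAt, by rw [h.val, h'.val], fun k => ?_, fun p k => ?_⟩
  · rw [(e1 k).self_of_nhds]; simp only [h.fst, h'.fst]
  · rw [pderiv_congr (e1 k), pderiv_add ((contDiffAt_pderiv h.contDiffAt).differentiableAt (by simp))
      ((contDiffAt_pderiv h'.contDiffAt).differentiableAt (by simp)), h.snd, h'.snd]

lemma HasJet.mul (h : HasJet e F c D H) (h' : HasJet e F' c' D' H') :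
    HasJet e (fun x => F x * F' x) (c * c') (fun k => c * D' k + D k * c')
      (fun p k => c * H' p k + D p * D' k + D k * D' p + H p k * c') := by
  have hd := h.contDiffAt.eventually (by simp)
  have hd' := h'.contDiffAt.eventually (by simp)
  have e1 : ∀ k, pderiv (e.symm k) (fun x => F x * F' x) =ᶠ[nhds 0]
      fun x => F x * pderiv (e.symm k) F' x + pderiv (e.symm k) F x * F' x := fun k => by
    filter_upwards [hd, hd'] with x hx hx'
    exact pderiv_mul (hx.differentiableAt (by simp)) (hx'.differentiableAt (by simp))
  refine ⟨h.contDiffAt.mul h'.contDiffAt, by rw [h.val, h'.val], fun k => ?_, fun p k => ?_⟩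
  · rw [(e1 k).self_of_nhds]; simp only [h.fst, h'.fst, h.val, h'.val]
  · have a1 := h.contDiffAt.differentiableAt (by simp)
    have a2 := h'.contDiffAt.differentiableAt (by simp)
    have a3 := (contDiffAt_pderiv (i := e.symm k) h.contDiffAt).differentiableAt (by simp)
    have a4 := (contDiffAt_pderiv (i := e.symm k) h'.contDiffAt).differentiableAt (by simp)
    rw [pderiv_congr (e1 k), pderiv_add (a1.fun_mul a4) (a3.fun_mul a2), pderiv_mul a1 a4,
      pderiv_mul a3 a2, h.snd, h'.snd, h.fst, h.fst, h'.fst, h'.fst, h.val, h'.val]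
    ring

lemma HasJet.const_mul (a : ℝ) (h : HasJet e F c D H) :
    HasJet e (fun x => a * F x) (a * c) (fun k => a * D k) (fun p k => a * H p k) :=
  ((HasJet.const a).mul h).cast rfl (by simp) (by simp)

lemma HasJet.sum {ι : Type*} {s : Finset ι} {F : ι → (Fin d → ℝ) → ℝ} {c : ι → ℝ} {D : ι → κ → ℝ}
    {H : ι → κ → κ → ℝ} (h : ∀ i ∈ s, HasJet e (F i) (c i) (D i) (H i)) :
    HasJet e (fun x => ∑ i ∈ s, F i x) (∑ i ∈ s, c i) (fun k => ∑ i ∈ s, D i k)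
      (fun p k => ∑ i ∈ s, H i p k) := by
  classical
  induction s using Finset.induction_on with
  | empty => exact (HasJet.const 0).cast (by simp) (by simp) (by simp)
  | insert i s hi ih =>
    simp only [Finset.sum_insert hi]
    exact (h i (by simp)).add (ih fun j hj => h j (by simp [hj]))

/-- The jet of the inverse of `1 + N`, where `N` vanishes to first order. -/
lemma HasJet.of_mul_one_add (hF : ContDiffAt ℝ ω F 0) (h' : HasJet e F' 0 0 H')
    (hmul : ∀ x, F x * (1 + F' x) = 1) : HasJet e F 1 0 (fun p k => -H' p k) := by
  have h1 := HasJet.of_contDiffAt (e := e) hF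
  have h2 := (HasJet.const (e := e) 1).add h'
  have h3 := (h1.mul h2).congr (F' := fun _ => 1) (.of_forall fun x => (hmul x).symm)
  obtain ⟨a1, a2, a3⟩ := h3.eq (HasJet.const 1)
  have b1 : F 0 = 1 := by simpa using a1
  have b2 : ∀ k, pderiv (e.symm k) F 0 = 0 := fun k => by simpa using congrFun a2 k
  refine h1.cast b1 b2 fun p k => ?_
  have := congrFun (congrFun a3 p) k
  simp [b1] at this
  linarith

end Jets

/-! ### The jets of the coefficients of the metric -/

section MetricJets

variable {m : ℕ} {t : ℝ} {p : Fin m → ℍ[ℝ] × ℍ[ℝ]}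

lemma jet_norm_baseL : HasJet (idx m) (fun x => ‖baseL m x‖ ^ 2) 0 0
    (fun a b => match a, b with
      | .inl k, .inl l => if k = l then 2 else 0
      | _, _ => 0) := by
  have h1 : ∀ x : Fin (3 * m + 4) → ℝ, ‖baseL m x‖ ^ 2 =
      ∑ k : Fin 4, x ((idx m).symm (.inl k)) * x ((idx m).symm (.inl k)) := fun x => by
    rw [sq, ← Quaternion.normSq_eq_norm_mul_self, Quaternion.normSq_def']
    simp only [← coordQ_baseL, Fin.sum_univ_four]
    simp [coordQ_eq]
    ring
  simp only [h1]
  refine (HasJet.sum fun k _ => (HasJet.coord (Sum.inl k)).mul (HasJet.coord (Sum.inl k))).cast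
    (by simp) (by simp) ?_
  rintro (a | a) (b | b)
  · by_cases hab : a = b
    · subst hab; simp [Finset.sum_add_distrib]; norm_num
    · simp [hab, Ne.symm hab, Finset.sum_add_distrib]
  all_goals simp

lemma jet_norm_fibL (s : Fin m) : HasJet (idx m) (fun x => ‖fibL m t s x‖ ^ 2) 0 0
    (fun a b => match a, b with
      | .inr k, .inr l => if k.1 = s ∧ k = l then 2 * (t⁻¹) ^ 2 else 0
      | _, _ => 0) := by
  have h1 : ∀ x : Fin (3 * m + 4) → ℝ, ‖fibL m t s x‖ ^ 2 =
      (t⁻¹) ^ 2 * ∑ k : Fin 3, x ((idx m).symm (.inr (s, k))) * x ((idx m).symm (.inr (s, k))) :=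
    fun x => by
    have h2 : ∀ k, coordQ (basisIm k) (fibL m t s x) ^ 2 =
      (t⁻¹) ^ 2 * (x ((idx m).symm (.inr (s, k))) * x ((idx m).symm (.inr (s, k)))) := fun k => by
      rw [coordQ_fibL]; ring
    rw [sq, ← Quaternion.normSq_eq_norm_mul_self, Quaternion.normSq_def', Finset.mul_sum]
    simp only [← h2, Fin.sum_univ_three]
    simp [coordQ_eq, re_fibL]
  simp only [h1]
  refine ((HasJet.sum fun k _ => (HasJet.coord (Sum.inr (s, k))).mul
    (HasJet.coord (Sum.inr (s, k)))).const_mul _).cast (by simp) (by simp) ?_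
  rintro (a | ⟨a, c⟩) (b | ⟨b, c'⟩)
  · simp
  · simp
  · simp
  · by_cases ha : a = s
    · subst ha
      by_cases hb : b = a
      · subst hb
        by_cases hc : c = c'
        · subst hc; simp [Finset.sum_add_distrib]; ring
        · simp [hc, Ne.symm hc, Finset.sum_add_distrib]
      · simp [hb, Ne.symm hb]
    · simp [ha]

lemma jet_rho_baseL : HasJet (idx m) (fun x => rho (baseL m x) ^ 2) 1 0
    (fun a b => match a, b with
      | .inl k, .inl l => if k = l then -2 else 0
      | _, _ => 0) := by
  refine (HasJet.of_mul_one_add (by fun_prop) jet_norm_baseL fun x => rho_sq _).cast rfl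
    (fun _ => rfl) ?_
  rintro (a | a) (b | b) <;> simp
  split_ifs <;> simp

lemma jet_rho_fibL (s : Fin m) : HasJet (idx m) (fun x => rho (fibL m t s x) ^ 2) 1 0
    (fun a b => match a, b with
      | .inr k, .inr l => if k.1 = s ∧ k = l then -(2 * (t⁻¹) ^ 2) else 0
      | _, _ => 0) := by
  refine (HasJet.of_mul_one_add (by fun_prop) (jet_norm_fibL s) fun x => rho_sq _).cast rfl
    (fun _ => rfl) ?_
  rintro (a | a) (b | b) <;> simp
  split_ifs <;> simp

/-- The components of the pulled back connection form. -/
def formC (m : ℕ) (i : Fin 4) (a : Fin m × Fin 3) (z : (Fin m → ℍ[ℝ] × ℍ[ℝ]) × ℍ[ℝ]) : ℝ :=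
  coordQ (basisIm a.2) (form m z (basisQ i) a.1)

/-- The derivative of a function in the base direction `X`. -/
def dbase {V : Type*} [NormedAddCommGroup V] [NormedSpace ℝ V] (X : ℍ[ℝ]) (Φ : V × ℍ[ℝ] → ℝ)
    (z : V × ℍ[ℝ]) : ℝ := fderiv ℝ Φ z (0, X)

/-- First derivatives of the pulled back connection form at the centre. -/
def formD (m : ℕ) (p : Fin m → ℍ[ℝ] × ℍ[ℝ]) (k i : Fin 4) (a : Fin m × Fin 3) : ℝ :=
  dbase (basisQ k) (formC m i a) (p, 0)

/-- Second derivatives of the pulled back connection form at the centre. -/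
def formDD (m : ℕ) (p : Fin m → ℍ[ℝ] × ℍ[ℝ]) (k l i : Fin 4) (a : Fin m × Fin 3) : ℝ :=
  dbase (basisQ k) (dbase (basisQ l) (formC m i a)) (p, 0)

lemma contDiffAt_formC {y : ℍ[ℝ]} (hy : Good m (ent p) y) (i : Fin 4) (a : Fin m × Fin 3) :
    ContDiffAt ℝ ω (formC m i a) (p, y) :=
  (coordQ (basisIm a.2)).contDiff.contDiffAt.comp (p, y) (contDiffAt_form hy (basisQ i) a.1)

lemma baseL_single (k : Fin 4) : baseL m (Pi.single ((idx m).symm (.inl k)) 1) = basisQ k := by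
  simp [baseL_apply, Pi.single_apply]

lemma baseL_single_inr (a : Fin m × Fin 3) :
    baseL m (Pi.single ((idx m).symm (.inr a)) 1) = 0 := by
  simp [baseL_apply]

lemma fibL_single_inl (k : Fin 4) (s : Fin m) :
    fibL m t s (Pi.single ((idx m).symm (.inl k)) 1) = 0 := by
  simp [fibL_apply]

lemma fibL_single (a : Fin m × Fin 3) (s : Fin m) :
    fibL m t s (Pi.single ((idx m).symm (.inr a)) 1) =
      if s = a.1 then t⁻¹ • basisIm a.2 else 0 := by
  rcases a with ⟨n, b⟩
  by_cases h : s = n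
  · subst h; simp [fibL_apply, Pi.single_apply]
  · simp [fibL_apply, h]

lemma pderiv_comp_baseL {V : Type*} [NormedAddCommGroup V] [NormedSpace ℝ V] {Φ : V × ℍ[ℝ] → ℝ}
    {q : V} {x : Fin (3 * m + 4) → ℝ} (hΦ : DifferentiableAt ℝ Φ (q, baseL m x))
    (i : Fin (3 * m + 4)) :
    pderiv i (fun x => Φ (q, baseL m x)) x = dbase (baseL m (Pi.single i 1)) Φ (q, baseL m x) := by
  have h1 : HasFDerivAt (fun x => (q, baseL m x))
      ((0 : (Fin (3 * m + 4) → ℝ) →L[ℝ] V).prod (baseL m)) x :=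
    (hasFDerivAt_const q x).prodMk (baseL m).hasFDerivAt
  have h2 : HasFDerivAt (fun x => Φ (q, baseL m x)) _ x := hΦ.hasFDerivAt.comp x h1
  rw [pderiv, h2.fderiv]
  rfl

lemma dbase_zero {V : Type*} [NormedAddCommGroup V] [NormedSpace ℝ V] (Φ : V × ℍ[ℝ] → ℝ)
    (z : V × ℍ[ℝ]) : dbase 0 Φ z = 0 := by
  rw [dbase, Prod.mk_zero_zero, map_zero]

lemma jet_formC (hm : 1 < m) (hp : Adm m (ent p)) (i : Fin 4) (a : Fin m × Fin 3) :
    HasJet (idx m) (fun x => formC m i a (p, baseL m x)) 0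
      (fun k => match k with
        | .inl k => formD m p k i a
        | .inr _ => 0)
      (fun k l => match k, l with
        | .inl k, .inl l => formDD m p k l i a
        | _, _ => 0) := by
  have hg := good_zero hp
  have hev : ∀ᶠ x in nhds (0 : Fin (3 * m + 4) → ℝ), Good m (ent p) (baseL m x) :=
    eventually_good (f := fun _ => ent p) (fun j => contDiffAt_const) (by fun_prop)
      (by rw [map_zero]; exact good_zero hp)
  have h1 : ∀ k, pderiv k (fun x => formC m i a (p, baseL m x)) =ᶠ[nhds 0]
      fun x => dbase (baseL m (Pi.single k 1)) (formC m i a) (p, baseL m x) := fun k => by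
    filter_upwards [hev] with x hx
    exact pderiv_comp_baseL ((contDiffAt_formC hx i a).differentiableAt (by simp)) k
  have h2 : ∀ k l, pderiv k (pderiv l (fun x => formC m i a (p, baseL m x))) 0 =
      dbase (baseL m (Pi.single k 1)) (dbase (baseL m (Pi.single l 1)) (formC m i a)) (p, 0) := by
    intro k l
    rw [pderiv_congr (h1 l), pderiv_comp_baseL, map_zero]
    rw [map_zero]
    exact (contDiffAt_fderiv_apply (contDiffAt_formC hg i a) _).differentiableAt (by simp)
  refine ⟨?_, ?_, ?_, ?_⟩
  · have h3 : ContDiffAt ℝ ω (formC m i a) (p, baseL m 0) := by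
      rw [map_zero]; exact contDiffAt_formC hg i a
    exact ContDiffAt.comp (g := formC m i a) (f := fun x => (p, baseL m x)) 0 h3
      (contDiffAt_const.prodMk (baseL m).contDiff.contDiffAt)
  · rw [map_zero, formC, (hasDerivAt_form_radial hm hp (basisQ i) a.1.2).1, map_zero]
  · rintro (k | k)
    · rw [(h1 _).self_of_nhds, baseL_single]; simp only [map_zero]; rfl
    · rw [(h1 _).self_of_nhds, baseL_single_inr]; exact dbase_zero _ _
  · rintro (k | k) (l | l)
    · rw [h2, baseL_single, baseL_single]; rfl
    · rw [h2, baseL_single, baseL_single_inr]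
      have : dbase 0 (formC m i a) = fun _ => 0 := funext fun z => dbase_zero _ z
      rw [this]; simp [dbase]
    · rw [h2, baseL_single_inr, dbase_zero]
    · rw [h2, baseL_single_inr, dbase_zero]

lemma form_add {z : (Fin m → ℍ[ℝ] × ℍ[ℝ]) × ℍ[ℝ]} (X Y : ℍ[ℝ]) (n : ℕ) :
    form m z (X + Y) n = form m z X n + form m z Y n := by
  rw [form, form, form, ← conn_ent_add, dsect, dsect, dsect, ← map_add, Prod.mk_add_mk, add_zero]

lemma form_zero_right {z : (Fin m → ℍ[ℝ] × ℍ[ℝ]) × ℍ[ℝ]} (n : ℕ) : form m z 0 n = 0 := by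
  have := form_add (z := z) 0 0 n
  rwa [add_zero, left_eq_add] at this

/-- The first derivative of the pulled back connection form is its curvature. -/
lemma formD_antisymm (hm : 1 < m) (hp : Adm m (ent p)) (k i : Fin 4) (a : Fin m × Fin 3) :
    formD m p k i a = -formD m p i k a := by
  have hg := good_zero hp
  have hd : ∀ X, DifferentiableAt ℝ (fun z => coordQ (basisIm a.2) (form m z X a.1)) (p, 0) :=
    fun X => (coordQ (basisIm a.2)).differentiableAt.comp (p, 0)
      ((contDiffAt_form hg X a.1).differentiableAt (by simp))
  let B : ℍ[ℝ] → ℍ[ℝ] → ℝ := fun Y X =>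
    dbase Y (fun z => coordQ (basisIm a.2) (form m z X a.1)) (p, 0)
  have hB1 : ∀ X Y Z, B (Y + Z) X = B Y X + B Z X := fun X Y Z => by
    simp only [B, dbase]
    rw [← map_add, Prod.mk_add_mk, add_zero]
  have hB2 : ∀ X Y Z, B Z (X + Y) = B Z X + B Z Y := fun X Y Z => by
    simp only [B, dbase]
    rw [← add_apply, ← fderiv_fun_add (hd X) (hd Y)]
    simp only [form_add, map_add]
  -- The radial vanishing says that the bilinear form `B` is alternating; polarization then gives
  -- antisymmetry.
  have hB0 : ∀ X, B X X = 0 := fun X => by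
    have h1 : HasDerivAt (fun s : ℝ => (p, s • X)) ((0, X) : (Fin m → ℍ[ℝ] × ℍ[ℝ]) × ℍ[ℝ]) 0 := by
      refine (hasDerivAt_const _ _).prodMk ?_
      simpa using (hasDerivAt_id (0 : ℝ)).smul_const X
    have h2 : HasFDerivAt (fun z => coordQ (basisIm a.2) (form m z X a.1))
        (fderiv ℝ (fun z => coordQ (basisIm a.2) (form m z X a.1)) (p, 0)) (p, (0 : ℝ) • X) := by
      rw [zero_smul]; exact (hd X).hasFDerivAt
    have h3 := (coordQ (basisIm a.2)).hasFDerivAt.comp_hasDerivAt (0 : ℝ)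
      (hasDerivAt_form_radial hm hp X a.1.2).2
    rw [map_zero] at h3
    exact (h2.comp_hasDerivAt 0 h1).unique h3
  have h := hB0 (basisQ k + basisQ i)
  rw [hB1, hB2, hB2, hB0, hB0] at h
  change B (basisQ k) (basisQ i) = -B (basisQ i) (basisQ k)
  linarith

end MetricJets

/-! ### Two-jets of the scaled connection form and of the metric coefficients. -/

section Theta

variable {m : ℕ} {t : ℝ} {p : Fin m → ℍ[ℝ] × ℍ[ℝ]}

/-- The structure constants of `Im ℍ`. -/
def eps (c d b : Fin 3) : ℝ := coordQ (basisIm b) (basisIm c * basisIm d)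

/-- The values at the centre of the scaled connection form. -/
def thetaVal {m : ℕ} : Fin 4 ⊕ (Fin m × Fin 3) → Fin m × Fin 3 → ℝ
  | .inl _, _ => 0
  | .inr a', a => if a = a' then 1 else 0

/-- The first derivatives at the centre of the scaled connection form. -/
def thetaD {m : ℕ} (t : ℝ) (f : Fin 4 → Fin 4 → Fin m × Fin 3 → ℝ) :
    Fin 4 ⊕ (Fin m × Fin 3) → Fin m × Fin 3 → Fin 4 ⊕ (Fin m × Fin 3) → ℝ
  | .inl i, a, .inl k => t * f k i a
  | .inr a', a, .inr d => if a.1 = a'.1 ∧ d.1 = a'.1 then -(t⁻¹ * eps a'.2 d.2 a.2) else 0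
  | _, _, _ => 0

/-- The second derivatives at the centre of the scaled connection form. -/
def thetaH {m : ℕ} (t : ℝ) (s : Fin 4 → Fin 4 → Fin 4 → Fin m × Fin 3 → ℝ) :
    Fin 4 ⊕ (Fin m × Fin 3) → Fin m × Fin 3 → Fin 4 ⊕ (Fin m × Fin 3) →
      Fin 4 ⊕ (Fin m × Fin 3) → ℝ
  | .inl i, a, .inl k, .inl l => t * s k l i a
  | .inr a', a, .inr d, .inr d' => if a = a' ∧ d.1 = a'.1 ∧ d = d' then -(2 * (t⁻¹) ^ 2) else 0
  | _, _, _, _ => 0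

lemma coordQ_basisIm_imQ (b : Fin 3) (a : ℍ[ℝ]) :
    coordQ (basisIm b) (imQ a) = coordQ (basisIm b) a := by
  rw [imQ_eq_sub_re, map_sub, coordQ_basisIm_coe, sub_zero]

/-- The jets of the scaled connection form in the local parametrization. -/
lemma jet_locForm (hm : 1 < m) (ht : t ≠ 0) (hp : Adm m (ent p)) (i : Fin 4 ⊕ (Fin m × Fin 3))
    (a : Fin m × Fin 3) :
    HasJet (idx m) (fun x => t * coordQ (basisIm a.2)
        (locForm m t p x (Pi.single ((idx m).symm i) 1) a.1))
      (thetaVal i a) (thetaD t (formD m p) i a) (thetaH t (formDD m p) i a) := by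
  rcases i with i | c
  · refine (((jet_formC hm hp i a).const_mul t).congr (.of_forall fun x => ?_)).cast ?_ ?_ ?_
    · simp [locForm, fibL_single_inl, baseL_single, formC]
    · simp [thetaVal]
    · rintro (k | k) <;> simp [thetaD]
    · rintro (k | k) (l | l) <;> simp [thetaH]
  · rcases a with ⟨n, b⟩
    rcases c with ⟨s, c⟩
    by_cases hn : n = s
    · subst hn
      have h1 : ∀ x : Fin (3 * m + 4) → ℝ, coordQ (basisIm b) (basisIm c * fibL m t n x) =
          ∑ d, (t⁻¹ * eps c d b) * x ((idx m).symm (.inr (n, d))) := fun x => by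
        rw [fibL_apply, Finset.mul_sum, map_sum]
        refine Finset.sum_congr rfl fun d _ => ?_
        rw [mul_smul_comm, map_smul, eps, smul_eq_mul]; ring
      -- In a fibre direction the pulled back form drops out. What remains is `rho²` times a
      -- constant minus a linear function of the fibre coordinates; the factor `t⁻¹` in `fibL`
      -- cancels the scale `t`.
      refine (((jet_rho_fibL (t := t) n).mul ((HasJet.const (if b = c then (1 : ℝ) else 0)).add
        ((HasJet.sum (s := Finset.univ) fun d _ => (HasJet.coord (Sum.inr (n, d))).const_mul
          (t⁻¹ * eps c d b)).const_mul (-1)))).congr (.of_forall fun x => ?_)).cast ?_ ?_ ?_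
      · simp only [locForm, baseL_single_inr, form_zero_right, zero_add, fibL_single, if_true,
          map_smul, map_sub, coordQ_basisIm_imQ, smul_mul_assoc, ← h1, coordQ_basisIm]
        simp only [smul_eq_mul]
        field_simp
        ring
      · simp [thetaVal]
      · rintro (k | ⟨s, d⟩)
        · simp [thetaD]
        · by_cases hs : s = n
          · subst hs; simp [thetaD]
          · simp [thetaD, hs]
      · rintro (k | ⟨s, d⟩) (l | ⟨s', d'⟩)
        · simp [thetaH]
        · simp [thetaH]
        · simp [thetaH]
        · by_cases hb : b = c
          · subst hb; simp [thetaH]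
          · simp [thetaH, hb]
    · refine ((HasJet.const 0).congr (.of_forall fun x => ?_)).cast ?_ ?_ ?_
      · simp [locForm, baseL_single_inr, form_zero_right, fibL_single, hn]
      · simp [thetaVal, hn]
      · rintro (k | ⟨s', d⟩) <;> simp [thetaD, hn]
      · rintro (k | ⟨s', d⟩) (l | ⟨s', d'⟩) <;> simp [thetaH, hn]

/-- The mixed second derivatives of the metric. -/
def mixE {m : ℕ} (t : ℝ) (f : Fin 4 → Fin 4 → Fin m × Fin 3 → ℝ) (k i : Fin 4)
    (d a : Fin m × Fin 3) : ℝ :=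
  ∑ b, t * f k i b * thetaD t f (.inr a) b (.inr d)

/-- The second derivatives of the fibre metric. -/
def fibW {m : ℕ} (t : ℝ) (d d' a b : Fin m × Fin 3) : ℝ :=
  if d.1 = a.1 ∧ d'.1 = a.1 ∧ b.1 = a.1 then -(t⁻¹) ^ 2 *
    ((if d.2 = d'.2 ∧ a.2 = b.2 then 2 else 0) + (if a.2 = d'.2 ∧ b.2 = d.2 then 1 else 0) +
      (if a.2 = d.2 ∧ b.2 = d'.2 then 1 else 0)) else 0

lemma mixE_antisymm {f : Fin 4 → Fin 4 → Fin m × Fin 3 → ℝ} (hf : ∀ k i a, f k i a = -f i k a)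
    (k i : Fin 4) (d a : Fin m × Fin 3) : mixE t f k i d a = -mixE t f i k d a := by
  rw [mixE, mixE, ← Finset.sum_neg_distrib]
  exact Finset.sum_congr rfl fun b _ => by rw [hf k i b]; ring

lemma eps_antisymm (c d b : Fin 3) : eps c d b = -eps b d c := by
  fin_cases c <;> fin_cases d <;> fin_cases b <;> simp [eps, coordQ_eq]

/-- The vector identity for the inner product of two cross products. -/
lemma sum_eps_mul_eps (a d b d' : Fin 3) : ∑ c, eps a d c * eps b d' c =
    (if d = d' ∧ a = b then 1 else 0) - (if a = d' ∧ b = d then 1 else 0) := by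
  rw [Fin.sum_univ_three]
  fin_cases a <;> fin_cases d <;> fin_cases b <;> fin_cases d' <;> simp [eps, coordQ_eq]

/-- The fibre is a product of round 3-spheres of radius `t`: distinct factors do not interact, and
each has Ricci curvature `2 / t²`. -/
lemma sum_fibW (a b : Fin m × Fin 3) :
    (1 / 2) * ∑ d, (fibW t d a b d + fibW t d b a d - fibW t d d a b - fibW t b a d d) =
      if a = b then 2 / t ^ 2 else 0 := by
  obtain ⟨n, a⟩ := a
  obtain ⟨n', b⟩ := b
  by_cases h : n' = n
  · subst h
    have h1 : ∀ d : Fin m × Fin 3, fibW t d (n', a) (n', b) d + fibW t d (n', b) (n', a) d -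
        fibW t d d (n', a) (n', b) - fibW t (n', b) (n', a) d d = if d.1 = n' then
        (fibW t (n', d.2) (n', a) (n', b) (n', d.2) + fibW t (n', d.2) (n', b) (n', a) (n', d.2) -
        fibW t (n', d.2) (n', d.2) (n', a) (n', b) - fibW t (n', b) (n', a) (n', d.2) (n', d.2))
        else 0 := by
      rintro ⟨n, d⟩
      by_cases hn : n = n'
      · subst hn; simp
      · simp [fibW, hn, Ne.symm hn]
    rw [Finset.sum_congr rfl fun d _ => h1 d]
    simp only [Fintype.sum_prod_type, Finset.sum_ite_irrel, Finset.sum_const_zero,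
      Finset.sum_ite_eq', Finset.mem_univ, if_true]
    simp only [fibW, and_self, if_true, Fin.sum_univ_three, Prod.mk.injEq, true_and]
    fin_cases a <;> fin_cases b <;> simp <;> ring
  · have h1 : ∀ d, fibW t d (n, a) (n', b) d = 0 := fun d => if_neg fun h2 => h h2.2.1.symm
    have h2 : ∀ d, fibW t d (n', b) (n, a) d = 0 := fun d => if_neg fun h2 => h h2.2.1.symm.symm
    have h3 : ∀ d, fibW t d d (n, a) (n', b) = 0 := fun d => if_neg fun h2 => h h2.2.2
    have h4 : ∀ d, fibW t (n', b) (n, a) d d = 0 := fun d =>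
      if_neg fun h2 => h (h2.1.trans h2.2.1.symm)
    simp [h1, h2, h3, h4, Ne.symm h]

lemma coordQ_zero_left (a : ℍ[ℝ]) : coordQ 0 a = 0 := by simp [coordQ_apply]

lemma sum_thetaVal_mul (a : Fin m × Fin 3) (g : Fin m × Fin 3 → ℝ) :
    ∑ x, thetaVal (.inr a) x * g x = g a := by
  simp [thetaVal]

/-- This makes the first derivatives of the fibre metric cancel at the centre. -/
lemma thetaD_antisymm (f : Fin 4 → Fin 4 → Fin m × Fin 3 → ℝ) (a b d : Fin m × Fin 3) :
    thetaD t f (.inr b) a (.inr d) = -thetaD t f (.inr a) b (.inr d) := by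
  simp only [thetaD]
  by_cases h : a.1 = b.1
  · rw [eps_antisymm, h]; split_ifs <;> simp
  · simp [h, Ne.symm h]

lemma sum_thetaD_mul_thetaD (f : Fin 4 → Fin 4 → Fin m × Fin 3 → ℝ) (a b d d' : Fin m × Fin 3) :
    ∑ x, thetaD t f (.inr a) x (.inr d) * thetaD t f (.inr b) x (.inr d') =
      if d.1 = a.1 ∧ d'.1 = a.1 ∧ b.1 = a.1 then (t⁻¹) ^ 2 *
        ((if d.2 = d'.2 ∧ a.2 = b.2 then 1 else 0) - (if a.2 = d'.2 ∧ b.2 = d.2 then 1 else 0))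
      else 0 := by
  have h1 : ∀ x, thetaD t f (.inr a) x (.inr d) * thetaD t f (.inr b) x (.inr d') =
      if x.1 = a.1 then (if d.1 = a.1 ∧ d'.1 = a.1 ∧ b.1 = a.1 then (t⁻¹) ^ 2 *
        (eps a.2 d.2 x.2 * eps b.2 d'.2 x.2) else 0) else 0 := fun x => by
    simp only [thetaD]
    by_cases hx : x.1 = a.1
    · by_cases hd : d.1 = a.1
      · by_cases hb : b.1 = a.1
        · by_cases hd' : d'.1 = a.1
          · simp [hx, hd, hb, hd']; ring
          · simp [hx, hd, hb, hd']
        · simp [hx, hd, hb, Ne.symm hb]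
      · simp [hd]
    · simp [hx]
  rw [Finset.sum_congr rfl fun x _ => h1 x, ← sum_eps_mul_eps]
  simp only [Fintype.sum_prod_type, Finset.sum_ite_irrel, Finset.sum_const_zero,
    Finset.sum_ite_eq', Finset.mem_univ, if_true, Finset.mul_sum]

lemma fibW_eq (f : Fin 4 → Fin 4 → Fin m × Fin 3 → ℝ)
    (s : Fin 4 → Fin 4 → Fin 4 → Fin m × Fin 3 → ℝ) (a b d d' : Fin m × Fin 3) :
    ∑ x, (thetaVal (.inr a) x * thetaH t s (.inr b) x (.inr d) (.inr d') +
        thetaD t f (.inr a) x (.inr d) * thetaD t f (.inr b) x (.inr d') +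
        thetaD t f (.inr a) x (.inr d') * thetaD t f (.inr b) x (.inr d) +
        thetaH t s (.inr a) x (.inr d) (.inr d') * thetaVal (.inr b) x) = fibW t d d' a b := by
  simp only [Finset.sum_add_distrib, sum_thetaVal_mul, sum_thetaD_mul_thetaD,
    mul_comm _ (thetaVal _ _)]
  simp only [thetaH, fibW]
  obtain ⟨n, a⟩ := a
  obtain ⟨n₁, b⟩ := b
  obtain ⟨n₂, d⟩ := d
  obtain ⟨n₃, d'⟩ := d'
  simp only [Prod.mk.injEq]
  by_cases h1 : n₁ = n
  · subst h1
    by_cases h2 : n₂ = n₁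
    · subst h2
      by_cases h3 : n₃ = n₂
      · subst h3
        have e1 : (a = b ∧ d = d') ↔ (d = d' ∧ a = b) := and_comm
        have e2 : (b = a ∧ d = d') ↔ (d = d' ∧ a = b) := by rw [and_comm, eq_comm (a := b)]
        have e3 : (d' = d ∧ a = b) ↔ (d = d' ∧ a = b) := by rw [eq_comm (a := d')]
        simp only [true_and, and_true, if_true, e1, e2, e3]
        split_ifs <;> ring
      · simp [h3, Ne.symm h3]
    · simp [h2]
  · simp [h1, Ne.symm h1]

/-- The jets of the coefficients of the connection metric. -/
lemma jet_metricCoeff (hm : 1 < m) (ht : t ≠ 0) (hp : Adm m (ent p))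
    (i j : Fin 4 ⊕ (Fin m × Fin 3)) :
    HasJet (idx m) (fun x => metricCoeff (connMetric m t) (param m t p) x
        ((idx m).symm i) ((idx m).symm j))
      (if i = j then 1 else 0) (fun k => blockD t (formD m p) k i j)
      (fun k l => blockH t (formD m p) (formDD m p) (mixE t (formD m p)) (fibW t) k l i j) := by
  have hev : ∀ᶠ x in nhds (0 : Fin (3 * m + 4) → ℝ), Good m (ent p) (baseL m x) :=
    eventually_good (f := fun _ => ent p) (fun j => contDiffAt_const) (by fun_prop)
      (by rw [map_zero]; exact good_zero hp)
  -- The metric is `rho⁴` times the flat base metric plus the sum of squares of the scaled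
  -- connection form, so its jets follow from the product rule.
  have hθ := fun i a => jet_locForm (t := t) hm ht hp i a
  have hsum := HasJet.sum (s := Finset.univ) fun a _ => (hθ i a).mul (hθ j a)
  have hβ := (jet_rho_baseL (m := m)).mul jet_rho_baseL
  have h := ((hβ.mul (HasJet.const (coordQ (baseL m (Pi.single ((idx m).symm i) 1))
    (baseL m (Pi.single ((idx m).symm j) 1))))).add hsum).congr
    (F' := fun x => metricCoeff (connMetric m t) (param m t p) x
        ((idx m).symm i) ((idx m).symm j)) (by
      filter_upwards [hev] with x hx
      have := metricFun_param (t := t) hm hp hx (Pi.single ((idx m).symm i) 1)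
        (Pi.single ((idx m).symm j) 1)
      change metricFun _ _ _ _ _ = _
      rw [this, Finset.mul_sum]
      congr 1
      · ring
      · exact Finset.sum_congr rfl fun a _ => by ring)
  refine h.cast ?_ ?_ ?_ <;> clear h hβ hsum hθ hev
  · rcases i with i | a <;> rcases j with j | b
    · simp [thetaVal, baseL_single, coordQ_basisQ]
    · simp [thetaVal, baseL_single_inr]
    · simp [thetaVal, baseL_single_inr, coordQ_zero_left]
    · simp [thetaVal, baseL_single_inr, eq_comm]
  · intro k
    rcases i with i | a <;> rcases j with j | b <;> rcases k with k | d <;>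
      first
      | simp only [Finset.sum_add_distrib, mul_comm _ (thetaVal _ _), sum_thetaVal_mul]
        rw [thetaD_antisymm]
        simp [blockD]
      | simp [thetaVal, thetaD, blockD]
  · intro k l
    rcases i with i | a <;> rcases j with j | b <;> rcases k with k | d <;> rcases l with l | d' <;>
      first
      | rw [fibW_eq, baseL_single_inr, coordQ_zero_left]
        simp [blockH]
      | simp [thetaVal, thetaD, thetaH, blockH, mixE, baseL_single, baseL_single_inr,
        coordQ_basisQ, coordQ_zero_left]
    -- In the base block `-4` arises as `-2 - 2`, one summand from each factor `rho²`.
    · rw [Finset.mul_sum]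
      congr 1
      · split_ifs <;> simp_all; norm_num
      · exact Finset.sum_congr rfl fun x _ => by ring
    · exact Finset.sum_congr rfl fun x _ => by split_ifs <;> ring
    · exact Finset.sum_congr rfl fun x _ => by split_ifs <;> ring

end Theta

/-! ### Positivity of the metric and of its Ricci curvature -/

section Positivity

variable {m : ℕ} {t : ℝ} {p : Fin m → ℍ[ℝ] × ℍ[ℝ]}

/-- Compactness is what lets a single fibre size `t` serve all points. -/
lemma isCompact_Sp2m (m : ℕ) : IsCompact (Sp2m m) := by
  refine Metric.isCompact_of_isClosed_isBounded ?_ ?_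
  · have h1 : IsClosed {u : Fin m → ℍ[ℝ] × ℍ[ℝ] | ∀ i, u i ∈ S7} := by
      simp only [Set.ofPred_forall]
      refine isClosed_iInter fun i => ?_
      exact isClosed_eq (by fun_prop) continuous_const
    have h2 : IsClosed {u : Fin m → ℍ[ℝ] × ℍ[ℝ] | ∀ i j : Fin m, (j : ℕ) = (i : ℕ) + 1 →
        (if (i : ℕ) = 0 then hopf (u i) else hopfTilde (u i)) = -hopf (u j)} := by
      simp only [Set.ofPred_forall]
      refine isClosed_iInter fun i => isClosed_iInter fun j => isClosed_iInter fun _ => ?_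
      refine isClosed_eq ?_ ?_
      · split_ifs
        · unfold hopf; fun_prop
        · unfold hopfTilde; fun_prop
      · unfold hopf; fun_prop
    exact h1.inter h2
  · refine (Metric.isBounded_closedBall (x := 0) (r := 1)).subset fun u hu => ?_
    rw [mem_closedBall_zero_iff, pi_norm_le_iff_of_nonneg zero_le_one]
    intro i
    have h : ‖(u i).1‖ ^ 2 + ‖(u i).2‖ ^ 2 = 1 := hu.1 i
    rw [Prod.norm_def, sup_le_iff]
    constructor <;> nlinarith [norm_nonneg (u i).1, norm_nonneg (u i).2]

/-- Here it matters that `sect` treats the centre as a variable: the pulled back form is analytic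
jointly in centre and parameter, so its jets at the centre depend continuously on `p`. -/
lemma continuousOn_formD (k i : Fin 4) (a : Fin m × Fin 3) :
    ContinuousOn (fun p => formD m p k i a) (Sp2m m) := fun p hp => by
  have hg := good_zero (mem_Sp2m_iff_adm.1 hp)
  have h1 : ContDiffAt ℝ ω (dbase (basisQ k) (formC m i a)) (p, 0) :=
    contDiffAt_fderiv_apply (contDiffAt_formC hg i a) _
  exact (h1.continuousAt.comp (f := fun p => (p, (0 : ℍ[ℝ]))) (by fun_prop)).continuousWithinAt

lemma continuousOn_formDD (k l i : Fin 4) (a : Fin m × Fin 3) :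
    ContinuousOn (fun p => formDD m p k l i a) (Sp2m m) := fun p hp => by
  have hg := good_zero (mem_Sp2m_iff_adm.1 hp)
  have h1 : ContDiffAt ℝ ω (dbase (basisQ k) (dbase (basisQ l) (formC m i a))) (p, 0) :=
    contDiffAt_fderiv_apply (contDiffAt_fderiv_apply (contDiffAt_formC hg i a) _) _
  exact (h1.continuousAt.comp (f := fun p => (p, (0 : ℍ[ℝ]))) (by fun_prop)).continuousWithinAt

/-- Uniform bounds on the jets of the connection form. -/
lemma exists_bound_form (m : ℕ) : ∃ K : ℝ, 0 ≤ K ∧ ∀ p ∈ Sp2m m,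
    (∀ k i a, |formD m p k i a| ≤ K) ∧
    ∀ i a, |∑ k, (formDD m p k i k a - formDD m p k k i a)| ≤ K := by
  have h1 : ContinuousOn (fun p => ∑ k, ∑ i, ∑ a, |formD m p k i a| +
      ∑ i, ∑ a, |∑ k, (formDD m p k i k a - formDD m p k k i a)|) (Sp2m m) := by
    refine .add ?_ ?_
    · exact continuousOn_finsetSum _ fun k _ => continuousOn_finsetSum _ fun i _ =>
        continuousOn_finsetSum _ fun a _ => (continuousOn_formD k i a).abs
    · exact continuousOn_finsetSum _ fun i _ => continuousOn_finsetSum _ fun a _ =>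
        (continuousOn_finsetSum _ fun k _ =>
          (continuousOn_formDD k i k a).sub (continuousOn_formDD k k i a)).abs
  obtain ⟨K, hK⟩ := (isCompact_Sp2m m).exists_bound_of_continuousOn h1
  refine ⟨max K 0, le_max_right _ _, fun p hp => ?_⟩
  have h2 := (le_abs_self _).trans ((hK p hp).trans (le_max_left K 0))
  set A := ∑ k, ∑ i, ∑ a, |formD m p k i a| with hA
  set B := ∑ i, ∑ a, |∑ k, (formDD m p k i k a - formDD m p k k i a)| with hB
  have hA0 : 0 ≤ A := by positivity
  have hB0 : 0 ≤ B := by positivity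
  constructor
  · intro k i a
    have : |formD m p k i a| ≤ A :=
      (Finset.single_le_sum (f := fun a => |formD m p k i a|) (fun _ _ => abs_nonneg _)
        (Finset.mem_univ a)).trans <|
      (Finset.single_le_sum (f := fun i => ∑ a, |formD m p k i a|) (fun _ _ => by positivity)
        (Finset.mem_univ i)).trans <|
      Finset.single_le_sum (f := fun k => ∑ i, ∑ a, |formD m p k i a|) (fun _ _ => by positivity)
        (Finset.mem_univ k)
    linarith
  · intro i a
    have : |∑ k, (formDD m p k i k a - formDD m p k k i a)| ≤ B :=
      (Finset.single_le_sum (f := fun a => |∑ k, (formDD m p k i k a - formDD m p k k i a)|)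
        (fun _ _ => abs_nonneg _) (Finset.mem_univ a)).trans <|
      Finset.single_le_sum (f := fun i => ∑ a, |∑ k, (formDD m p k i k a - formDD m p k k i a)|)
        (fun _ _ => by positivity) (Finset.mem_univ i)
    linarith

/-- A tangent vector is the image of some coordinate vector `ξ`. The coordinates are orthonormal at
the centre, so its squared length is `∑ ξ i ^ 2`. -/
lemma connMetric_pos (hm : 1 < m) (ht : t ≠ 0) (hp : p ∈ Sp2m m) {v : Fin m → ℍ[ℝ] × ℍ[ℝ]}
    (hv : v ∈ tangentVectors (Sp2m m) p) (hv0 : v ≠ 0) : 0 < connMetric m t p v v := by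
  have hpa := mem_Sp2m_iff_adm.1 hp
  obtain ⟨ξ, rfl⟩ := exists_fderiv_param_eq hm ht hp hv
  have hξ : ξ ≠ 0 := by rintro rfl; exact hv0 (map_zero _)
  have h := metricFun_param (t := t) (x := 0) hm hpa (by rw [map_zero]; exact good_zero hpa) ξ ξ
  rw [param_zero hpa] at h
  rw [connMetric_apply, h]
  have h1 : ∀ n, locForm m t p 0 ξ n = fibL m t n ξ := fun n => by
    rw [locForm, map_zero, map_zero, (hasDerivAt_form_radial hm hpa (baseL m ξ) n.2).1]
    simp
  have h2 : coordQ (baseL m ξ) (baseL m ξ) = ∑ k, ξ ((idx m).symm (.inl k)) ^ 2 := by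
    simp only [← coordQ_baseL, Fin.sum_univ_four]
    simp [coordQ_eq]
    ring
  have h3 : t ^ 2 * ∑ a : Fin m × Fin 3, coordQ (basisIm a.2) (locForm m t p 0 ξ a.1) *
      coordQ (basisIm a.2) (locForm m t p 0 ξ a.1) = ∑ a, ξ ((idx m).symm (.inr a)) ^ 2 := by
    rw [Finset.mul_sum]
    refine Finset.sum_congr rfl fun a _ => ?_
    rw [h1, coordQ_fibL]
    field_simp
  have h4 : ∑ i, ξ i ^ 2 = ∑ k, ξ ((idx m).symm (.inl k)) ^ 2 +
      ∑ a, ξ ((idx m).symm (.inr a)) ^ 2 := by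
    rw [← (idx m).symm.sum_comp, Fintype.sum_sum_type]
  rw [h3, map_zero, rho_zero, h2, one_pow, one_pow, one_mul, ← h4]
  obtain ⟨i, hi⟩ := Function.ne_iff.1 hξ
  exact Finset.sum_pos' (fun _ _ => sq_nonneg _) ⟨i, Finset.mem_univ i, by positivity [sq_pos_of_ne_zero hi]⟩

lemma isRiemannianMetric_connMetric (hm : 1 < m) (ht : t ≠ 0) :
    IsRiemannianMetric (Sp2m m) (connMetric m t) :=
  isRiemannianMetric_of_apply (contDiff_connMetric_apply m t)
    (fun u v w => metricFun_comm m t u v w) fun _ hp _ hv hv0 => connMetric_pos hm ht hp hv hv0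

lemma ricci_metricCoeff (hm : 1 < m) (ht : t ≠ 0) (hp : Adm m (ent p)) (i j : Fin (3 * m + 4)) :
    ricci (metricCoeff (connMetric m t) (param m t p)) i j 0 =
      jetRicci (blockD t (formD m p))
        (blockH t (formD m p) (formDD m p) (mixE t (formD m p)) (fibW t)) (idx m i) (idx m j) := by
  have hJ : ∀ i j, HasJet (idx m) (fun x => metricCoeff (connMetric m t) (param m t p) x i j) _ _ _ :=
    fun i j => by simpa using jet_metricCoeff (t := t) hm ht hp (idx m i) (idx m j)
  rw [ricci_eq_jetRicci (fun i j => (hJ i j).contDiffAt), ← jetRicci_reindex (idx m)]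
  · congr 1
    · funext k i j
      simpa using (hJ i j).fst (idx m k)
    · funext k l i j
      simpa using (hJ i j).snd (idx m k) (idx m l)
  · ext i j
    rw [(hJ i j).val, Matrix.one_apply]

/-- For small `t`, the connection metric has positive Ricci curvature. -/
theorem exists_hasPosRicci (hm : 1 < m) :
    ∃ t : ℝ, t ≠ 0 ∧ HasPosRicci (3 * m + 4) (Sp2m m) (connMetric m t) := by
  obtain ⟨K, hK, hb⟩ := exists_bound_form m
  set C : ℝ := 32 * Fintype.card (Fin m × Fin 3) * K ^ 2 + K * Fintype.card (Fin m × Fin 3) + 2 * K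
    with hC
  have hC0 : 0 ≤ C := by positivity
  -- This value meets both requirements of `jetRicci_pos`, `t ≤ 1` and `t * C ≤ 1`, and does not
  -- depend on the point.
  have ht0 : 0 < (1 + C)⁻¹ := by positivity
  refine ⟨(1 + C)⁻¹, ht0.ne', fun p hp => ?_⟩
  have hpa := mem_Sp2m_iff_adm.1 hp
  obtain ⟨U, hU, hU0⟩ := exists_isLocalParam hm ht0.ne' hp
  refine ⟨U, param m (1 + C)⁻¹ p, 0, hU, hU0, param_zero hpa, fun v hv => ?_⟩
  simp only [ricci_metricCoeff hm ht0.ne' hpa]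
  have h := jetRicci_pos (t := (1 + C)⁻¹) (s := formDD m p) (by simp) (formD_antisymm hm hpa)
    (mixE_antisymm (t := (1 + C)⁻¹) (formD_antisymm hm hpa)) sum_fibW hK ht0
    (inv_le_one_of_one_le₀ (by linarith))
    (by rw [← hC, inv_mul_le_one₀ (by positivity)]; linarith) (hb p hp).1 (hb p hp).2
    (fun k => v ((idx m).symm k)) (fun h0 => hv (funext fun i => by
      simpa using congrFun h0 (idx m i)))
  rw [← (idx m).sum_comp] at h
  simp only [← (idx m).sum_comp (fun j => jetRicci _ _ _ j * _ * v ((idx m).symm j)),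
    Equiv.symm_apply_apply] at h
  exact h

lemma isSubmanifold_Sp2m (hm : 1 < m) : IsSubmanifold (3 * m + 4) (Sp2m m) := fun p hp => by
  obtain ⟨U, hU, hU0⟩ := exists_isLocalParam hm one_ne_zero hp
  exact ⟨U, _, hU, 0, hU0, param_zero (mem_Sp2m_iff_adm.1 hp)⟩

end Positivity

end Wilhelm

end

theorem mainTheorem10 (m : ℕ) (hm : 2 < m) :
    Wilhelm.IsSubmanifold (3 * m + 4) (Wilhelm.Sp2m m) ∧
    Wilhelm.IsTrivialPrincipalS3Bundle (Wilhelm.Sp2m m) (Wilhelm.Sp2m (m - 1))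
      (Wilhelm.forgetLast m) (Wilhelm.lastAction m) ∧
    Wilhelm.AreDiffeomorphic (Wilhelm.Sp2m m) (Wilhelm.S3pow (m - 2) ×ˢ Wilhelm.Sp2) ∧
    ∃ g : (Fin m → ℍ[ℝ] × ℍ[ℝ]) →
        (Fin m → ℍ[ℝ] × ℍ[ℝ]) →L[ℝ] (Fin m → ℍ[ℝ] × ℍ[ℝ]) →L[ℝ] ℝ,
      Wilhelm.IsRiemannianMetric (Wilhelm.Sp2m m) g ∧
      Wilhelm.HasPosRicci (3 * m + 4) (Wilhelm.Sp2m m) g ∧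
      ∀ p ∈ Wilhelm.S3, ∀ q ∈ Wilhelm.S3pow m,
        Wilhelm.PreservesMetric (Wilhelm.Sp2m m) g (Wilhelm.wilhelmAction m p q) := by
  obtain ⟨k, rfl⟩ : ∃ k, m = k + 3 := ⟨m - 3, by omega⟩
  obtain ⟨t, ht, hR⟩ := Wilhelm.exists_hasPosRicci (m := k + 3) (by omega)
  exact ⟨Wilhelm.isSubmanifold_Sp2m (by omega), Wilhelm.isTrivialPrincipalS3Bundle_Sp2m k,
    Wilhelm.areDiffeomorphic_Sp2m (k + 1), Wilhelm.connMetric (k + 3) t,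
    Wilhelm.isRiemannianMetric_connMetric (by omega) ht, hR,
    fun p hp q hq => Wilhelm.preservesMetric_wilhelmAction (by omega) t hp hq⟩
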